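/- Let $n,L\ge 1$, and let $H=\sum_{l=1}^{L}\alpha_l H_l$ be an $n$-qubit Hamiltonian, where $\alpha_l\ge 0$ and the $H_l$ are unitaries that are efficiently simulatable, in the sense that each controlled-$H_l$ is a product of at most $\kappa n$ elementary gates (unitaries on at most two qubits) for a constant $\kappa$. Consider one segment, $U=e^{-iH\tau}$ with $\tau\sum_l\alpha_l=\ln 2$. For truncation orders $0\le K_1\le K_2$, $K_2\ge 1$, and a mixing probability $p\in[0,1)$, put $$F_1=\sum_{k=0}^{K_1}\frac{(-iH\tau)^k}{k!},\qquad F_2=\sum_{k=0}^{K_1}\frac{(-iH\tau)^k}{k!}+\frac1{1-p}\sum_{k=K_1+1}^{K_2}\frac{(-iH\tau)^k}{k!}.$$ Expanding the powers of $H$ gives linear combinations of unitaries $F_i=\sum_{j\in J_i}\beta^{(i)}_j\tilde V_j$, where $J_i=\{(k,l_1,\dots,l_k):k\le K_i,\ 1\le l_m\le L\}$, $\tilde V_j=(-i)^kH_{l_1}\cdots H_{l_k}$ and $\beta^{(i)}_j\ge 0$ is the corresponding coefficient. Let $s_1$ be any number with $\sum_{j\in J_1}\beta^{(1)}_j\le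 s_1\le 2$, let $s_2=1/\sin(\pi/10)$, and assume that $\sum_{j\in J_2}\beta^{(2)}_j\le s_2$ (this holds in particular if $p\le 1/(1+2\delta_1)$ with $\delta_1$ as below). In each case add two terms $\pm\gamma\mathbb 1$ with $\gamma\ge0$, which cancel, so that the coefficients sum to $s_i$. Let $W_i=(G_i^\dagger\otimes\mathbb 1)\,\mathrm{SELECT}_i\,(G_i\otimes\mathbb 1)$ be built from the corresponding oracles $G_i|0\rangle=s_i^{-1/2}\sum_j\sqrt{\beta_j}\,|j\rangle$ and $\mathrm{SELECT}_i|j\rangle|\psi\rangle=|j\rangle\tilde V_j|\psi\rangle$, and let $R=(\mathbb 1-2|0\rangle\langle0|)\otimes\mathbb 1$ and $T_i=-W_iRW_i^\dagger R$. The segment circuits $\mathfrak V_1$ and $\mathfrak V_2$ perform $T_1W_1$ and $T_2T_2W_2$ (oblivious amplitude amplification), possibly with further clean work qubits. Then $\mathfrak V_i:|0\rangle|\psi\rangle\mapsto|0\rangle V_i|\psi\rangle+|\perp_i\rangle$ with $(\langle0|\otimes\mathbb 1)|\perp_i\rangle=0$ and $$V_1=\frac3{s_1}F_1-\frac4{s_1^3}F_1F_1^\dagger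 F_1,\qquad V_2=\frac5{s_2}F_2-\frac{20}{s_2^3}F_2F_2^\dagger F_2+\frac{16}{s_2^5}F_2F_2^\dagger F_2F_2^\dagger F_2 .$$ Write $\delta_1=2\frac{(\ln2)^{K_1+1}}{(K_1+1)!}$ and $\delta_m=2\frac{(\ln2)^{K_2+1}}{(K_2+1)!}$. 1. (Error) For every density matrix $\rho$, the mixed channel $\mathcal V_{\mathrm{mix}}(\rho)=pV_1\rho V_1^\dagger+(1-p)V_2\rho V_2^\dagger$ satisfies $$\left\|\mathcal V_{\mathrm{mix}}(\rho)-U\rho U^\dagger\right\|_1\le\max\left\{\frac{40}{1-p}\delta_1^2,\ 8\delta_m\right\}.$$ 2. (Failure probability) If $\mathfrak V_1$ is run with probability $p$ and $\mathfrak V_2$ with probability $1-p$ on $|0\rangle\langle 0|\otimes\rho$, then the probability that the final measurement of the ancilla register does not give $|0\rangle$ is at most $\frac{8}{1-p}\delta_1^2+4\delta_1$, for every density matrix $\rho$. 3. (Cost) Such circuits $\mathfrak V_1,\mathfrak V_2$ exist with expected number of elementary gates $G=p\,|\mathfrak V_1|+(1-p)\,|\mathfrak V_2|=\tilde{\mathcal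 O}\big(nL(pK_1+(1-p)K_2)\big)$: there are constants $C,e$ depending only on $\kappa$ with $G\le C\,g\,(\log(2+g))^{e}$, where $g=nL(pK_1+(1-p)K_2)$. -/

import Mathlib

open scoped Matrix Kronecker ComplexOrder

noncomputable section

namespace RTS

/-! ### Registers, gates, circuits -/

/-- Computational basis states of a register of qubits indexed by `ι`. -/
abbrev Basis (ι : Type) := ι → Bool

/-- Operators on the register of qubits indexed by `ι`, as matrices in the computational basis. -/
abbrev Op (ι : Type) := Matrix (Basis ι) (Basis ι) ℂ

/-- The all-zero basis state. -/
def zero (ι : Type) : Basis ι := fun _ => false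

/-- An elementary gate: an arbitrary unitary acting on at most two of the qubits. -/
structure Gate (ι : Type) [DecidableEq ι] where
  wires : Finset ι
  card_le : wires.card ≤ 2
  mat : Matrix.unitaryGroup (Basis wires) ℂ

/-- The action of a gate on the whole register: the gate on its wires, the identity elsewhere. -/
def Gate.op {ι : Type} [Fintype ι] [DecidableEq ι] (g : Gate ι) : Op ι :=
  Matrix.of fun x y =>
    if ∀ i, i ∉ g.wires → x i = y i then
      (g.mat : Op g.wires) (fun i => x i) (fun i => y i)
    else 0

/-- A circuit is a list of elementary gates, applied from left to right;
its gate count is the length of the list. -/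
abbrev Circuit (ι : Type) [DecidableEq ι] := List (Gate ι)

/-- The operator that a circuit performs. -/
def Circuit.op {ι : Type} [Fintype ι] [DecidableEq ι] : Circuit ι → Op ι
  | [] => 1
  | g :: c => Circuit.op c * g.op

/-- The controlled-`V` operator, with one control qubit `Sum.inl ()`. -/
def controlled {n : ℕ} (V : Op (Fin n)) : Op (Unit ⊕ Fin n) :=
  Matrix.of fun x y =>
    if x (Sum.inl ()) = y (Sum.inl ()) then
      (if x (Sum.inl ()) = true then V else 1) (x ∘ Sum.inr) (y ∘ Sum.inr)
    else 0

/-! ### States and the trace norm -/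

/-- Density matrices. -/
def IsDensity {ι : Type} [Fintype ι] [DecidableEq ι] (ρ : Op ι) : Prop :=
  ρ.PosSemidef ∧ ρ.trace = 1

/-- The trace norm `Tr √(X† X)`: the sum of the singular values of `X`. -/
def traceNorm {m : Type} [Fintype m] [DecidableEq m] (X : Matrix m m ℂ) : ℝ :=
  ∑ i, √((Matrix.isHermitian_conjTranspose_mul_self X).eigenvalues i)

/-- The mixed channel `ρ ↦ p V₁ ρ V₁† + (1 - p) V₂ ρ V₂†`. -/
def mixChannel {m : Type} [Fintype m] (p : ℝ) (V₁ V₂ ρ : Matrix m m ℂ) : Matrix m m ℂ :=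
  (p : ℂ) • (V₁ * ρ * V₁ᴴ) + ((1 - p : ℝ) : ℂ) • (V₂ * ρ * V₂ᴴ)

/-! ### The truncated Taylor series and the amplified operators -/

/-- `δ_K = 2 (ln 2)^(K+1) / (K+1)!`. -/
def delta (K : ℕ) : ℝ := 2 * Real.log 2 ^ (K + 1) / (K + 1).factorial

/-- The amplification target `s₂ = 1 / sin (π / 10)`. -/
def sTwo : ℝ := (Real.sin (Real.pi / 10))⁻¹

/-- The Hamiltonian `H = ∑ α_l H_l`. -/
def hamiltonian {n L : ℕ} (α : Fin L → ℝ)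
    (Hl : Fin L → Matrix.unitaryGroup (Basis (Fin n)) ℂ) : Op (Fin n) :=
  ∑ l, (α l : ℂ) • (Hl l : Op (Fin n))

/-- The ideal evolution `exp (-i H τ)` of a segment. -/
def idealU {n : ℕ} (H : Op (Fin n)) (τ : ℝ) : Op (Fin n) :=
  NormedSpace.exp ((-(Complex.I * (τ : ℂ))) • H)

/-- The `k`-th Taylor term `(-i H τ)^k / k!`. -/
def taylorTerm {n : ℕ} (H : Op (Fin n)) (τ : ℝ) (k : ℕ) : Op (Fin n) :=
  ((k.factorial : ℂ)⁻¹) • ((-(Complex.I * (τ : ℂ))) • H) ^ k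

/-- `F₁`, the series truncated at order `K₁`. -/
def F₁ {n : ℕ} (H : Op (Fin n)) (τ : ℝ) (K₁ : ℕ) : Op (Fin n) :=
  ∑ k ∈ Finset.range (K₁ + 1), taylorTerm H τ k

/-- `F₂`, in which the terms of order `K₁ + 1, …, K₂` are amplified by `1 / (1 - p)`. -/
def F₂ {n : ℕ} (H : Op (Fin n)) (τ p : ℝ) (K₁ K₂ : ℕ) : Op (Fin n) :=
  ∑ k ∈ Finset.range (K₁ + 1), taylorTerm H τ k +
    ((1 / (1 - p) : ℝ) : ℂ) • ∑ k ∈ Finset.Ioc K₁ K₂, taylorTerm H τ k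

/-- `V₁ = (3/s) F - (4/s³) F F† F`. -/
def amp₁ {m : Type} [Fintype m] (s : ℝ) (F : Matrix m m ℂ) : Matrix m m ℂ :=
  ((3 / s : ℝ) : ℂ) • F - ((4 / s ^ 3 : ℝ) : ℂ) • (F * Fᴴ * F)

/-- `V₂ = (5/s) F - (20/s³) F F† F + (16/s⁵) F F† F F† F`. -/
def amp₂ {m : Type} [Fintype m] (s : ℝ) (F : Matrix m m ℂ) : Matrix m m ℂ :=
  ((5 / s : ℝ) : ℂ) • F - ((20 / s ^ 3 : ℝ) : ℂ) • (F * Fᴴ * F) +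
    ((16 / s ^ 5 : ℝ) : ℂ) • (F * Fᴴ * F * Fᴴ * F)

/-! ### The linear combination of unitaries -/

/-- The index set `{(k, l₁, …, l_k) : k ≤ K, l_m ∈ {1, …, L}}`. -/
abbrev TaylorIndex (L K : ℕ) := Σ k : Fin (K + 1), (Fin k → Fin L)

/-- The coefficient `c_k τ^k α_{l₁} ⋯ α_{l_k} / k!`, where `c_k` is the amplification of order
`k`. -/
def taylorCoeff {L K : ℕ} (c : ℕ → ℝ) (τ : ℝ) (α : Fin L → ℝ) (j : TaylorIndex L K) : ℝ :=
  c j.1 * (τ ^ (j.1 : ℕ) * (∏ m, α (j.2 m)) / (j.1 : ℕ).factorial)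

/-- The unitary `(-i)^k H_{l₁} ⋯ H_{l_k}`. -/
def taylorUnitary {n L K : ℕ} (Hl : Fin L → Matrix.unitaryGroup (Basis (Fin n)) ℂ)
    (j : TaylorIndex L K) : Op (Fin n) :=
  (-Complex.I) ^ (j.1 : ℕ) • (List.ofFn fun m => (Hl (j.2 m) : Op (Fin n))).prod

/-- The sum `∑_j β_j` of the coefficients. -/
def coeffSum {L : ℕ} (K : ℕ) (c : ℕ → ℝ) (τ : ℝ) (α : Fin L → ℝ) : ℝ :=
  ∑ j : TaylorIndex L K, taylorCoeff c τ α j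

/-- The amplification used for `F₁`: none. -/
def weight₁ : ℕ → ℝ := fun _ => 1

/-- The amplification used for `F₂`: the orders above `K₁` are multiplied by `1 / (1 - p)`. -/
def weight₂ (p : ℝ) (K₁ : ℕ) : ℕ → ℝ := fun k => if k ≤ K₁ then 1 else 1 / (1 - p)

/-- The index set of the linear combination. The two additional indices carry the terms `+γ 1`
and `-γ 1`, which cancel and bring the sum of the coefficients up to the prescribed value `s`. -/
abbrev LCUIndex (L K : ℕ) := TaylorIndex L K ⊕ Bool

/-- The coefficients `β_j` of the linear combination; they add up to `s`. -/
def lcuCoeff {L K : ℕ} (c : ℕ → ℝ) (τ : ℝ) (α : Fin L → ℝ) (s : ℝ) : LCUIndex L K → ℝ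
  | Sum.inl j => taylorCoeff c τ α j
  | Sum.inr _ => (s - coeffSum K c τ α) / 2

/-- The unitaries of the linear combination. -/
def lcuUnitary {n L K : ℕ} (Hl : Fin L → Matrix.unitaryGroup (Basis (Fin n)) ℂ) :
    LCUIndex L K → Op (Fin n)
  | Sum.inl j => taylorUnitary Hl j
  | Sum.inr b => if b then 1 else -1

/-! ### The segment circuit: linear combination of unitaries and amplitude amplification -/

/-- Operators on an ancilla register of `a` qubits and the system of `n` qubits. -/
abbrev JointOp (a n : ℕ) :=
  Matrix (Basis (Fin a) × Basis (Fin n)) (Basis (Fin a) × Basis (Fin n)) ℂ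

/-- `W = (G† ⊗ 1) SELECT (G ⊗ 1)`. -/
def lcuW {a n : ℕ} (G : Op (Fin a)) (sel : JointOp a n) : JointOp a n :=
  (Gᴴ ⊗ₖ (1 : Op (Fin n))) * sel * (G ⊗ₖ (1 : Op (Fin n)))

/-- `R = (1 - 2 |0⟩⟨0|) ⊗ 1`. -/
def reflection (a n : ℕ) : JointOp a n :=
  (1 - (2 : ℂ) • Matrix.single (zero (Fin a)) (zero (Fin a)) (1 : ℂ)) ⊗ₖ (1 : Op (Fin n))

/-- `T = - W R W† R`. -/
def ampStep {a n : ℕ} (W : JointOp a n) : JointOp a n :=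
  -(W * reflection a n * Wᴴ * reflection a n)

/-- The qubits of a segment circuit: the system, the ancilla register of the linear combination,
and clean work qubits. -/
abbrev SegWires (n a w : ℕ) := Fin n ⊕ (Fin a ⊕ Fin w)

/-- The basis state with system part `x`, ancilla part `u` and work part `z`. -/
def joinBasis {n a w : ℕ} (x : Basis (Fin n)) (u : Basis (Fin a)) (z : Basis (Fin w)) :
    Basis (SegWires n a w) :=
  Sum.elim x (Sum.elim u z)

/-- A circuit for one segment of the Taylor-series algorithm for `∑_j β_j Ṽ_j` with `∑_j β_j = s`:
PREPARE and SELECT on an ancilla register in which the indices `j` are encoded as basis states,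
followed by `rounds` rounds of oblivious amplitude amplification. -/
structure Segment {n L : ℕ} (K : ℕ) (c : ℕ → ℝ) (τ : ℝ) (α : Fin L → ℝ)
    (Hl : Fin L → Matrix.unitaryGroup (Basis (Fin n)) ℂ) (s : ℝ) (rounds : ℕ) where
  /-- number of ancilla qubits of the linear combination -/
  a : ℕ
  /-- number of work qubits -/
  w : ℕ
  /-- the encoding of the indices -/
  enc : LCUIndex L K ↪ Basis (Fin a)
  /-- PREPARE: `G |0⟩ = s^(-1/2) ∑_j √β_j |j⟩` -/
  G : Matrix.unitaryGroup (Basis (Fin a)) ℂ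
  G_zero : ∀ u, (G : Op (Fin a)) u (zero (Fin a)) =
    ∑ j : LCUIndex L K, if enc j = u then ((√(lcuCoeff c τ α s j / s) : ℝ) : ℂ) else 0
  /-- SELECT: `|j⟩ |ψ⟩ ↦ |j⟩ Ṽ_j |ψ⟩` -/
  sel : Matrix.unitaryGroup (Basis (Fin a) × Basis (Fin n)) ℂ
  sel_apply : ∀ (j : LCUIndex L K) (u : Basis (Fin a)) (x y : Basis (Fin n)),
    (sel : JointOp a n) (u, x) (enc j, y) = if u = enc j then lcuUnitary Hl j x y else 0
  /-- the gates -/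
  circuit : Circuit (SegWires n a w)
  /-- started with work qubits `|0⟩`, the circuit performs `T ^ rounds * W` on ancillas and system
  and returns the work qubits to `|0⟩` -/
  circuit_apply : ∀ (x y : Basis (Fin n)) (u v : Basis (Fin a)) (z : Basis (Fin w)),
    circuit.op (joinBasis x u z) (joinBasis y v (zero (Fin w))) =
      if z = zero (Fin w) then
        (ampStep (lcuW (G : Op (Fin a)) (sel : JointOp a n)) ^ rounds *
          lcuW (G : Op (Fin a)) (sel : JointOp a n)) (u, x) (v, y)
      else 0

namespace Segment

variable {n L K : ℕ} {c : ℕ → ℝ} {τ : ℝ} {α : Fin L → ℝ}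
  {Hl : Fin L → Matrix.unitaryGroup (Basis (Fin n)) ℂ} {s : ℝ} {rounds : ℕ}

/-- The gate count of the segment. -/
def cost (S : Segment K c τ α Hl s rounds) : ℕ := S.circuit.length

/-- The operator `V` with `|0⟩ |ψ⟩ ↦ |0⟩ V |ψ⟩ + |⊥⟩`, where `(⟨0| ⊗ 1) |⊥⟩ = 0`. -/
def block (S : Segment K c τ α Hl s rounds) : Op (Fin n) :=
  Matrix.of fun x y =>
    S.circuit.op (joinBasis x (zero _) (zero _)) (joinBasis y (zero _) (zero _))

/-- The initial state `ρ ⊗ |0⟩⟨0|` of the register. -/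
def initial (S : Segment K c τ α Hl s rounds) (ρ : Op (Fin n)) : Op (SegWires n S.a S.w) :=
  Matrix.of fun x y =>
    if x ∘ Sum.inr = zero _ ∧ y ∘ Sum.inr = zero _ then ρ (x ∘ Sum.inl) (y ∘ Sum.inl) else 0

/-- The probability that measuring the ancillas of the linear combination at the end gives
`|0⟩`. -/
def successProb (S : Segment K c τ α Hl s rounds) (ρ : Op (Fin n)) : ℝ :=
  ∑ x : Basis (Fin n), ∑ z : Basis (Fin S.w),
    ((S.circuit.op * S.initial ρ * S.circuit.opᴴ)
      (joinBasis x (zero _) z) (joinBasis x (zero _) z)).re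

end Segment

end RTS

end

/-! Error. Since H is Hermitian, the ideal evolution, the truncated series and the amplified
operators are all functions of H, so every operator bound reduces to a scalar bound on one
eigenvector (`mixed_operator_bounds`). There the target is a phase u and the series is a number f
close to u. Amplification keeps the phase of f and replaces the modulus s·y by P(y), where P(y) is
sin(3 arcsin y) or sin(5 arcsin y). For s = 2, respectively s = 1/sin(π/10), the modulus 1
corresponds to a point where P = 1 with zero slope. Errors of the modulus therefore enter only
quadratically, and so does a first-order shortfall of `s₁` below 2. The one first-order error that
survives is the phase error i·u·Im(f·ū), which is linear in f (`amplified_scalar`).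

The reweighting in `F₂` is chosen so that p·f₁ + (1-p)·f₂ is exactly the series truncated at `K₂`.
The phase errors of the two circuits thus average to at most the tail beyond `K₂`
(`mixed_scalar_bounds`). A mixed channel is governed by the squares of the individual errors and by
the error of the average (`traceNorm_mixChannel_sub_le`), which yields the maximum of a term in δ₁²
and a term in δ_m.

Failure. The blocks of the circuits are the amplified operators: with R = 1 - 2Π and Π the projector
onto ancilla zero, expand the amplification steps and use that the zero block is multiplicative
across Π (`zeroBlock_mul_mul`). The failure probability is governed by 1 - V†V, which depends on the
modulus alone and is again quadratic in the tail.

Cost. The order k is held in unary flags and each l_m in a one-hot block of wires. Then PREPARE is a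
chain of controlled rotations (`exists_prepare`), SELECT is a product of singly controlled H_l,
phases and signs (`exists_select`), and the reflection is a conjunction that is computed, used and
uncomputed (`exists_reflection`). A segment costs O(n L (K+1)) gates, and the +1 is absorbed by
`one_le_mean_order`, so no logarithm is needed. -/

set_option linter.unusedSectionVars false

noncomputable section

namespace RTS

section

variable {ι κ : Type} [Fintype ι] [DecidableEq ι] [Fintype κ] [DecidableEq κ]

/-! ### Basis vectors and lifted operators -/

/-- The computational basis vector `|x⟩`. -/
def ket (x : Basis ι) : Basis ι → ℂ := Pi.single x 1

theorem ket_apply (x y : Basis ι) : ket x y = if y = x then 1 else 0 := by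
  simp [ket, Pi.single_apply]

theorem mulVec_ket (A : Op ι) (y x : Basis ι) : (A *ᵥ ket y) x = A x y := by
  simp [ket]

theorem op_ext {A B : Op ι} (h : ∀ y, A *ᵥ ket y = B *ᵥ ket y) : A = B := by
  refine Matrix.ext fun x y => ?_
  rw [← mulVec_ket A, h, mulVec_ket B]

/-- The operator on the register `κ` that acts as `A` on the wires `f i` and as the identity on the
other wires. -/
def lift (f : ι → κ) (A : Op ι) : Op κ :=
  Matrix.of fun x y =>
    if ∀ k, (∀ i, f i ≠ k) → x k = y k then A (x ∘ f) (y ∘ f) else 0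

/-- Translates the agreement condition in the entries of `lift` into a formula for the basis states
reachable from y. Identities for `lift` can then be checked on kets. -/
theorem eq_extend_iff {f : ι → κ} (hf : Function.Injective f) (x y : Basis κ) (b : Basis ι) :
    x = Function.extend f b y ↔ (∀ k, (∀ i, f i ≠ k) → x k = y k) ∧ b = x ∘ f := by
  constructor
  · rintro rfl
    refine ⟨fun k hk => ?_, ?_⟩
    · rw [Function.extend_apply']
      rintro ⟨i, hi⟩
      exact hk i hi
    · ext i
      simp [hf.extend_apply]
  · rintro ⟨h, rfl⟩
    ext k
    by_cases hk : ∃ i, f i = k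
    · obtain ⟨i, rfl⟩ := hk
      simp [hf.extend_apply]
    · rw [Function.extend_apply' _ _ _ hk, h k (by simpa using hk)]

theorem lift_ket {f : ι → κ} (hf : Function.Injective f) (A : Op ι) (y : Basis κ) :
    lift f A *ᵥ ket y = ∑ b, A b (y ∘ f) • ket (Function.extend f b y) := by
  ext x
  rw [mulVec_ket, Finset.sum_apply]
  simp only [Pi.smul_apply, ket_apply, smul_eq_mul, mul_ite, mul_one, mul_zero,
    eq_extend_iff hf, lift, Matrix.of_apply, ite_and]
  split_ifs with h
  · simp
  · simp

theorem extend_comp_self {f : ι → κ} (hf : Function.Injective f) (b : Basis ι) (y : Basis κ) :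
    Function.extend f b y ∘ f = b := by
  ext i
  simp [hf.extend_apply]

theorem extend_extend {f : ι → κ} (hf : Function.Injective f) (b c : Basis ι) (y : Basis κ) :
    Function.extend f b (Function.extend f c y) = Function.extend f b y := by
  rw [eq_extend_iff hf]
  refine ⟨fun k hk => ?_, (extend_comp_self hf _ _).symm⟩
  have : ¬ ∃ i, f i = k := by simpa using hk
  rw [Function.extend_apply' _ _ _ this, Function.extend_apply' _ _ _ this]

theorem lift_mul {f : ι → κ} (hf : Function.Injective f) (A B : Op ι) :
    lift f (A * B) = lift f A * lift f B := by
  refine op_ext fun y => ?_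
  rw [← Matrix.mulVec_mulVec, lift_ket hf, lift_ket hf, Matrix.mulVec_sum]
  simp only [Matrix.mulVec_smul, lift_ket hf, extend_comp_self hf, extend_extend hf,
    Finset.smul_sum, smul_smul, Matrix.mul_apply, Finset.sum_smul]
  rw [Finset.sum_comm]
  simp only [mul_comm]

theorem lift_one {f : ι → κ} (hf : Function.Injective f) : lift f (1 : Op ι) = 1 := by
  refine op_ext fun y => ?_
  rw [lift_ket hf, Finset.sum_eq_single (y ∘ f)]
  · have : Function.extend f (y ∘ f) y = y := ((eq_extend_iff hf _ _ _).2 ⟨fun _ _ => rfl, rfl⟩).symm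
    simp [this]
  · intro b _ hb
    simp [Matrix.one_apply_ne hb]
  · simp

theorem lift_conjTranspose (f : ι → κ) (A : Op ι) : lift f Aᴴ = (lift f A)ᴴ := by
  ext x y
  simp only [lift, Matrix.of_apply, Matrix.conjTranspose_apply]
  have : (∀ k, (∀ i, f i ≠ k) → x k = y k) ↔ ∀ k, (∀ i, f i ≠ k) → y k = x k :=
    forall_congr' fun k => by rw [eq_comm]
  simp only [this]
  split_ifs <;> simp

theorem lift_lift {μ : Type} [Fintype μ] [DecidableEq μ] {f : ι → κ} {g : κ → μ}
    (hg : Function.Injective g) (A : Op ι) : lift g (lift f A) = lift (g ∘ f) A := by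
  ext x y
  simp only [lift, Matrix.of_apply, ← ite_and]
  have : ((∀ k, (∀ i, g i ≠ k) → x k = y k) ∧
      ∀ k, (∀ i, f i ≠ k) → (x ∘ g) k = (y ∘ g) k) ↔ ∀ k, (∀ i, (g ∘ f) i ≠ k) → x k = y k := by
    constructor
    · rintro ⟨h1, h2⟩ k hk
      by_cases hgk : ∃ m, g m = k
      · obtain ⟨m, rfl⟩ := hgk
        exact h2 m fun i hi => hk i (by simp [hi])
      · exact h1 k (by simpa using hgk)
    · intro h
      refine ⟨fun k hk => h k fun i => hk _, fun k hk => h _ fun i hi => hk i (hg hi)⟩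
  simp only [this]
  rfl

theorem lift_mem_unitaryGroup {f : ι → κ} (hf : Function.Injective f) {A : Op ι}
    (hA : A ∈ Matrix.unitaryGroup (Basis ι) ℂ) :
    lift f A ∈ Matrix.unitaryGroup (Basis κ) ℂ := by
  rw [Matrix.mem_unitaryGroup_iff, Matrix.star_eq_conjTranspose] at *
  rw [← lift_conjTranspose, ← lift_mul hf, hA, lift_one hf]

/-! ### Gates and circuits -/

theorem Gate.op_eq_lift (g : Gate ι) : g.op = lift (Subtype.val : g.wires → ι) (g.mat : Op g.wires) := by
  ext x y
  simp only [Gate.op, lift, Matrix.of_apply]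
  have : (∀ i, i ∉ g.wires → x i = y i) ↔
      ∀ k, (∀ i : g.wires, (i : ι) ≠ k) → x k = y k :=
    forall_congr' fun k => by
      refine imp_congr_left ⟨fun h i hi => h (hi ▸ i.2), fun h hk => h ⟨k, hk⟩ rfl⟩
  simp only [this]
  rfl

/-- An injective map of the wires, restricted to a set of wires and its image. -/
def wiresMap (f : ι ↪ κ) (s : Finset ι) : s → s.map f :=
  fun i => ⟨f i, Finset.mem_map_of_mem f i.2⟩

theorem wiresMap_injective (f : ι ↪ κ) (s : Finset ι) : Function.Injective (wiresMap f s) :=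
  fun _ _ h => Subtype.ext (f.injective (congrArg Subtype.val h))

/-- The gate moved along an injective map of the wires. -/
def Gate.map (f : ι ↪ κ) (g : Gate ι) : Gate κ where
  wires := g.wires.map f
  card_le := by simpa using g.card_le
  mat := ⟨lift (wiresMap f g.wires) (g.mat : Op g.wires),
    lift_mem_unitaryGroup (wiresMap_injective f g.wires) g.mat.2⟩

/-- Both sides are lifts of the small matrix of the gate along the same composite map of wires, so
`lift_lift` identifies them. -/
theorem Gate.map_op (f : ι ↪ κ) (g : Gate ι) : (g.map f).op = lift f g.op := by
  rw [Gate.op_eq_lift, Gate.op_eq_lift g, lift_lift f.injective]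
  exact lift_lift Subtype.val_injective _

/-- The inverse gate. -/
def Gate.inv (g : Gate ι) : Gate ι where
  wires := g.wires
  card_le := g.card_le
  mat := star g.mat

theorem Gate.inv_op (g : Gate ι) : g.inv.op = g.opᴴ := by
  rw [Gate.op_eq_lift, Gate.op_eq_lift, ← lift_conjTranspose]
  rfl

theorem Gate.op_mem (g : Gate ι) : g.op ∈ Matrix.unitaryGroup (Basis ι) ℂ := by
  rw [Gate.op_eq_lift]
  exact lift_mem_unitaryGroup Subtype.val_injective g.mat.2

theorem Circuit.op_append (c d : Circuit ι) :
    Circuit.op (c ++ d) = Circuit.op d * Circuit.op c := by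
  induction c with
  | nil => simp [Circuit.op]
  | cons g c ih =>
    rw [List.cons_append, Circuit.op, Circuit.op, ih, mul_assoc]

theorem Circuit.op_mem (c : Circuit ι) : c.op ∈ Matrix.unitaryGroup (Basis ι) ℂ := by
  induction c with
  | nil => exact one_mem _
  | cons g c ih => exact mul_mem ih g.op_mem

/-- `A` is performed by a circuit of at most `N` gates. -/
def Implementable (A : Op ι) (N : ℕ) : Prop :=
  ∃ c : Circuit ι, c.op = A ∧ c.length ≤ N

namespace Implementable

variable {A B : Op ι} {M N : ℕ}

theorem one : Implementable (1 : Op ι) 0 := ⟨[], rfl, le_rfl⟩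

theorem mono (h : Implementable A M) (hMN : M ≤ N) : Implementable A N :=
  let ⟨c, hc, hl⟩ := h
  ⟨c, hc, hl.trans hMN⟩

theorem mul (hA : Implementable A M) (hB : Implementable B N) : Implementable (A * B) (M + N) := by
  obtain ⟨c, rfl, hc⟩ := hA
  obtain ⟨d, rfl, hd⟩ := hB
  refine ⟨d ++ c, Circuit.op_append _ _, ?_⟩
  rw [List.length_append]
  omega

theorem pow (hA : Implementable A M) (k : ℕ) : Implementable (A ^ k) (k * M) := by
  induction k with
  | zero => simpa using one
  | succ k ih => rw [pow_succ, Nat.succ_mul]; exact ih.mul hA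

theorem conjTranspose (hA : Implementable A M) : Implementable Aᴴ M := by
  obtain ⟨c, rfl, hc⟩ := hA
  induction c generalizing M with
  | nil => exact ⟨[], by simp [Circuit.op], by simp⟩
  | cons g c ih =>
    rw [Circuit.op, Matrix.conjTranspose_mul]
    have h1 : Implementable g.opᴴ 1 := ⟨[g.inv], by simp [Circuit.op, Gate.inv_op], le_rfl⟩
    refine (h1.mul (ih (M := c.length) le_rfl)).mono ?_
    simpa [add_comm] using hc

theorem lift (f : ι ↪ κ) (hA : Implementable A M) : Implementable (lift f A) M := by
  obtain ⟨c, rfl, hc⟩ := hA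
  refine ⟨c.map (Gate.map f), ?_, by simpa using hc⟩
  clear hc
  induction c with
  | nil => exact (lift_one f.injective).symm
  | cons g c ih =>
    rw [List.map_cons, Circuit.op, Circuit.op, ih, Gate.map_op, lift_mul f.injective]

theorem mem_unitaryGroup (hA : Implementable A M) : A ∈ Matrix.unitaryGroup (Basis ι) ℂ := by
  obtain ⟨c, rfl, -⟩ := hA
  exact c.op_mem

theorem listProd {l : List (Op ι)} (h : ∀ A ∈ l, Implementable A M) :
    Implementable l.prod (l.length * M) := by
  induction l with
  | nil => simpa using one
  | cons A l ih =>
    rw [List.prod_cons, List.length_cons, Nat.succ_mul, add_comm]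
    exact (h A (by simp)).mul (ih fun B hB => h B (by simp [hB]))

end Implementable

/-! ### Multiplexed one-qubit gates -/

/-- The one-qubit operator `U b` on the wire `j`, where `b` is the value of the wire `i`. -/
def mux (i j : ι) (U : Bool → Matrix Bool Bool ℂ) : Op ι :=
  Matrix.of fun x y => if ∀ k, k ≠ j → x k = y k then U (y i) (x j) (y j) else 0

theorem mux_ket (i j : ι) (U : Bool → Matrix Bool Bool ℂ) (y : Basis ι) :
    mux i j U *ᵥ ket y = ∑ b, U (y i) b (y j) • ket (Function.update y j b) := by
  ext x
  rw [mulVec_ket, Finset.sum_apply]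
  have key : ∀ b, x = Function.update y j b ↔ (∀ k, k ≠ j → x k = y k) ∧ b = x j := fun b => by
    rw [Function.eq_update_iff, and_comm, eq_comm]
  simp only [Pi.smul_apply, ket_apply, smul_eq_mul, mul_ite, mul_one, mul_zero, key, mux,
    Matrix.of_apply, ite_and]
  split_ifs with h
  · simp only [Finset.sum_ite_eq', Finset.mem_univ, if_true]
  · simp

theorem mux_mul {i j : ι} (hij : i ≠ j) (U V : Bool → Matrix Bool Bool ℂ) :
    mux i j U * mux i j V = mux i j fun b => U b * V b := by
  refine op_ext fun y => ?_
  rw [← Matrix.mulVec_mulVec, mux_ket, mux_ket, Matrix.mulVec_sum]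
  simp only [Matrix.mulVec_smul, mux_ket, Function.update_self, Function.update_of_ne hij,
    Function.update_idem, Finset.smul_sum, smul_smul, Matrix.mul_apply, Finset.sum_smul]
  rw [Finset.sum_comm]
  simp only [mul_comm]

theorem mux_smul_one (i j : ι) (a : ℂ) : mux i j (fun _ => a • 1) = a • (1 : Op ι) := by
  refine op_ext fun y => ?_
  rw [mux_ket, Finset.sum_eq_single (y j)]
  · simp [Matrix.smul_mulVec]
  · intro b _ hb
    simp [Matrix.one_apply_ne hb]
  · simp

theorem mux_conjTranspose {i j : ι} (hij : i ≠ j) (U : Bool → Matrix Bool Bool ℂ) :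
    (mux i j U)ᴴ = mux i j fun b => (U b)ᴴ := by
  ext x y
  simp only [mux, Matrix.of_apply, Matrix.conjTranspose_apply]
  by_cases h : ∀ k, k ≠ j → x k = y k
  · have h' : ∀ k, k ≠ j → y k = x k := fun k hk => (h k hk).symm
    rw [if_pos h, if_pos h', h i hij]
  · have h' : ¬ ∀ k, k ≠ j → y k = x k := fun h' => h fun k hk => (h' k hk).symm
    rw [if_neg h, if_neg h', star_zero]

theorem mux_mem_unitaryGroup {i j : ι} (hij : i ≠ j) {U : Bool → Matrix Bool Bool ℂ}
    (hU : ∀ b, U b ∈ Matrix.unitaryGroup Bool ℂ) :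
    mux i j U ∈ Matrix.unitaryGroup (Basis ι) ℂ := by
  rw [Matrix.mem_unitaryGroup_iff, Matrix.star_eq_conjTranspose, mux_conjTranspose hij,
    mux_mul hij]
  have : (fun b => U b * (U b)ᴴ) = fun _ => (1 : ℂ) • 1 := by
    ext1 b
    rw [one_smul]
    exact Matrix.mem_unitaryGroup_iff.1 (hU b)
  rw [this, mux_smul_one, one_smul]

theorem lift_mux {f : ι → κ} (hf : Function.Injective f) (i j : ι)
    (U : Bool → Matrix Bool Bool ℂ) : lift f (mux i j U) = mux (f i) (f j) U := by
  ext x y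
  simp only [lift, mux, Matrix.of_apply, ← ite_and]
  have : ((∀ k, (∀ i, f i ≠ k) → x k = y k) ∧ ∀ k, k ≠ j → (x ∘ f) k = (y ∘ f) k) ↔
      ∀ k, k ≠ f j → x k = y k := by
    constructor
    · rintro ⟨h1, h2⟩ k hk
      by_cases hfk : ∃ m, f m = k
      · obtain ⟨m, rfl⟩ := hfk
        exact h2 m fun h => hk (h ▸ rfl)
      · exact h1 k (by simpa using hfk)
    · intro h
      exact ⟨fun k hk => h k (hk j).symm, fun k hk => h _ fun e => hk (hf e)⟩
  simp only [this]
  rfl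

/-- The operator is a lift from the two wires i and j. Apart from the given controlled unitaries,
all circuits below are products of such gates; an uncontrolled one-qubit gate is the case of
constant U, with i a dummy wire. -/
theorem implementable_mux {i j : ι} (hij : i ≠ j) {U : Bool → Matrix Bool Bool ℂ}
    (hU : ∀ b, U b ∈ Matrix.unitaryGroup Bool ℂ) : Implementable (mux i j U) 1 := by
  have hi : i ∈ ({i, j} : Finset ι) := by simp
  have hj : j ∈ ({i, j} : Finset ι) := by simp
  refine ⟨[⟨{i, j}, Finset.card_le_two, ⟨mux ⟨i, hi⟩ ⟨j, hj⟩ U,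
    mux_mem_unitaryGroup (by simpa using hij) hU⟩⟩], ?_, le_rfl⟩
  rw [Circuit.op, Circuit.op, one_mul, Gate.op_eq_lift]
  exact lift_mux Subtype.val_injective _ _ _

/-! ### Block-diagonal operators -/

/-- `∑_u V_u ⊗ |u⟩⟨u|`. -/
def multiControlled (V : Basis κ → Op ι) : Op (ι ⊕ κ) :=
  Matrix.of fun x y =>
    if x ∘ Sum.inr = y ∘ Sum.inr then V (y ∘ Sum.inr) (x ∘ Sum.inl) (y ∘ Sum.inl) else 0

theorem multiControlled_ket (V : Basis κ → Op ι) (y : Basis (ι ⊕ κ)) :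
    multiControlled V *ᵥ ket y =
      ∑ b, V (y ∘ Sum.inr) b (y ∘ Sum.inl) • ket (Sum.elim b (y ∘ Sum.inr)) := by
  ext x
  rw [mulVec_ket, Finset.sum_apply]
  have key : ∀ b : Basis ι, x = Sum.elim b (y ∘ Sum.inr) ↔
      x ∘ Sum.inr = y ∘ Sum.inr ∧ b = x ∘ Sum.inl := fun b => by
    constructor
    · rintro rfl
      simp
    · rintro ⟨h, rfl⟩
      rw [← h, Sum.elim_comp_inl_inr]
  simp only [Pi.smul_apply, ket_apply, smul_eq_mul, mul_ite, mul_one, mul_zero, key,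
    multiControlled, Matrix.of_apply, ite_and]
  split_ifs with h
  · simp
  · simp

theorem multiControlled_mul (V V' : Basis κ → Op ι) :
    multiControlled V * multiControlled V' = multiControlled fun u => V u * V' u := by
  refine op_ext fun y => ?_
  rw [← Matrix.mulVec_mulVec, multiControlled_ket, multiControlled_ket, Matrix.mulVec_sum]
  simp only [Matrix.mulVec_smul, multiControlled_ket, Sum.elim_comp_inl, Sum.elim_comp_inr,
    Finset.smul_sum, smul_smul, Matrix.mul_apply, Finset.sum_smul]
  rw [Finset.sum_comm]
  simp only [mul_comm]

theorem multiControlled_one : multiControlled (fun _ : Basis κ => (1 : Op ι)) = 1 := by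
  refine op_ext fun y => ?_
  rw [multiControlled_ket, Finset.sum_eq_single (y ∘ Sum.inl)]
  · simp
  · intro b _ hb
    simp [Matrix.one_apply_ne hb]
  · simp

theorem multiControlled_listProd (l : List (Basis κ → Op ι)) :
    multiControlled (fun u => (l.map fun V => V u).prod) = (l.map multiControlled).prod := by
  induction l with
  | nil => simpa using multiControlled_one
  | cons V l ih => simp only [List.map_cons, List.prod_cons, ← ih, multiControlled_mul]

/-- Plugs the ancilla wire q into the control qubit. This is how the hypothesis on controlled H_l
enters SELECT. -/
theorem lift_controlled {n : ℕ} (q : κ) (V : Op (Fin n)) :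
    lift (Sum.elim (fun _ : Unit => Sum.inr q) Sum.inl : Unit ⊕ Fin n → Fin n ⊕ κ)
      (controlled V) = multiControlled fun u => if u q then V else 1 := by
  ext x y
  simp only [lift, controlled, multiControlled, Matrix.of_apply, ← ite_and]
  have : ((∀ k, (∀ i, Sum.elim (fun _ : Unit => Sum.inr q) Sum.inl i ≠ k) → x k = y k) ∧
      (x ∘ Sum.elim (fun _ : Unit => Sum.inr q) Sum.inl) (Sum.inl ()) =
        (y ∘ Sum.elim (fun _ : Unit => Sum.inr q) Sum.inl) (Sum.inl ())) ↔
      x ∘ Sum.inr = y ∘ Sum.inr := by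
    simp only [funext_iff, Sum.forall, Function.comp_apply, Sum.elim_inl, Sum.elim_inr, ne_eq,
      reduceCtorEq, not_false_eq_true, forall_const, Sum.inr.injEq, Sum.inl.injEq,
      true_and]
    constructor
    · rintro ⟨h1, h2⟩ k
      by_cases hk : q = k
      · exact hk ▸ h2
      · exact h1.2 k ⟨hk, fun _ => trivial⟩
    · intro h
      exact ⟨⟨fun a h' => absurd rfl (h' a), fun k _ => h k⟩, h q⟩
  simp only [this]
  refine if_ctx_congr Iff.rfl (fun h => ?_) fun _ => rfl
  have hq : x (Sum.inr q) = y (Sum.inr q) := congrFun h q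
  simp only [Function.comp_apply, Sum.elim_inl, hq]
  rfl

theorem mux_phase (i j : κ) (ζ : ℂ) :
    mux (Sum.inr i : ι ⊕ κ) (Sum.inr j) (fun _ => Matrix.diagonal fun b => if b then ζ else 1) =
      multiControlled fun u => (if u j then ζ else 1) • (1 : Op ι) := by
  refine op_ext fun y => ?_
  rw [mux_ket, multiControlled_ket, Finset.sum_eq_single (y (Sum.inr j)),
    Finset.sum_eq_single (y ∘ Sum.inl)]
  · simp
  · intro b _ hb
    simp [Matrix.one_apply_ne hb]
  · simp
  · intro b _ hb
    simp [Matrix.diagonal_apply_ne _ hb]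
  · simp

end

section

variable {ι : Type} [Fintype ι] [DecidableEq ι]

/-! ### One-qubit operators -/

/-- The rotation `|0⟩ ↦ a |0⟩ + b |1⟩`, `|1⟩ ↦ -b |0⟩ + a |1⟩`. -/
def rotation (a b : ℝ) : Matrix Bool Bool ℂ :=
  Matrix.of fun x y => if x = y then (a : ℂ) else if x then (b : ℂ) else -(b : ℂ)

theorem rotation_mem {a b : ℝ} (h : a ^ 2 + b ^ 2 = 1) :
    rotation a b ∈ Matrix.unitaryGroup Bool ℂ := by
  have h' : (a : ℂ) * a + b * b = 1 := by
    have := congrArg (fun r : ℝ => (r : ℂ)) h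
    push_cast at this
    linear_combination this
  rw [Matrix.mem_unitaryGroup_iff]
  ext x y
  cases x <;> cases y <;>
    simp [rotation, Matrix.mul_apply] <;> first | linear_combination h' | ring

/-- The Pauli matrix `X`. -/
def flip : Matrix Bool Bool ℂ := Matrix.of fun x y => if x = y then 0 else 1

theorem flip_mem : flip ∈ Matrix.unitaryGroup Bool ℂ := by
  rw [Matrix.mem_unitaryGroup_iff]
  ext x y
  cases x <;> cases y <;> simp [flip, Matrix.mul_apply]

theorem controlledFlip_mem (b₀ : Bool) :
    ∀ b : Bool, (if b = b₀ then flip else 1) ∈ Matrix.unitaryGroup Bool ℂ := fun b => by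
  split_ifs
  exacts [flip_mem, one_mem _]

theorem controlledFlip_ket (i j : ι) (b₀ : Bool) (x : Basis ι) :
    mux i j (fun b => if b = b₀ then flip else 1) *ᵥ ket x =
      ket (if x i = b₀ then Function.update x j (!x j) else x) := by
  rw [mux_ket]
  by_cases h : x i = b₀
  · simp only [h, if_true]
    cases hj : x j <;> simp [flip]
  · simp only [h, if_false]
    rw [Finset.sum_eq_single (x j)]
    · simp
    · intro b _ hb
      simp [Matrix.one_apply_ne hb]
    · simp

/-! ### Preparation of a superposition along a chain of wires -/

/-- The wire `i k` set to `1` and the wires `i j`, `j < k`, set to `h`. -/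
def pattern {N : ℕ} (h : Bool) (x : Basis ι) (i : Fin (N + 1) → ι) (k : Fin (N + 1)) : Basis ι :=
  fun w => if w = i k then true else if ∃ j < k, w = i j then h else x w

theorem pattern_zero {N : ℕ} (h : Bool) {x : Basis ι} {i : Fin (N + 1) → ι} (hx : x (i 0) = true) :
    pattern h x i 0 = x := by
  ext w
  simp only [pattern, Fin.not_lt_zero, false_and, exists_false, if_false]
  split_ifs with hw
  · rw [hw, hx]
  · rfl

theorem pattern_succ {N : ℕ} (h : Bool) (x : Basis ι) {i : Fin (N + 2) → ι}
    (k : Fin (N + 1)) :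
    pattern h (Function.update (Function.update x (i 1) true) (i 0) h) (i ∘ Fin.succ) k =
      pattern h x i k.succ := by
  ext w
  simp only [pattern, Function.comp_apply]
  by_cases hk : w = i k.succ
  · simp [hk]
  rw [if_neg hk, if_neg hk]
  have hex : (∃ j < k.succ, w = i j) ↔ w = i 0 ∨ ∃ j < k, w = i j.succ := by
    rw [Fin.exists_fin_succ]
    simp
  by_cases h1 : ∃ j < k, w = i j.succ
  · rw [if_pos h1, if_pos (hex.2 (Or.inr h1))]
  rw [if_neg h1]
  by_cases h0 : w = i 0
  · rw [if_pos (hex.2 (Or.inl h0)), h0, Function.update_self]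
  · rw [if_neg (fun h' => (hex.1 h').elim h0 h1), Function.update_of_ne h0,
      Function.update_of_ne]
    rintro rfl
    by_cases hk0 : k = 0
    · exact hk (by rw [hk0]; rfl)
    · exact h1 ⟨0, Fin.pos_of_ne_zero hk0, rfl⟩

theorem exists_normalized_tail {N : ℕ} (c : Fin (N + 1) → ℝ) (hc : ∀ k, 0 ≤ c k) :
    ∃ (t : ℝ) (d : Fin (N + 1) → ℝ), t ^ 2 = ∑ k, c k ^ 2 ∧ (∀ k, 0 ≤ d k) ∧ ∑ k, d k ^ 2 = 1 ∧
      ∀ k, t * d k = c k := by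
  have hnn : 0 ≤ ∑ k, c k ^ 2 := Finset.sum_nonneg fun k _ => sq_nonneg _
  rcases hnn.eq_or_lt with h0 | hpos
  -- With an all-zero tail any unit vector serves as d, since it is multiplied by t = 0.
  · refine ⟨0, Pi.single 0 1, by simp [← h0], fun k => ?_, ?_, fun k => ?_⟩
    · by_cases hk : k = 0 <;> simp [hk]
    · simp [Pi.single_apply]
    · have := (Finset.sum_eq_zero_iff_of_nonneg fun k _ => sq_nonneg (c k)).1 h0.symm k
        (Finset.mem_univ k)
      simpa using (pow_eq_zero_iff two_ne_zero).1 this |>.symm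
  · refine ⟨√(∑ k, c k ^ 2), fun k => c k / √(∑ k, c k ^ 2), Real.sq_sqrt hnn,
      fun k => div_nonneg (hc k) (Real.sqrt_nonneg _), ?_, fun k => ?_⟩
    · simp only [div_pow, Real.sq_sqrt hnn, ← Finset.sum_div]
      exact div_self hpos.ne'
    · exact mul_div_cancel₀ _ (Real.sqrt_pos.2 hpos).ne'

/-- A rotation on wire 1, controlled by wire 0, leaves amplitude c₀ in place and hands the norm of
the remaining amplitudes on to wire 1, where the recursion continues. With h = true the passed wires
stay set, giving a unary code; with h = false they are cleared, giving a one-hot code. Acting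
trivially when all wires are 0 is what lets the recursion leave the first branch alone. -/
theorem exists_chain (h : Bool) {N : ℕ} (c : Fin (N + 1) → ℝ) (hc : ∀ k, 0 ≤ c k)
    (hs : ∑ k, c k ^ 2 = 1) (i : Fin (N + 1) → ι) (hi : Function.Injective i) :
    ∃ A : Op ι, Implementable A (2 * N) ∧
      (∀ x, (∀ k, x (i k) = false) → A *ᵥ ket x = ket x) ∧
      ∀ x, x (i 0) = true → (∀ k, k ≠ 0 → x (i k) = false) →
        A *ᵥ ket x = ∑ k, (c k : ℂ) • ket (pattern h x i k) := by
  induction N with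
  | zero =>
    refine ⟨1, Implementable.one, fun x _ => by simp, fun x hx _ => ?_⟩
    have h1 : c 0 = 1 := by
      have : c 0 ^ 2 = 1 := by simpa using hs
      nlinarith [hc 0]
    simp [h1, pattern_zero h hx]
  | succ N ih =>
    obtain ⟨t, d, ht, hd, hd1, htd⟩ := exists_normalized_tail (c ∘ Fin.succ) fun k => hc _
    obtain ⟨A, hA, hA0, hA1⟩ := ih d hd hd1 (i ∘ Fin.succ) (hi.comp (Fin.succ_injective _))
    have h01 : i 0 ≠ i 1 := fun e => by simpa using hi e
    have hrot : c 0 ^ 2 + t ^ 2 = 1 := by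
      rw [ht, ← hs]
      exact (Fin.sum_univ_succ fun k => c k ^ 2).symm
    set B := mux (i 0) (i 1) fun b => if b then rotation (c 0) t else 1 with hB
    have hBi : Implementable B 1 := implementable_mux h01 fun b => by
      cases b
      exacts [one_mem _, rotation_mem hrot]
    -- The gate D clears wire 0 once wire 1 is set; it is needed only for the one-hot code and is
    -- the identity for the unary one.
    obtain ⟨D, hDi, hD0, hD1⟩ : ∃ D : Op ι, Implementable D 1 ∧
        (∀ x, x (i 1) = false → D *ᵥ ket x = ket x) ∧
        ∀ x, x (i 0) = true → x (i 1) = true → D *ᵥ ket x = ket (Function.update x (i 0) h) := by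
      cases h with
      | true =>
        refine ⟨1, Implementable.one.mono zero_le_one, fun x _ => by simp, fun x h0 h1 => ?_⟩
        rw [Matrix.one_mulVec, ← h0, Function.update_eq_self]
      | false =>
        refine ⟨mux (i 1) (i 0) fun b => if b = true then flip else 1,
          implementable_mux h01.symm (controlledFlip_mem true), fun x h1 => ?_, fun x h0 h1 => ?_⟩
        · rw [controlledFlip_ket, if_neg (by simp [h1])]
        · rw [controlledFlip_ket, if_pos h1, h0]
          rfl
    refine ⟨A * (D * B), (hA.mul (hDi.mul hBi)).mono (by omega), fun x hx => ?_,
      fun x hx0 hx => ?_⟩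
    · have : B *ᵥ ket x = ket x := by
        rw [hB, mux_ket, hx 0, Finset.sum_eq_single (x (i 1))]
        · simp
        · intro b _ hb
          simp [Matrix.one_apply_ne hb]
        · simp
      rw [← Matrix.mulVec_mulVec, ← Matrix.mulVec_mulVec, this, hD0 x (hx 1),
        hA0 x fun k => hx _]
    · have hx1 : x (i 1) = false := hx 1 (by simp)
      have : B *ᵥ ket x = (c 0 : ℂ) • ket x + (t : ℂ) • ket (Function.update x (i 1) true) := by
        have hu : Function.update x (i 1) false = x := by rw [← hx1, Function.update_eq_self]
        rw [hB, mux_ket, hx0, hx1]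
        simp [rotation, hu, add_comm]
      rw [← Matrix.mulVec_mulVec, ← Matrix.mulVec_mulVec, this, Matrix.mulVec_add,
        Matrix.mulVec_smul, Matrix.mulVec_smul, hD0 x hx1,
        hD1 _ (by rw [Function.update_of_ne h01, hx0]) (Function.update_self ..),
        Matrix.mulVec_add, Matrix.mulVec_smul, Matrix.mulVec_smul,
        hA0 x fun k => hx _ (Fin.succ_ne_zero k), hA1,
        Fin.sum_univ_succ fun k => (c k : ℂ) • ket (pattern h x i k), pattern_zero h hx0,
        Finset.smul_sum]
      · congr 1
        refine Finset.sum_congr rfl fun k _ => ?_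
        rw [smul_smul, pattern_succ h x, ← Complex.ofReal_mul, htd]
        rfl
      · simp only [Function.comp_apply, Fin.succ_zero_eq_one]
        rw [Function.update_of_ne h01.symm, Function.update_self]
      · intro k hk
        rw [Function.comp_apply, Function.update_of_ne, Function.update_of_ne,
          hx _ (Fin.succ_ne_zero k)]
        · intro e
          exact hk (Fin.succ_injective _ (hi e))
        · intro e
          exact Fin.succ_ne_zero k (hi e)

theorem exists_block {L : ℕ} (φ : Fin (L + 1) → ℝ) (hφ : ∀ l, 0 ≤ φ l) (hs : ∑ l, φ l ^ 2 = 1)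
    (fl : ι) (q : Fin (L + 1) → ι) (hq : Function.Injective q) (hfl : ∀ l, fl ≠ q l) :
    ∃ A : Op ι, Implementable A (2 * L + 1) ∧
      (∀ x, x fl = false → (∀ l, x (q l) = false) → A *ᵥ ket x = ket x) ∧
      ∀ x, x fl = true → (∀ l, x (q l) = false) →
        A *ᵥ ket x = ∑ l, (φ l : ℂ) • ket (Function.update x (q l) true) := by
  obtain ⟨A, hA, hA0, hA1⟩ := exists_chain false φ hφ hs q hq
  -- The flag is copied to the head of the chain, so the chain runs exactly when the flag is set.
  refine ⟨A * mux fl (q 0) fun b => if b = true then flip else 1,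
    hA.mul (implementable_mux (hfl 0) (controlledFlip_mem true)), fun x hx hxq => ?_,
    fun x hx hxq => ?_⟩
  · rw [← Matrix.mulVec_mulVec, controlledFlip_ket, if_neg (by simp [hx]), hA0 x hxq]
  · rw [← Matrix.mulVec_mulVec, controlledFlip_ket, if_pos hx, hxq, hA1]
    · refine Finset.sum_congr rfl fun l _ => ?_
      congr 2
      ext w
      simp only [pattern]
      by_cases hl : w = q l
      · simp [hl]
      rw [if_neg hl, Function.update_of_ne hl]
      by_cases h0 : ∃ j < l, w = q j
      · rw [if_pos h0]
        obtain ⟨j, -, rfl⟩ := h0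
        exact (hxq j).symm
      · rw [if_neg h0, Function.update_of_ne]
        rintro rfl
        by_cases hl0 : l = 0
        · exact hl (by rw [hl0])
        · exact h0 ⟨0, Fin.pos_of_ne_zero hl0, rfl⟩
    · simp
    · intro k hk
      rw [Function.update_of_ne (fun e => hk (hq e)), hxq]

/-- The blocks occupy disjoint wires and none of them touches a flag. A unary flag pattern of length
k therefore prepares k independent one-hot superpositions, whose product expands over all index
words of length k. -/
theorem exists_blocks {L M : ℕ} (φ : Fin (L + 1) → ℝ) (hφ : ∀ l, 0 ≤ φ l)
    (hs : ∑ l, φ l ^ 2 = 1) (fl : Fin M → ι) (q : Fin M → Fin (L + 1) → ι)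
    (hq : ∀ m l m' l', q m l = q m' l' → m = m' ∧ l = l') (hfl : ∀ m m' l, fl m ≠ q m' l) :
    ∃ A : Op ι, Implementable A (M * (2 * L + 1)) ∧
      ∀ (k : ℕ) (hk : k ≤ M) (x : Basis ι), (∀ m, x (fl m) = decide ((m : ℕ) < k)) →
        (∀ m l, x (q m l) = false) →
        A *ᵥ ket x = ∑ l : Fin k → Fin (L + 1), (∏ m, (φ (l m) : ℂ)) •
          ket fun w => x w || decide (∃ m : Fin k, w = q (Fin.castLE hk m) (l m)) := by
  induction M with
  | zero =>
    refine ⟨1, by simpa using Implementable.one, fun k hk x _ _ => ?_⟩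
    obtain rfl : k = 0 := by omega
    simp
  | succ M ih =>
    obtain ⟨A, hA, hA1⟩ := ih (fl ∘ Fin.succ) (fun m => q m.succ)
      (fun m l m' l' e => by simpa using hq _ _ _ _ e) fun m m' l => hfl _ _ _
    obtain ⟨B, hB, hB0, hB1⟩ := exists_block φ hφ hs (fl 0) (q 0)
      (fun l l' e => (hq _ _ _ _ e).2) fun l => hfl _ _ _
    refine ⟨B * A, (hB.mul hA).mono (le_of_eq (by ring)), fun k hk x hx hxq => ?_⟩
    rw [← Matrix.mulVec_mulVec]
    cases k with
    | zero =>
      rw [hA1 0 (Nat.zero_le _) x (fun m => by simp [hx]) fun m l => hxq _ _]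
      simp [hB0 x (by simp [hx]) (hxq 0)]
    | succ k =>
      rw [hA1 k (by omega) x (fun m => by simp [hx]) fun m l => hxq _ _, Matrix.mulVec_sum,
        ← (Fin.consEquiv fun _ : Fin (k + 1) => Fin (L + 1)).sum_comp, Fintype.sum_prod_type,
        Finset.sum_comm]
      refine Finset.sum_congr rfl fun l _ => ?_
      rw [Matrix.mulVec_smul, hB1, Finset.smul_sum]
      · refine Finset.sum_congr rfl fun l₀ _ => ?_
        rw [smul_smul, Fin.prod_univ_succ]
        simp only [Fin.consEquiv, Equiv.coe_fn_mk, Fin.cons_zero, Fin.cons_succ]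
        rw [mul_comm]
        congr 2
        ext w
        have hex : (∃ m : Fin (k + 1), w = q (Fin.castLE hk m)
              (Fin.cons (α := fun _ => Fin (L + 1)) l₀ l m)) ↔
            w = q 0 l₀ ∨ ∃ m : Fin k, w = q (Fin.castLE (by omega) m).succ (l m) := by
          rw [Fin.exists_fin_succ]
          rfl
        rw [Bool.eq_iff_iff]
        rw [Bool.or_eq_true]
        refine Iff.trans ?_ (or_congr_right (hex.symm.trans decide_eq_true_iff.symm))
        by_cases hw : w = q 0 l₀
        · subst hw
          simp
        · rw [Function.update_of_ne hw]
          simp [hw]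
      · simp [hx, hfl]
      · intro l'
        rw [hxq]
        simp only [Bool.false_or, decide_eq_false_iff_not, not_exists]
        intro m e
        exact absurd (hq _ _ _ _ e).1.symm (Fin.succ_ne_zero _)

/-! ### PREPARE -/

/-- The ancilla wires: flags that hold the branch in unary, and one-hot encodings of the
indices `l₁, …, l_K`. -/
abbrev Ancilla (K L : ℕ) := Fin (K + 3) ⊕ Fin K × Fin (L + 1)

/-- The basis state in which the flags up to `p` are set. -/
def flagState {K L : ℕ} (p : Fin (K + 3)) : Basis (Ancilla K L) :=
  Sum.elim (fun r => decide (r ≤ p)) fun _ => false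

/-- The encoding of the indices of the linear combination. -/
def encode (K L : ℕ) : LCUIndex (L + 1) K → Basis (Ancilla K L)
  | Sum.inr b => flagState (if b then 0 else 1)
  | Sum.inl ⟨k, l⟩ => fun w => flagState k.succ.succ w ||
      decide (∃ m, w = Sum.inr (Fin.castLE (Nat.le_of_lt_succ k.2) m, l m))

theorem encode_inl_inl {K L : ℕ} (k : Fin (K + 1)) (l : Fin k → Fin (L + 1)) (r : Fin (K + 3)) :
    encode K L (Sum.inl ⟨k, l⟩) (Sum.inl r) = decide (r ≤ k.succ.succ) := by
  simp [encode, flagState]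

theorem encode_inl_inr {K L : ℕ} (k : Fin (K + 1)) (l : Fin k → Fin (L + 1)) (m : Fin K)
    (l' : Fin (L + 1)) :
    encode K L (Sum.inl ⟨k, l⟩) (Sum.inr (m, l')) =
      decide (∃ h : (m : ℕ) < k, l ⟨m, h⟩ = l') := by
  simp only [encode, flagState, Sum.elim_inr, Bool.false_or, Sum.inr.injEq, Prod.mk.injEq]
  congr 1
  refine propext ⟨?_, ?_⟩
  · rintro ⟨m, rfl, rfl⟩
    exact ⟨m.2, rfl⟩
  · rintro ⟨h, rfl⟩
    exact ⟨⟨m, h⟩, rfl, rfl⟩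

/-- The flags determine the branch, hence k or the sign, and the one-hot blocks determine the
letters. -/
theorem encode_injective (K L : ℕ) : Function.Injective (encode K L) := by
  have hp : ∀ p p' : Fin (K + 3), (∀ r, decide (r ≤ p) = decide (r ≤ p')) → p = p' :=
    fun p p' h => le_antisymm (by simpa using h p) (by simpa using (h p').symm)
  rintro (⟨k, l⟩ | b) (⟨k', l'⟩ | b') h
  · have hk : k = k' := by
      have := hp k.succ.succ k'.succ.succ fun r => by
        rw [← encode_inl_inl k l, ← encode_inl_inl k' l', h]
      simpa using this
    subst hk
    congr 2
    ext1 m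
    have h1 := encode_inl_inr k l (Fin.castLE (Nat.le_of_lt_succ k.2) m) (l m)
    rw [h, encode_inl_inr] at h1
    simpa [eq_comm] using h1
  · have := hp k.succ.succ (if b' then 0 else 1) fun r => by
      rw [← encode_inl_inl k l, h]; rfl
    cases b' <;> exact absurd (congrArg Fin.val this) (by simp)
  · have := hp k'.succ.succ (if b then 0 else 1) fun r => by
      rw [← encode_inl_inl k' l', ← h]; rfl
    cases b <;> exact absurd (congrArg Fin.val this) (by simp)
  · have := hp (if b then 0 else 1) (if b' then 0 else 1) fun r => congrFun h (Sum.inl r)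
    cases b <;> cases b' <;> simp_all

/-- A unary chain on the flags distributes the branch amplitudes: branches 0 and 1 are the two
cancelling identity terms, branch k + 2 is order k. The flags then trigger the one-hot blocks. This
suffices because the amplitude of an index word factors into one factor per letter. -/
theorem exists_prepare {K L : ℕ} (c : Fin (K + 3) → ℝ) (hc : ∀ p, 0 ≤ c p)
    (hc1 : ∑ p, c p ^ 2 = 1) (φ : Fin (L + 1) → ℝ) (hφ : ∀ l, 0 ≤ φ l) (hφ1 : ∑ l, φ l ^ 2 = 1) :
    ∃ A : Op (Ancilla K L), Implementable A (K * (2 * L + 1) + (2 * (K + 2) + 1)) ∧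
      A *ᵥ ket (zero _) = ∑ j : LCUIndex (L + 1) K,
        (match j with
          | Sum.inl ⟨k, l⟩ => (c k.succ.succ : ℂ) * ∏ m, (φ (l m) : ℂ)
          | Sum.inr b => (c (if b then 0 else 1) : ℂ)) • ket (encode K L j) := by
  obtain ⟨A, hA, -, hA1⟩ := exists_chain (ι := Ancilla K L) true c hc hc1 Sum.inl Sum.inl_injective
  obtain ⟨B, hB, hB1⟩ := exists_blocks (ι := Ancilla K L) φ hφ hφ1
    -- Order k sets the flags up to k + 2, so flag m + 3 is set exactly when m < k.
    (fun m : Fin K => Sum.inl ⟨m + 3, by omega⟩) (fun m l => Sum.inr (m, l))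
    (fun m l m' l' e => by simpa using e) (by simp)
  have h10 : (Sum.inl 1 : Ancilla K L) ≠ Sum.inl 0 := by simp
  -- Flag 1 is still 0 at the start, so this gate sets flag 0, the head of the chain.
  have hX := implementable_mux h10 (U := fun b => if b = false then flip else 1)
    (controlledFlip_mem false)
  refine ⟨B * (A * _), hB.mul (hA.mul hX), ?_⟩
  rw [← Matrix.mulVec_mulVec, ← Matrix.mulVec_mulVec, controlledFlip_ket, if_pos (by rfl), hA1]
  · have hpat : ∀ p, pattern true (Function.update (zero (Ancilla K L)) (Sum.inl 0)
        (!zero (Ancilla K L) (Sum.inl 0))) Sum.inl p = flagState p := by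
      intro p
      ext w
      rcases w with r | r
      · simp only [pattern, flagState, Sum.elim_inl, Sum.inl.injEq]
        rcases lt_trichotomy r p with h | h | h
        · rw [if_neg h.ne, if_pos ⟨r, h, rfl⟩, decide_eq_true h.le]
        · rw [if_pos h, decide_eq_true h.le]
        · rw [if_neg h.ne', if_neg, decide_eq_false (not_le.2 h), Function.update_of_ne]
          · rfl
          · intro e
            rw [Sum.inl.injEq] at e
            exact absurd h (by simp [e])
          · rintro ⟨j, hj, rfl⟩
            exact lt_asymm h hj
      · simp [pattern, flagState, zero]
    simp only [hpat]
    rw [Matrix.mulVec_sum, Fintype.sum_sum_type, Fintype.sum_sigma, Fintype.sum_bool,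
      Fin.sum_univ_succ, Fin.sum_univ_succ]
    have hflag : ∀ (p : Fin (K + 3)) (k : ℕ), (p : ℕ) - 2 = k → ∀ m : Fin K,
        flagState (L := L) p (Sum.inl ⟨m + 3, by omega⟩) = decide ((m : ℕ) < k) := by
      intro p k hpk m
      simp only [flagState, Sum.elim_inl, Fin.le_def]
      congr 1
      refine propext ⟨fun h => ?_, fun h => ?_⟩ <;> omega
    have hsmall : ∀ p : Fin (K + 3), (p : ℕ) < 2 → B *ᵥ ket (flagState p) = ket (flagState p) := by
      intro p hp
      rw [hB1 0 (Nat.zero_le _) _ (hflag p 0 (by omega)) fun m l => rfl]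
      simp
    simp only [Matrix.mulVec_smul]
    rw [hsmall 0 (by simp), hsmall (Fin.succ 0) (by simp), add_comm (Finset.sum _ _), ← add_assoc]
    congr 1
    refine Finset.sum_congr rfl fun k _ => ?_
    rw [hB1 k (Nat.le_of_lt_succ k.2) _ (hflag _ _ (by simp)) fun m l => rfl, Finset.smul_sum]
    refine Finset.sum_congr rfl fun l _ => ?_
    rw [smul_smul]
    rfl
  · simp [zero]
  · intro k hk
    rw [Function.update_of_ne (by simpa using hk)]
    rfl

end

section

variable {ι κ : Type} [Fintype ι] [DecidableEq ι] [Fintype κ] [DecidableEq κ]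

/-! ### The reflection -/

/-- The Hadamard matrix. -/
def hadamard : Matrix Bool Bool ℂ :=
  Matrix.of fun x y => if x && y then -((√2 : ℝ) : ℂ)⁻¹ else ((√2 : ℝ) : ℂ)⁻¹

theorem inv_sqrt_two_mul_self : ((√2 : ℝ) : ℂ)⁻¹ * ((√2 : ℝ) : ℂ)⁻¹ = 1 / 2 := by
  rw [← mul_inv, ← Complex.ofReal_mul, Real.mul_self_sqrt (by norm_num)]
  norm_num

theorem hadamard_mem : hadamard ∈ Matrix.unitaryGroup Bool ℂ := by
  rw [Matrix.mem_unitaryGroup_iff]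
  have := inv_sqrt_two_mul_self
  ext x y
  cases x <;> cases y <;>
    simp [hadamard, Matrix.mul_apply] <;> linear_combination 2 * this

theorem phase_mem {ζ : ℂ} (hζ : ζ * star ζ = 1) :
    (Matrix.diagonal fun b => if b then ζ else 1 : Matrix Bool Bool ℂ) ∈
      Matrix.unitaryGroup Bool ℂ := by
  rw [Matrix.mem_unitaryGroup_iff, Matrix.star_eq_conjTranspose, Matrix.diagonal_conjTranspose,
    Matrix.diagonal_mul_diagonal, ← Matrix.diagonal_one]
  congr 1
  ext b
  cases b
  · simp
  · simpa using hζ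

theorem phase_ket (i j : ι) (ζ : ℂ) (x : Basis ι) :
    mux i j (fun _ => Matrix.diagonal fun b => if b then ζ else 1) *ᵥ ket x =
      (if x j then ζ else 1) • ket x := by
  rw [mux_ket, Finset.sum_eq_single (x j)]
  · simp
  · intro b _ hb
    simp [Matrix.diagonal_apply_ne _ hb]
  · simp

theorem mux_ket_of_eq_one {i j : ι} {U : Bool → Matrix Bool Bool ℂ} {x : Basis ι}
    (h : U (x i) = 1) : mux i j U *ᵥ ket x = ket x := by
  rw [mux_ket, h, Finset.sum_eq_single (x j)]
  · simp
  · intro b _ hb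
    simp [Matrix.one_apply_ne hb]
  · simp

/-- The conjunction of the value of `s` and the negated value of `u`, computed into a clean
wire `t`. -/
theorem exists_and {s u t : ι} (hs : s ≠ t) (hu : u ≠ t) :
    ∃ A : Op ι, Implementable A 3 ∧ ∀ x, x t = false →
      A *ᵥ ket x = ket (Function.update x t (x s && !x u)) := by
  set B := mux u t fun b => if b then 1 else hadamard with hB
  set C := mux s t fun b => if b then Matrix.diagonal fun b => if b then (-1 : ℂ) else 1 else 1
    with hC
  have hBi : Implementable B 1 := implementable_mux hu fun b => by
    cases b
    exacts [hadamard_mem, one_mem _]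
  have hCi : Implementable C 1 := implementable_mux hs fun b => by
    cases b
    exacts [one_mem _, phase_mem (by simp)]
  refine ⟨B * (C * B), hBi.mul (hCi.mul hBi), fun x hx => ?_⟩
  have hC0 : ∀ y : Basis ι, (y s = false ∨ y t = false) → C *ᵥ ket y = ket y := by
    intro y hy
    by_cases h : y s = false
    · exact mux_ket_of_eq_one (by simp [h])
    · have ht : y t = false := hy.resolve_left h
      have hs' : y s = true := by simpa using h
      rw [hC, mux_ket, hs', ht]
      simp [← ht, Matrix.diagonal]
  have hC1 : ∀ y : Basis ι, y s = true → y t = true → C *ᵥ ket y = -ket y := by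
    intro y h ht
    rw [hC, mux_ket, h, ht]
    simp [← ht, Matrix.diagonal]
  rw [← Matrix.mulVec_mulVec, ← Matrix.mulVec_mulVec]
  have hxu : Function.update x t false = x := by rw [← hx, Function.update_eq_self]
  cases hxu' : x u with
  | true =>
    have h1 : B *ᵥ ket x = ket x := mux_ket_of_eq_one (by simp [hxu'])
    rw [h1, hC0 x (Or.inr hx), h1]
    simp [hxu]
  | false =>
    set x₁ := Function.update x t true with hx₁
    have h1 : B *ᵥ ket x = ((√2 : ℝ) : ℂ)⁻¹ • (ket x + ket x₁) := by
      rw [hB, mux_ket, hxu', hx]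
      simp [hadamard, hxu, ← hx₁, add_comm]
    have h2 : B *ᵥ ket x₁ = ((√2 : ℝ) : ℂ)⁻¹ • (ket x - ket x₁) := by
      have e1 : x₁ u = false := by rw [hx₁, Function.update_of_ne hu, hxu']
      have e2 : x₁ t = true := Function.update_self ..
      rw [hB, mux_ket, e1, e2, hx₁]
      simp [hadamard, hxu, smul_sub, neg_add_eq_sub]
    have e1 : x₁ s = x s := Function.update_of_ne hs ..
    rw [h1, Matrix.mulVec_smul, Matrix.mulVec_add, hC0 x (Or.inr hx)]
    have key := inv_sqrt_two_mul_self
    cases hxs : x s with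
    | true =>
      rw [hC1 x₁ (e1.trans hxs) (Function.update_self ..), Matrix.mulVec_smul, Matrix.mulVec_add,
        Matrix.mulVec_neg, h1, h2, ← sub_eq_add_neg, ← smul_sub, smul_smul, key]
      simp only [Bool.not_false, Bool.and_self, ← hx₁]
      module
    | false =>
      rw [hC0 x₁ (Or.inl (e1.trans hxs)), Matrix.mulVec_smul, Matrix.mulVec_add, h1, h2,
        ← smul_add, smul_smul, key]
      simp only [Bool.false_and, hxu]
      module

/-- Partial conjunctions run along the work wires z. Only the last one is described, because the
resulting basis state y is uncomputed afterwards. -/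
theorem exists_conjunction {a : ℕ} (u : Fin a → ι) (z : Fin (a + 1) → ι)
    (hz : Function.Injective z) (huz : ∀ j k, u j ≠ z k) :
    ∃ A : Op ι, Implementable A (3 * a) ∧ ∀ x, (∀ k, k ≠ 0 → x (z k) = false) →
      ∃ y, A *ᵥ ket x = ket y ∧
        y (z (Fin.last a)) = (x (z 0) && decide (∀ j, x (u j) = false)) := by
  induction a with
  | zero => exact ⟨1, Implementable.one, fun x _ => ⟨x, by simp, by simp⟩⟩
  | succ a ih =>
    obtain ⟨A, hA, hA1⟩ := ih (u ∘ Fin.succ) (z ∘ Fin.succ) (hz.comp (Fin.succ_injective _))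
      fun j k => huz _ _
    have h01 : z 0 ≠ z 1 := fun e => by simpa using hz e
    obtain ⟨B, hB, hB1⟩ := exists_and h01 (huz 0 1)
    refine ⟨A * B, (hA.mul hB).mono (by omega), fun x hx => ?_⟩
    rw [← Matrix.mulVec_mulVec, hB1 x (hx 1 (by simp))]
    obtain ⟨y, hy, hyl⟩ := hA1 (Function.update x (z 1) (x (z 0) && !x (u 0))) fun k hk => by
      rw [Function.comp_apply, Function.update_of_ne, hx _ (Fin.succ_ne_zero k)]
      exact fun e => hk (Fin.succ_injective _ (hz e))
    refine ⟨y, hy, ?_⟩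
    have hu : ∀ j, Function.update x (z 1) (x (z 0) && !x (u 0)) (u j) = x (u j) := fun j =>
      Function.update_of_ne (huz j 1) ..
    rw [← Fin.succ_last, ← Function.comp_apply (f := z), hyl]
    simp only [Function.comp_apply, Fin.succ_zero_eq_one, Function.update_self, hu]
    rw [Bool.eq_iff_iff]
    simp only [Bool.and_eq_true, Bool.not_eq_true', decide_eq_true_eq, Fin.forall_fin_succ,
      and_assoc]

theorem exists_reflection {a : ℕ} (u : Fin (a + 1) → ι) (z : Fin (a + 2) → ι)
    (hz : Function.Injective z) (huz : ∀ j k, u j ≠ z k) :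
    ∃ A : Op ι, Implementable A (6 * (a + 1) + 3) ∧ ∀ x, (∀ k, x (z k) = false) →
      A *ᵥ ket x = (if ∀ j, x (u j) = false then (-1 : ℂ) else 1) • ket x := by
  obtain ⟨A, hA, hA1⟩ := exists_conjunction u z hz huz
  have hX := implementable_mux (huz 0 0) (U := fun _ => flip) fun _ => flip_mem
  have hP := implementable_mux (huz 0 (Fin.last _))
    (U := fun _ => Matrix.diagonal fun b => if b then (-1 : ℂ) else 1)
    fun _ => phase_mem (by simp)
  set X := mux (u 0) (z 0) fun _ => flip
  set P := mux (u 0) (z (Fin.last _)) fun _ => Matrix.diagonal fun b => if b then (-1 : ℂ) else 1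
    with hPdef
  have hE := hA.mul hX
  -- Compute the conjunction, flip the phase on its result, uncompute by the adjoint circuit. X sets
  -- z 0, the empty conjunction.
  refine ⟨(A * X)ᴴ * (P * (A * X)), (hE.conjTranspose.mul (hP.mul hE)).mono (by omega),
    fun x hx => ?_⟩
  have hXx : X *ᵥ ket x = ket (Function.update x (z 0) true) := by
    rw [mux_ket, hx 0]
    simp [flip]
  obtain ⟨y, hy, hyl⟩ := hA1 (Function.update x (z 0) true) fun k hk => by
    rw [Function.update_of_ne (fun e => hk (hz e)), hx]
  have hEx : (A * X) *ᵥ ket x = ket y := by rw [← Matrix.mulVec_mulVec, hXx, hy]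
  have hinv : (A * X)ᴴ *ᵥ ket y = ket x := by
    rw [← hEx, Matrix.mulVec_mulVec, ← Matrix.star_eq_conjTranspose,
      Matrix.mem_unitaryGroup_iff'.1 hE.mem_unitaryGroup, Matrix.one_mulVec]
  rw [← Matrix.mulVec_mulVec, ← Matrix.mulVec_mulVec, hEx, hPdef, phase_ket, Matrix.mulVec_smul,
    hinv, hyl]
  simp only [Function.update_self, Bool.true_and, decide_eq_true_eq,
    Function.update_of_ne (huz _ 0)]

/-! ### SELECT -/

theorem implementable_multiControlled_listProd {l : List (Basis κ → Op ι)} {M : ℕ}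
    (h : ∀ V ∈ l, Implementable (multiControlled V) M) :
    Implementable (multiControlled l.prod) (l.length * M) := by
  have e : multiControlled l.prod = (l.map multiControlled).prod := by
    rw [← multiControlled_listProd]
    congr 1
    ext1 u
    exact map_list_prod (Pi.evalMonoidHom (fun _ : Basis κ => Op ι) u) l
  rw [e]
  simpa using Implementable.listProd (l := l.map multiControlled) (M := M) (by simpa using h)

theorem implementable_phase {i j : κ} (hij : i ≠ j) {ζ : ℂ} (hζ : ζ * star ζ = 1) :
    Implementable (multiControlled fun u => (if u j then ζ else 1) • (1 : Op ι)) 1 := by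
  rw [← mux_phase i]
  exact implementable_mux (by simpa using hij) fun _ => phase_mem hζ

theorem implementable_controlled {n N : ℕ} {V : Op (Fin n)} (q : κ)
    (hV : Implementable (controlled V) N) :
    Implementable (multiControlled fun u => if u q then V else 1) N := by
  rw [← lift_controlled]
  refine hV.lift ⟨_, ?_⟩
  rintro (i | i) (j | j) h <;> simp_all

theorem ofFn_prod_ite {M : Type*} [Monoid M] {N : ℕ} (a : Fin N → M) (i₀ : Fin N) :
    (List.ofFn fun i => if i₀ = i then a i else 1).prod = a i₀ := by
  induction N with
  | zero => exact i₀.elim0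
  | succ N ih =>
    rw [List.ofFn_succ, List.prod_cons]
    refine Fin.cases ?_ (fun i => ?_) i₀
    · simp [(Fin.succ_ne_zero _).symm]
    · simpa using ih (a ∘ Fin.succ) i

theorem ofFn_prod_dite {M : Type*} [Monoid M] {N k : ℕ} (hk : k ≤ N) (a : Fin k → M) :
    (List.ofFn fun m : Fin N => if h : (m : ℕ) < k then a ⟨m, h⟩ else 1).prod =
      (List.ofFn a).prod := by
  induction N generalizing k with
  | zero =>
    obtain rfl : k = 0 := by omega
    simp
  | succ N ih =>
    cases k with
    | zero => simp
    | succ k =>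
      rw [List.ofFn_succ, List.prod_cons, List.ofFn_succ, List.prod_cons,
        ← ih (Nat.le_of_succ_le_succ hk) fun m => a m.succ]
      simp

theorem ofFn_prod_smul {R M : Type*} [CommSemiring R] [Semiring M] [Algebra R M] {k : ℕ} (z : R)
    (a : Fin k → M) : (List.ofFn fun m => z • a m).prod = z ^ k • (List.ofFn a).prod := by
  induction k with
  | zero => simp
  | succ k ih =>
    rw [List.ofFn_succ, List.prod_cons, List.ofFn_succ, List.prod_cons, ih, smul_mul_smul_comm,
      pow_succ']

/-- In a one-hot block exactly one wire of an active slot is set, so the product over all l of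
singly controlled H_l picks out the right factor, and inactive slots contribute 1. The flag m + 3
supplies the factor -i of slot m. -/
theorem exists_select {n K L N : ℕ} (Hl : Fin (L + 1) → Matrix.unitaryGroup (Basis (Fin n)) ℂ)
    (hHl : ∀ l, Implementable (controlled (Hl l : Op (Fin n))) N) :
    ∃ V : Basis (Ancilla K L) → Op (Fin n),
      Implementable (multiControlled V) (2 + K * (1 + (L + 1) * N)) ∧
        ∀ j, V (encode K L j) = lcuUnitary Hl j := by
  set sgn : Fin (K + 3) → Basis (Ancilla K L) → Op (Fin n) := fun r u =>
    (if u (Sum.inl r) then (-1 : ℂ) else 1) • 1 with hsgn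
  set ph : Fin K → Basis (Ancilla K L) → Op (Fin n) := fun m u =>
    (if u (Sum.inl ⟨m + 3, by omega⟩) then -Complex.I else 1) • 1 with hph
  set ct : Fin K → Fin (L + 1) → Basis (Ancilla K L) → Op (Fin n) := fun m l u =>
    if u (Sum.inr (m, l)) then (Hl l : Op (Fin n)) else 1 with hct
  -- Signs on flags 1 and 2 cancel on every Taylor branch, which sets both. Branch 1 sets only flag
  -- 1 and gets -1; branch 0 sets neither and gets +1.
  refine ⟨(sgn 1 * sgn 2) * (List.ofFn fun m => ph m * (List.ofFn (ct m)).prod).prod, ?_, ?_⟩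
  · have hmul : ∀ {V V' : Basis (Ancilla K L) → Op (Fin n)} {M M' : ℕ},
        Implementable (multiControlled V) M → Implementable (multiControlled V') M' →
          Implementable (multiControlled (V * V')) (M + M') := fun h h' => by
      have := h.mul h'
      rwa [multiControlled_mul] at this
    have hs : ∀ r, r ≠ 0 → Implementable (multiControlled (sgn r)) 1 := fun r hr =>
      implementable_phase (i := Sum.inl 0) (by simpa using hr.symm) (by simp)
    refine hmul (hmul (hs 1 (by simp)) (hs 2 (by simp [Fin.ext_iff, Nat.mod_eq_of_lt]))) ?_
    refine (implementable_multiControlled_listProd (M := 1 + (L + 1) * N) ?_).mono (by simp)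
    intro V hV
    obtain ⟨m, rfl⟩ := (List.mem_ofFn' _ _).1 hV
    refine hmul (implementable_phase (i := Sum.inl 0) (by simp [Fin.ext_iff]) (by simp)) ?_
    refine (implementable_multiControlled_listProd (M := N) ?_).mono (by simp)
    intro V hV
    obtain ⟨l, rfl⟩ := (List.mem_ofFn' _ _).1 hV
    exact implementable_controlled _ (hHl l)
  · intro j
    have heval : ∀ (l : List (Basis (Ancilla K L) → Op (Fin n))) u,
        l.prod u = (l.map fun V => V u).prod := fun l u =>
      map_list_prod (Pi.evalMonoidHom (fun _ : Basis (Ancilla K L) => Op (Fin n)) u) l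
    rw [Pi.mul_apply, Pi.mul_apply, heval, List.map_ofFn]
    have hblk : ∀ m u, (fun V : Basis (Ancilla K L) → Op (Fin n) => V u)
        (ph m * (List.ofFn (ct m)).prod) = ph m u * (List.ofFn fun l => ct m l u).prod := by
      intro m u
      simp only [Pi.mul_apply, heval, List.map_ofFn]
      rfl
    simp only [Function.comp_def] at hblk ⊢
    simp only [hblk]
    rcases j with ⟨k, l⟩ | b
    · have h1 : sgn 1 (encode K L (Sum.inl ⟨k, l⟩)) * sgn 2 (encode K L (Sum.inl ⟨k, l⟩)) = 1 := by
        have e1 : (1 : Fin (K + 3)) ≤ k.succ.succ := by simp [Fin.le_def]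
        have e2 : (2 : Fin (K + 3)) ≤ k.succ.succ := by
          simp [Fin.le_def, Nat.mod_eq_of_lt]
        simp only [hsgn, encode_inl_inl, decide_eq_true e1, decide_eq_true e2, if_true]
        simp
      rw [h1, one_mul]
      have h2 : ∀ m, ph m (encode K L (Sum.inl ⟨k, l⟩)) *
          (List.ofFn fun l' => ct m l' (encode K L (Sum.inl ⟨k, l⟩))).prod =
          if h : (m : ℕ) < k then -Complex.I • (Hl (l ⟨m, h⟩) : Op (Fin n)) else 1 := by
        intro m
        simp only [hph, hct, encode_inl_inl, encode_inl_inr, decide_eq_true_eq]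
        have e : (⟨m + 3, by omega⟩ : Fin (K + 3)) ≤ k.succ.succ ↔ (m : ℕ) < k := by
          simp only [Fin.le_def, Fin.val_succ]
          omega
        simp only [e]
        by_cases h : (m : ℕ) < k
        · simp only [h, if_true, dif_pos, exists_true_left]
          rw [ofFn_prod_ite (fun l' => (Hl l' : Op (Fin n))), smul_mul_assoc, one_mul]
        · simp [h]
      simp only [h2]
      rw [ofFn_prod_dite (Nat.le_of_lt_succ k.2)
        fun m => -Complex.I • (Hl (l m) : Op (Fin n)), ofFn_prod_smul]
      rfl
    · have h1 : (List.ofFn fun m => ph m (encode K L (Sum.inr b)) *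
          (List.ofFn fun l => ct m l (encode K L (Sum.inr b))).prod).prod = 1 := by
        refine List.prod_eq_one fun A hA => ?_
        obtain ⟨m, rfl⟩ := (List.mem_ofFn' _ _).1 hA
        have e : ¬ (⟨m + 3, by omega⟩ : Fin (K + 3)) ≤ if b then 0 else 1 := by
          cases b <;> simp [Fin.le_def]
        simp [hph, hct, encode, flagState, e]
      rw [h1, mul_one]
      have e2 : ¬ (2 : Fin (K + 3)) ≤ if b then 0 else 1 := by
        cases b <;> simp [Fin.ext_iff, Fin.le_def, Nat.mod_eq_of_lt]
      have e1 : (1 : Fin (K + 3)) ≤ (if b then 0 else 1) ↔ b = false := by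
        cases b <;> simp
      simp only [hsgn, encode, flagState, Sum.elim_inl, decide_eq_true_eq, e1, e2, if_false]
      cases b <;> simp [lcuUnitary]

end

/-! ### Segment circuits -/

/-- Operators on system and ancillas as operators on the product space. -/
def toJoint {n a : ℕ} (A : Op (Fin n ⊕ Fin a)) : JointOp a n :=
  Matrix.of fun p q => A (Sum.elim p.2 p.1) (Sum.elim q.2 q.1)

/-- Pairs of basis states of ancillas and system are basis states of the sum. -/
def jointEquiv (n a : ℕ) : Basis (Fin a) × Basis (Fin n) ≃ Basis (Fin n ⊕ Fin a) where
  toFun p := Sum.elim p.2 p.1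
  invFun x := (x ∘ Sum.inr, x ∘ Sum.inl)
  left_inv p := by simp
  right_inv x := by simp

section Joint

variable {n a w : ℕ}

theorem toJoint_mul (A B : Op (Fin n ⊕ Fin a)) : toJoint (A * B) = toJoint A * toJoint B := by
  ext p q
  simp only [toJoint, Matrix.of_apply, Matrix.mul_apply]
  exact ((jointEquiv n a).sum_comp fun z => A (Sum.elim p.2 p.1) z * B z (Sum.elim q.2 q.1)).symm

theorem toJoint_conjTranspose (A : Op (Fin n ⊕ Fin a)) : toJoint Aᴴ = (toJoint A)ᴴ := rfl

theorem toJoint_one : toJoint (1 : Op (Fin n ⊕ Fin a)) = 1 := by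
  ext p q
  simp only [toJoint, Matrix.of_apply, Matrix.one_apply]
  congr 1
  exact propext ((jointEquiv n a).injective.eq_iff (a := p) (b := q))

theorem toJoint_lift_inr (G : Op (Fin a)) :
    toJoint (lift (Sum.inr : Fin a → Fin n ⊕ Fin a) G) = G ⊗ₖ (1 : Op (Fin n)) := by
  ext p q
  simp only [toJoint, lift, Matrix.of_apply, Matrix.kroneckerMap_apply, Matrix.one_apply]
  have : (∀ k : Fin n ⊕ Fin a, (∀ i, Sum.inr i ≠ k) →
      Sum.elim p.2 p.1 k = Sum.elim q.2 q.1 k) ↔ p.2 = q.2 := by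
    simp [Sum.forall, funext_iff]
  simp only [this, mul_ite, mul_one, mul_zero]
  rfl

theorem toJoint_lcuW (G : Op (Fin a)) (S : Op (Fin n ⊕ Fin a)) :
    toJoint ((lift Sum.inr G)ᴴ * S * lift Sum.inr G) = lcuW G (toJoint S) := by
  rw [toJoint_mul, toJoint_mul, ← lift_conjTranspose, toJoint_lift_inr, toJoint_lift_inr, lcuW]

/-- Started with clean work qubits, `C` acts as `M` on ancillas and system and returns the work
qubits clean. -/
def ActsAs (C : Op (SegWires n a w)) (M : JointOp a n) : Prop :=
  ∀ v y, C *ᵥ ket (joinBasis y v (zero _)) = ∑ p, M p (v, y) • ket (joinBasis p.2 p.1 (zero _))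

theorem ActsAs.mul {C D : Op (SegWires n a w)} {M N : JointOp a n} (hC : ActsAs C M)
    (hD : ActsAs D N) : ActsAs (C * D) (M * N) := by
  intro v y
  rw [← Matrix.mulVec_mulVec, hD, Matrix.mulVec_sum]
  simp only [Matrix.mulVec_smul, hC _ _, Finset.smul_sum, smul_smul, Matrix.mul_apply,
    Finset.sum_smul]
  rw [Finset.sum_comm]
  exact Finset.sum_congr rfl fun p _ => Finset.sum_congr rfl fun q _ =>
    congrArg (· • _) (mul_comm (N q (v, y)) (M p q))

theorem ActsAs.one : ActsAs (1 : Op (SegWires n a w)) 1 := by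
  intro v y
  rw [Finset.sum_eq_single (v, y)]
  · simp
  · intro p _ hp
    simp [Matrix.one_apply_ne hp]
  · simp

theorem ActsAs.smul {C : Op (SegWires n a w)} {M : JointOp a n} (h : ActsAs C M) (z : ℂ) :
    ActsAs (z • C) (z • M) := by
  intro v y
  simp only [Matrix.smul_mulVec, h v y, Finset.smul_sum, smul_smul, Matrix.smul_apply,
    smul_eq_mul]

theorem ActsAs.pow {C : Op (SegWires n a w)} {M : JointOp a n} (h : ActsAs C M) (k : ℕ) :
    ActsAs (C ^ k) (M ^ k) := by
  induction k with
  | zero => simpa using ActsAs.one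
  | succ k ih => simpa only [pow_succ] using ih.mul h

/-- The wires of system and ancillas. -/
def coreWires (n a w : ℕ) : Fin n ⊕ Fin a ↪ SegWires n a w :=
  ⟨Sum.map id Sum.inl, Function.Injective.sumMap Function.injective_id Sum.inl_injective⟩

theorem actsAs_lift (A : Op (Fin n ⊕ Fin a)) :
    ActsAs (lift (coreWires n a w) A) (toJoint A) := by
  intro v y
  rw [lift_ket (coreWires n a w).injective, ← (jointEquiv n a).sum_comp]
  refine Finset.sum_congr rfl fun p _ => ?_
  have h1 : joinBasis y v (zero (Fin w)) ∘ coreWires n a w = Sum.elim y v := by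
    ext k
    cases k <;> rfl
  have h2 : Function.extend (coreWires n a w) (jointEquiv n a p) (joinBasis y v (zero (Fin w))) =
      joinBasis p.2 p.1 (zero (Fin w)) := by
    refine ((eq_extend_iff (coreWires n a w).injective _ _ _).2 ⟨?_, ?_⟩).symm
    · rintro (k | k | k) hk
      · exact absurd rfl (hk (Sum.inl k))
      · exact absurd rfl (hk (Sum.inr k))
      · rfl
    · ext k
      cases k <;> rfl
  rw [h1, h2]
  rfl

theorem joinBasis_inj {x x' : Basis (Fin n)} {u u' : Basis (Fin a)} {z z' : Basis (Fin w)} :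
    joinBasis x u z = joinBasis x' u' z' ↔ x = x' ∧ u = u' ∧ z = z' := by
  simp only [joinBasis, Sum.elim_eq_iff]

theorem ActsAs.apply {C : Op (SegWires n a w)} {M : JointOp a n} (h : ActsAs C M)
    (x y : Basis (Fin n)) (u v : Basis (Fin a)) (z : Basis (Fin w)) :
    C (joinBasis x u z) (joinBasis y v (zero (Fin w))) =
      if z = zero (Fin w) then M (u, x) (v, y) else 0 := by
  rw [← mulVec_ket C, h, Finset.sum_apply, Finset.sum_eq_single (u, x)]
  · simp [ket_apply, joinBasis_inj]
  · intro p _ hp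
    have : ¬ (x = p.2 ∧ u = p.1) := fun e => hp (Prod.ext e.2.symm e.1.symm)
    simp only [Pi.smul_apply, ket_apply, joinBasis_inj, smul_eq_mul]
    rw [if_neg fun e => this ⟨e.1, e.2.1⟩, mul_zero]
  · simp

theorem reflection_apply (p : Basis (Fin a) × Basis (Fin n)) (v : Basis (Fin a))
    (y : Basis (Fin n)) :
    reflection a n p (v, y) = if p = (v, y) then (if v = zero _ then -1 else 1) else 0 := by
  obtain ⟨u, x⟩ := p
  simp only [reflection, Matrix.kroneckerMap_apply, Matrix.sub_apply, Matrix.smul_apply,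
    Matrix.one_apply, Matrix.single_apply, Prod.mk.injEq, smul_eq_mul]
  by_cases hx : x = y
  · by_cases hu : u = v
    · subst hu
      by_cases h0 : u = zero _
      · subst h0
        simp [hx]
        norm_num
      · simp [hx, h0, Ne.symm h0]
    · have : ¬ (zero (Fin a) = u ∧ zero (Fin a) = v) := fun e => hu (e.1.symm.trans e.2)
      simp [hu, this]
  · simp [hx]

theorem exists_actsAs_reflection (n a : ℕ) :
    ∃ C : Op (SegWires n (a + 1) (a + 2)), Implementable C (6 * (a + 1) + 3) ∧
      ActsAs C (reflection (a + 1) n) := by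
  obtain ⟨C, hC, hC1⟩ := exists_reflection (ι := SegWires n (a + 1) (a + 2))
    (fun j => Sum.inr (Sum.inl j)) (fun k => Sum.inr (Sum.inr k)) (fun i j h => by simpa using h)
    (by simp)
  refine ⟨C, hC, fun v y => ?_⟩
  rw [hC1 _ fun k => rfl, Finset.sum_eq_single (v, y)]
  · have : (∀ j : Fin (a + 1), joinBasis y v (zero (Fin (a + 2))) (Sum.inr (Sum.inl j)) = false) ↔
        v = zero _ := by
      rw [funext_iff]
      rfl
    rw [reflection_apply, if_pos rfl]
    simp only [this]
  · intro p _ hp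
    rw [reflection_apply, if_neg hp, zero_smul]
  · simp

theorem exists_actsAs_ampStep {W : Op (Fin n ⊕ Fin (a + 1))} {N : ℕ} (hW : Implementable W N) :
    ∃ C : Op (SegWires n (a + 1) (a + 2)), Implementable C (2 * N + 12 * (a + 1) + 7) ∧
      ActsAs C (ampStep (toJoint W)) := by
  obtain ⟨R, hR, hR1⟩ := exists_actsAs_reflection n a
  have hW1 := hW.lift (coreWires n (a + 1) (a + 2))
  have hW2 := hW.conjTranspose.lift (coreWires n (a + 1) (a + 2))
  have hne : (Sum.inr (Sum.inl 0) : SegWires n (a + 1) (a + 2)) ≠ Sum.inr (Sum.inr 0) := by simp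
  have hneg : Implementable ((-1 : ℂ) • (1 : Op (SegWires n (a + 1) (a + 2)))) 1 := by
    rw [← mux_smul_one (Sum.inr (Sum.inl 0)) (Sum.inr (Sum.inr 0))]
    refine implementable_mux hne fun _ => ?_
    rw [Matrix.mem_unitaryGroup_iff]
    simp
  refine ⟨_, (hneg.mul (((hW1.mul hR).mul hW2).mul hR)).mono (by omega), ?_⟩
  have h : ampStep (toJoint W) = (-1 : ℂ) • (1 : JointOp (a + 1) n) *
      (toJoint W * reflection (a + 1) n * toJoint Wᴴ * reflection (a + 1) n) := by
    rw [ampStep, smul_mul_assoc, one_mul, neg_one_smul, toJoint_conjTranspose]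
  rw [h]
  exact (ActsAs.one.smul (-1)).mul ((((actsAs_lift W).mul hR1).mul (actsAs_lift Wᴴ)).mul hR1)

end Joint

theorem exists_segment {n L K : ℕ} {c : ℕ → ℝ} {τ : ℝ} {α : Fin L → ℝ}
    {Hl : Fin L → Matrix.unitaryGroup (Basis (Fin n)) ℂ} {s : ℝ} (rounds : ℕ)
    {A : Type} [Fintype A] [DecidableEq A] [Nonempty A] (enc : LCUIndex L K ↪ Basis A)
    {G : Op A} {NG : ℕ} (hG : Implementable G NG)
    (hG0 : G *ᵥ ket (zero A) =
      ∑ j, ((√(lcuCoeff c τ α s j / s) : ℝ) : ℂ) • ket (enc j))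
    {V : Basis A → Op (Fin n)} {NS : ℕ} (hV : Implementable (multiControlled V) NS)
    (hV1 : ∀ j, V (enc j) = lcuUnitary Hl j) :
    ∃ S : Segment K c τ α Hl s rounds,
      S.cost ≤ rounds * (2 * (2 * NG + NS) + 12 * Fintype.card A + 7) + (2 * NG + NS) := by
  -- The reflection and the global sign use an actual ancilla wire, so the register is written with
  -- a + 1 qubits.
  obtain ⟨a, ha⟩ := Nat.exists_eq_succ_of_ne_zero (Fintype.card_ne_zero (α := A))
  have e : A ≃ Fin (a + 1) := Fintype.equivFinOfCardEq ha
  have hG' := hG.lift e.toEmbedding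
  have hV' := hV.lift (Function.Embedding.sumMap (Function.Embedding.refl (Fin n)) e.toEmbedding)
  set G' : Op (Fin (a + 1)) := lift e.toEmbedding G
  set S' : Op (Fin n ⊕ Fin (a + 1)) :=
    lift (Function.Embedding.sumMap (Function.Embedding.refl (Fin n)) e.toEmbedding)
      (multiControlled V)
  have hGl := hG'.lift (⟨Sum.inr, Sum.inr_injective⟩ : Fin (a + 1) ↪ Fin n ⊕ Fin (a + 1))
  have hWi : Implementable ((lift (Sum.inr : _ → Fin n ⊕ Fin (a + 1)) G')ᴴ * S' *
      lift (Sum.inr : _ → Fin n ⊕ Fin (a + 1)) G') (2 * NG + NS) :=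
    ((hGl.conjTranspose.mul hV').mul hGl).mono (by omega)
  obtain ⟨T, hT, hT1⟩ := exists_actsAs_ampStep hWi
  rw [toJoint_lcuW] at hT1
  have hWa := actsAs_lift (w := a + 2) ((lift (Sum.inr : _ → Fin n ⊕ Fin (a + 1)) G')ᴴ * S' *
      lift (Sum.inr : _ → Fin n ⊕ Fin (a + 1)) G')
  rw [toJoint_lcuW] at hWa
  obtain ⟨C, hC, hCl⟩ := (hT.pow rounds).mul (hWi.lift (coreWires n (a + 1) (a + 2)))
  have hact := (hT1.pow rounds).mul hWa
  have hS'u := hV'.mem_unitaryGroup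
  refine ⟨{
    a := a + 1
    w := a + 2
    enc := enc.trans (Equiv.arrowCongr e (Equiv.refl Bool)).toEmbedding
    G := ⟨G', hG'.mem_unitaryGroup⟩
    G_zero := fun u => ?_
    sel := ⟨toJoint S', ?_⟩
    sel_apply := fun j u x y => ?_
    circuit := C
    circuit_apply := fun x y u v z => ?_ }, ?_⟩
  · have h1 : G' u (zero _) = (G *ᵥ ket (zero A)) (u ∘ e) := by
      rw [mulVec_ket]
      simp only [G', lift, Matrix.of_apply]
      rw [if_pos]
      · rfl
      · intro k hk
        exact absurd (e.apply_symm_apply k) (hk _)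
    have h2 : ∀ j, (u ∘ e = enc j) ↔ (enc j ∘ e.symm = u) := fun j =>
      ⟨fun h => by rw [← h]; ext; simp, fun h => by rw [← h]; ext; simp⟩
    simp only [h1, hG0, Finset.sum_apply, Pi.smul_apply, ket_apply, smul_eq_mul, mul_ite, mul_one,
      mul_zero, h2]
    rfl
  · rw [Matrix.mem_unitaryGroup_iff, Matrix.star_eq_conjTranspose, ← toJoint_conjTranspose,
      ← toJoint_mul, ← Matrix.star_eq_conjTranspose, Matrix.mem_unitaryGroup_iff.1 hS'u,
      toJoint_one]
  · have h2 : (u ∘ e = enc j) ↔ (u = enc j ∘ e.symm) :=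
      ⟨fun h => by rw [← h]; ext; simp, fun h => by rw [h]; ext; simp⟩
    change toJoint S' (u, x) (enc j ∘ e.symm, y) = if u = enc j ∘ e.symm then _ else _
    simp only [toJoint, S', lift, Matrix.of_apply]
    rw [if_pos]
    · have h3 : (enc j ∘ e.symm) ∘ e = enc j := by ext; simp
      change (if u ∘ e = (enc j ∘ e.symm) ∘ e then V ((enc j ∘ e.symm) ∘ e) x y else 0) = _
      simp only [h3, h2, hV1]
    · rintro (k | k) hk
      · exact absurd rfl (hk (Sum.inl k))
      · exact absurd (congrArg Sum.inr (e.apply_symm_apply k)) (hk (Sum.inr (e.symm k)))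
  · rw [hC]
    exact hact.apply x y u v z
  · refine hCl.trans (le_of_eq ?_)
    rw [ha]

/-! ### The coefficients -/

theorem coeffSum_eq {L : ℕ} (K : ℕ) (c : ℕ → ℝ) (τ : ℝ) (α : Fin L → ℝ) :
    coeffSum K c τ α =
      ∑ k ∈ Finset.range (K + 1), c k * ((τ * ∑ l, α l) ^ k / k.factorial) := by
  rw [coeffSum, Fintype.sum_sigma, Finset.sum_range]
  refine Finset.sum_congr rfl fun k _ => ?_
  simp only [taylorCoeff]
  rw [← Finset.mul_sum, ← Finset.sum_div, ← Finset.mul_sum, ← Fintype.sum_pow, mul_pow]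

theorem taylorCoeff_nonneg {L K : ℕ} {c : ℕ → ℝ} (hc : ∀ k, 0 ≤ c k) {τ : ℝ} (hτ : 0 ≤ τ)
    {α : Fin L → ℝ} (hα : ∀ l, 0 ≤ α l) (j : TaylorIndex L K) : 0 ≤ taylorCoeff c τ α j :=
  mul_nonneg (hc _) (div_nonneg (mul_nonneg (pow_nonneg hτ _)
    (Finset.prod_nonneg fun _ _ => hα _)) (Nat.cast_nonneg _))

theorem lcuCoeff_nonneg {L K : ℕ} {c : ℕ → ℝ} (hc : ∀ k, 0 ≤ c k) {τ : ℝ} (hτ : 0 ≤ τ)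
    {α : Fin L → ℝ} (hα : ∀ l, 0 ≤ α l) {s : ℝ} (hs : coeffSum K c τ α ≤ s) :
    ∀ j : LCUIndex L K, 0 ≤ lcuCoeff c τ α s j
  | Sum.inl j => taylorCoeff_nonneg hc hτ hα j
  | Sum.inr _ => div_nonneg (sub_nonneg.2 hs) zero_le_two

theorem weight₁_nonneg (k : ℕ) : 0 ≤ weight₁ k := zero_le_one

theorem weight₂_nonneg {p : ℝ} (hp : p < 1) (K k : ℕ) : 0 ≤ weight₂ p K k := by
  rw [weight₂]
  split_ifs
  exacts [zero_le_one, div_nonneg zero_le_one (sub_nonneg.2 hp.le)]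

theorem exists_taylor_segment {n L K κ : ℕ} (hn : 1 ≤ n) {c : ℕ → ℝ} (hc : ∀ k, 0 ≤ c k) {τ : ℝ}
    (hτ : 0 ≤ τ) {α : Fin L → ℝ} (hα : ∀ l, 0 ≤ α l) (hαpos : 0 < ∑ l, α l)
    {Hl : Fin L → Matrix.unitaryGroup (Basis (Fin n)) ℂ}
    (hHl : ∀ l, Implementable (controlled (Hl l : Op (Fin n))) (κ * n)) {s : ℝ} (hs0 : 0 < s)
    (hs : coeffSum K c τ α ≤ s) {rounds : ℕ} (hr : rounds ≤ 2) :
    ∃ S : Segment K c τ α Hl s rounds, S.cost ≤ (5 * κ + 250) * (n * L * (K + 1)) := by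
  obtain _ | L := L
  · simp at hαpos
  set A := ∑ l, α l with hA
  set γ := (s - coeffSum K c τ α) / 2 with hγ
  have hγ0 : 0 ≤ γ := div_nonneg (sub_nonneg.2 hs) zero_le_two
  set b : ℕ → ℝ := fun k => c k * ((τ * A) ^ k / k.factorial) with hb
  have hb0 : ∀ k, 0 ≤ b k := fun k =>
    mul_nonneg (hc k) (div_nonneg (pow_nonneg (mul_nonneg hτ hαpos.le) _) (Nat.cast_nonneg _))
  -- The weight of a branch: γ/s for the two padding terms, and the total coefficient of order k,
  -- divided by s, for branch k + 2. Within an order the letters are independent with probabilities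
  -- α_l / A, which restores the individual coefficients.
  set q : Fin (K + 3) → ℝ := fun p => (if (p : ℕ) < 2 then γ else b (p - 2)) / s with hq
  have hq0 : ∀ p, 0 ≤ q p := fun p => by
    refine div_nonneg ?_ hs0.le
    split_ifs
    exacts [hγ0, hb0 _]
  have hq1 : ∑ p, √(q p) ^ 2 = 1 := by
    simp only [Real.sq_sqrt (hq0 _)]
    rw [Fin.sum_univ_succ, Fin.sum_univ_succ]
    have : ∑ k : Fin (K + 1), q k.succ.succ = coeffSum K c τ α / s := by
      rw [coeffSum_eq, Finset.sum_div, Finset.sum_range]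
      refine Finset.sum_congr rfl fun k _ => ?_
      simp [hq, hb, hA]
    rw [this]
    simp only [hq, Fin.val_zero, Fin.val_succ, hγ]
    norm_num
    field_simp
    ring
  set φ : Fin (L + 1) → ℝ := fun l => α l / A with hφ
  have hφ0 : ∀ l, 0 ≤ φ l := fun l => div_nonneg (hα l) hαpos.le
  have hφ1 : ∑ l, √(φ l) ^ 2 = 1 := by
    simp only [Real.sq_sqrt (hφ0 _)]
    rw [hφ, ← Finset.sum_div]
    exact div_self hαpos.ne'
  obtain ⟨G, hG, hG0⟩ := exists_prepare (K := K) (fun p => √(q p)) (fun p => Real.sqrt_nonneg _)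
    hq1 (fun l => √(φ l)) (fun l => Real.sqrt_nonneg _) hφ1
  obtain ⟨V, hV, hV1⟩ := exists_select (K := K) Hl hHl
  have hG1 : G *ᵥ ket (zero _) = ∑ j, ((√(lcuCoeff c τ α s j / s) : ℝ) : ℂ) •
      ket ((⟨encode K L, encode_injective K L⟩ : LCUIndex (L + 1) K ↪ Basis (Ancilla K L)) j) := by
    rw [hG0]
    refine Finset.sum_congr rfl fun j _ => ?_
    rw [Function.Embedding.coeFn_mk]
    congr 1
    rcases j with ⟨k, l⟩ | b'
    · simp only
      rw [← Complex.ofReal_prod, ← Complex.ofReal_mul, ← Real.sqrt_prod _ fun m _ => hφ0 _,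
        ← Real.sqrt_mul (hq0 _)]
      congr 2
      simp only [hq, hb, hφ, lcuCoeff, taylorCoeff, Fin.val_succ, Finset.prod_div_distrib,
        Finset.prod_const, Finset.card_univ, Fintype.card_fin, mul_pow]
      rw [if_neg (by omega), Nat.add_sub_cancel (n := (k : ℕ)) (m := 2)]
      have := (pow_pos hαpos (k : ℕ)).ne'
      have h2 : ((k : ℕ).factorial : ℝ) ≠ 0 := Nat.cast_ne_zero.2 (Nat.factorial_ne_zero _)
      field_simp
    · cases b' <;> simp [hq, lcuCoeff, hγ]
  obtain ⟨S, hS⟩ := exists_segment rounds _ hG hG1 hV hV1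
  refine ⟨S, hS.trans ?_⟩
  have hcard : Fintype.card (Ancilla K L) = K + 3 + K * (L + 1) := by simp
  rw [hcard]
  obtain ⟨n, rfl⟩ := Nat.exists_eq_add_of_le hn
  generalize hX : 2 * (K * (2 * L + 1) + (2 * (K + 2) + 1)) +
    (2 + K * (1 + (L + 1) * (κ * (1 + n)))) = X
  -- With two rounds W or its adjoint runs five times, and only SELECT involves κ; hence 5κ. The
  -- constant 250 generously covers everything else.
  calc rounds * (2 * X + 12 * (K + 3 + K * (L + 1)) + 7) + X
      ≤ 2 * (2 * X + 12 * (K + 3 + K * (L + 1)) + 7) + X := by gcongr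
    _ ≤ (5 * κ + 250) * ((1 + n) * (L + 1) * (K + 1)) := by
        rw [← hX]
        ring_nf
        have h1 := Nat.zero_le (K * L * n * κ)
        nlinarith [Nat.zero_le (K * L), Nat.zero_le (K * L * n), Nat.zero_le (K * n),
          Nat.zero_le (L * n), Nat.zero_le (κ * n), Nat.zero_le (κ * L), Nat.zero_le (κ * L * n)]

/-! ### Numerical constants and the size of the mean truncation order -/

theorem log_two_gt : 0.693 < Real.log 2 := by linarith [Real.log_two_gt_d9]

/-- The closed form of the amplification target. -/
theorem sin_pi_div_ten : Real.sin (Real.pi / 10) = (√5 - 1) / 4 := by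
  have h := Real.cos_pi_div_five
  have h2 : Real.cos (Real.pi / 5) = 1 - 2 * Real.sin (Real.pi / 10) ^ 2 := by
    rw [show Real.pi / 5 = 2 * (Real.pi / 10) by ring, Real.cos_two_mul']
    linarith [Real.sin_sq_add_cos_sq (Real.pi / 10)]
  have h0 : 0 ≤ Real.sin (Real.pi / 10) :=
    Real.sin_nonneg_of_nonneg_of_le_pi (by positivity) (by linarith [Real.pi_pos])
  have h5 : √5 ^ 2 = 5 := Real.sq_sqrt (by norm_num)
  have h1 : 1 ≤ √5 := Real.one_le_sqrt.2 (by norm_num)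
  have hsq : Real.sin (Real.pi / 10) ^ 2 = ((√5 - 1) / 4) ^ 2 := by nlinarith
  exact (pow_left_inj₀ h0 (by linarith) two_ne_zero).1 hsq

theorem sTwo_eq : sTwo = √5 + 1 := by
  rw [sTwo, sin_pi_div_ten, inv_eq_one_div, div_eq_iff]
  · linarith [Real.mul_self_sqrt (show (0 : ℝ) ≤ 5 by norm_num)]
  · have : 1 < √5 := Real.lt_sqrt_of_sq_lt (by norm_num)
    linarith

theorem sTwo_lt : sTwo < 3.2361 := by
  have : √5 < 2.2361 := (Real.sqrt_lt' (by norm_num)).2 (by norm_num)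
  rw [sTwo_eq]
  linarith

theorem sTwo_gt : 3.236 < sTwo := by
  have : 2.236 < √5 := Real.lt_sqrt_of_sq_lt (by norm_num)
  rw [sTwo_eq]
  linarith

/-- The mean order could be tiny only for `K₁` = 0 and p near 1. But then the coefficients of `F₂`
sum to at least 1 + ln 2/(1-p), and the bound by `sTwo` forces 1 - p > 1/4. -/
theorem one_le_mean_order {L : ℕ} {K₁ K₂ : ℕ} {τ p : ℝ} {α : Fin L → ℝ}
    (hτ : τ * ∑ l, α l = Real.log 2) (h12 : K₁ ≤ K₂) (hK₂ : 1 ≤ K₂) (hp0 : 0 ≤ p) (hp : p < 1)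
    (hs : coeffSum K₂ (weight₂ p K₁) τ α ≤ sTwo) :
    1 ≤ 4 * (p * K₁ + (1 - p) * K₂) := by
  have hK₂' : (1 : ℝ) ≤ K₂ := by exact_mod_cast hK₂
  rcases Nat.eq_zero_or_pos K₁ with h0 | h1
  · subst h0
    have hlt : (0 : ℝ) < 1 - p := by linarith
    have hle : 1 + 1 / (1 - p) * Real.log 2 ≤ coeffSum K₂ (weight₂ p 0) τ α := by
      rw [coeffSum_eq, hτ]
      refine le_trans (le_of_eq ?_) (Finset.sum_le_sum_of_subset_of_nonneg
        (Finset.range_mono (show 2 ≤ K₂ + 1 by omega)) fun k _ _ => mul_nonneg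
          (weight₂_nonneg hp 0 k) (div_nonneg (pow_nonneg (Real.log_nonneg one_le_two) _)
          (Nat.cast_nonneg _)))
      simp [Finset.sum_range_succ, weight₂]
    have h3 : 1 / (1 - p) * Real.log 2 ≤ 2.2361 := by linarith [sTwo_lt]
    rw [one_div, inv_mul_le_iff₀ hlt] at h3
    have h4 := log_two_gt
    push_cast
    nlinarith
  · have h1' : (1 : ℝ) ≤ K₁ := by exact_mod_cast h1
    nlinarith

/-! ### The block of the ancilla state zero -/

section Block

variable {n a : ℕ}

/-- The block `(⟨0| ⊗ 1) M (|0⟩ ⊗ 1)`. -/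
def zeroBlock : JointOp a n →ₗ[ℂ] Op (Fin n) where
  toFun M := Matrix.of fun x y => M (zero _, x) (zero _, y)
  map_add' _ _ := rfl
  map_smul' _ _ := rfl

/-- The projector `|0⟩⟨0| ⊗ 1`. -/
def zeroProj (a n : ℕ) : JointOp a n := Matrix.diagonal fun p => if p.1 = zero _ then 1 else 0

theorem zeroBlock_apply (M : JointOp a n) (x y : Basis (Fin n)) :
    zeroBlock M x y = M (zero _, x) (zero _, y) := rfl

theorem zeroBlock_one : zeroBlock (1 : JointOp a n) = 1 := by
  ext x y
  simp [zeroBlock_apply, Matrix.one_apply]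

theorem zeroBlock_conjTranspose (M : JointOp a n) : zeroBlock Mᴴ = (zeroBlock M)ᴴ := rfl

theorem zeroBlock_mul_zeroProj (M : JointOp a n) :
    zeroBlock (M * zeroProj a n) = zeroBlock M := by
  ext x y
  simp [zeroBlock_apply, zeroProj, Matrix.mul_diagonal]

theorem zeroBlock_zeroProj_mul (M : JointOp a n) :
    zeroBlock (zeroProj a n * M) = zeroBlock M := by
  ext x y
  simp [zeroBlock_apply, zeroProj, Matrix.diagonal_mul]

theorem zeroBlock_mul_mul (M N : JointOp a n) :
    zeroBlock (M * zeroProj a n * N) = zeroBlock M * zeroBlock N := by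
  ext x y
  rw [zeroBlock_apply, Matrix.mul_apply, Fintype.sum_prod_type, Finset.sum_eq_single (zero _)]
  · rw [Matrix.mul_apply]
    refine Finset.sum_congr rfl fun z _ => ?_
    rw [zeroProj, Matrix.mul_diagonal]
    simp [zeroBlock_apply]
  · intro u _ hu
    simp [zeroProj, Matrix.mul_diagonal, hu]
  · simp

theorem reflection_eq : reflection a n = 1 - (2 : ℂ) • zeroProj a n := by
  ext p q
  rw [show q = (q.1, q.2) from rfl, reflection_apply]
  by_cases h : p = q
  · subst h
    simp only [Matrix.sub_apply, Matrix.one_apply_eq, Matrix.smul_apply, zeroProj,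
      Matrix.diagonal_apply_eq, smul_eq_mul, if_true, mul_ite, mul_one, mul_zero]
    split_ifs <;> norm_num
  · simp [zeroProj, h]

variable {W : JointOp a n} (hW : W * Wᴴ = 1) (hW' : Wᴴ * W = 1)
include hW hW'

theorem ampStep_mul :
    ampStep W * W = -W + (2 : ℂ) • (W * zeroProj a n) + (2 : ℂ) • (zeroProj a n * W)
      - (4 : ℂ) • (W * zeroProj a n * (Wᴴ * zeroProj a n * W)) := by
  have e1 : W * Wᴴ * W = W := by rw [hW, one_mul]
  have e2 : W * zeroProj a n * Wᴴ * W = W * zeroProj a n := by rw [mul_assoc, hW', mul_one]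
  have e3 : W * Wᴴ * zeroProj a n * W = zeroProj a n * W := by rw [hW, one_mul]
  rw [ampStep, reflection_eq]
  simp only [mul_sub, sub_mul, mul_one, Matrix.mul_smul, Matrix.smul_mul, neg_mul, e1, e2, e3,
    ← mul_assoc]
  module

theorem zeroBlock_ampStep_mul :
    zeroBlock (ampStep W * W) =
      (3 : ℂ) • zeroBlock W - (4 : ℂ) • (zeroBlock W * (zeroBlock W)ᴴ * zeroBlock W) := by
  rw [ampStep_mul hW hW']
  simp only [map_add, map_sub, map_neg, map_smul, zeroBlock_mul_zeroProj, zeroBlock_zeroProj_mul,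
    zeroBlock_mul_mul, zeroBlock_conjTranspose, ← mul_assoc]
  module

/-- Writing Y = T W, the expansion of T Y involves only the zero blocks of W, of Y and of W†Y. The
first round gives the block of Y, and W†W = 1 simplifies that of W†Y to 1 - 2B†B with B the block of
W. -/
theorem zeroBlock_ampStep_sq_mul :
    zeroBlock (ampStep W ^ 2 * W) =
      (5 : ℂ) • zeroBlock W - (20 : ℂ) • (zeroBlock W * (zeroBlock W)ᴴ * zeroBlock W) +
        (16 : ℂ) • (zeroBlock W * (zeroBlock W)ᴴ * zeroBlock W * (zeroBlock W)ᴴ *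
          zeroBlock W) := by
  set Y := ampStep W * W with hY
  have hWY : Wᴴ * Y = -1 + (2 : ℂ) • zeroProj a n + (2 : ℂ) • (Wᴴ * zeroProj a n * W)
      - (4 : ℂ) • (zeroProj a n * (Wᴴ * zeroProj a n * W)) := by
    rw [hY, ampStep_mul hW hW']
    simp only [mul_sub, mul_add, mul_neg, Matrix.mul_smul, ← mul_assoc, hW', one_mul]
  have hBY := zeroBlock_ampStep_mul hW hW'
  rw [← hY] at hBY
  have hBP : zeroBlock (zeroProj a n) = (1 : Op (Fin n)) := by
    rw [← one_mul (zeroProj a n), zeroBlock_mul_zeroProj, zeroBlock_one]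
  have hBWY : zeroBlock (Wᴴ * Y) =
      1 - (2 : ℂ) • ((zeroBlock W)ᴴ * zeroBlock W) := by
    rw [hWY]
    simp only [map_add, map_sub, map_neg, map_smul, zeroBlock_zeroProj_mul,
      zeroBlock_mul_mul, zeroBlock_conjTranspose, zeroBlock_one, hBP]
    module
  have e1 : ampStep W ^ 2 * W = -Y + (2 : ℂ) • (zeroProj a n * Y) +
      (2 : ℂ) • (W * zeroProj a n * (Wᴴ * Y)) -
      (4 : ℂ) • (W * zeroProj a n * (Wᴴ * zeroProj a n * Y)) := by
    rw [pow_two, mul_assoc, ← hY, ampStep, reflection_eq]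
    simp only [mul_sub, sub_mul, mul_one, one_mul, Matrix.mul_smul, Matrix.smul_mul, neg_mul, hW,
      ← mul_assoc]
    module
  rw [e1]
  simp only [map_add, map_sub, map_neg, map_smul, zeroBlock_zeroProj_mul,
    zeroBlock_mul_mul, zeroBlock_conjTranspose, hBWY, hBY]
  simp only [mul_sub, mul_one, Matrix.mul_smul, ← mul_assoc]
  module

end Block

/-! ### The linear combination -/

theorem sum_pow_eq_sum_ofFn {R ι : Type*} [Semiring R] [Fintype ι] (a : ι → R) (k : ℕ) :
    (∑ l, a l) ^ k = ∑ f : Fin k → ι, (List.ofFn fun m => a (f m)).prod := by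
  induction k with
  | zero => simp
  | succ k ih =>
    rw [pow_succ', ih, ← (Fin.consEquiv fun _ : Fin (k + 1) => ι).sum_comp, Fintype.sum_prod_type,
      Finset.sum_mul_sum]
    refine Finset.sum_congr rfl fun i _ => Finset.sum_congr rfl fun f _ => ?_
    rw [List.ofFn_succ, List.prod_cons]
    rfl

theorem ofFn_smul_prod {R M : Type*} [CommSemiring R] [Semiring M] [Algebra R M] {k : ℕ}
    (z : Fin k → R) (a : Fin k → M) :
    (List.ofFn fun m => z m • a m).prod = (∏ m, z m) • (List.ofFn a).prod := by
  induction k with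
  | zero => simp
  | succ k ih =>
    rw [List.ofFn_succ, List.prod_cons, List.ofFn_succ, List.prod_cons, ih, smul_mul_smul_comm,
      Fin.prod_univ_succ]

/-- The truncated series with the orders weighted by `c`. -/
def weightedSeries {n : ℕ} (H : Op (Fin n)) (τ : ℝ) (c : ℕ → ℝ) (K : ℕ) : Op (Fin n) :=
  ∑ k ∈ Finset.range (K + 1), (c k : ℂ) • taylorTerm H τ k

theorem weightedSeries_weight₁ {n : ℕ} (H : Op (Fin n)) (τ : ℝ) (K : ℕ) :
    weightedSeries H τ weight₁ K = F₁ H τ K := by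
  simp [weightedSeries, weight₁, F₁]

theorem sum_weight₂ {M : Type*} [AddCommGroup M] [Module ℂ M] (f : ℕ → M) (p : ℝ) {K₁ K₂ : ℕ}
    (h : K₁ ≤ K₂) : ∑ k ∈ Finset.range (K₂ + 1), (weight₂ p K₁ k : ℂ) • f k =
      ∑ k ∈ Finset.range (K₁ + 1), f k +
        ((1 / (1 - p) : ℝ) : ℂ) • ∑ k ∈ Finset.Ioc K₁ K₂, f k := by
  have hd : Disjoint (Finset.range (K₁ + 1)) (Finset.Ioc K₁ K₂) := by
    rw [Finset.disjoint_left]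
    intro k hk hk'
    simp only [Finset.mem_range, Finset.mem_Ioc] at hk hk'
    omega
  have hu : Finset.range (K₂ + 1) = Finset.range (K₁ + 1) ∪ Finset.Ioc K₁ K₂ := by
    ext k
    simp only [Finset.mem_union, Finset.mem_range, Finset.mem_Ioc]
    omega
  rw [hu, Finset.sum_union hd, Finset.smul_sum]
  congr 1
  · refine Finset.sum_congr rfl fun k hk => ?_
    simp [weight₂, Nat.le_of_lt_succ (Finset.mem_range.1 hk)]
  · refine Finset.sum_congr rfl fun k hk => ?_
    rw [weight₂, if_neg (not_le.2 (Finset.mem_Ioc.1 hk).1)]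

theorem weightedSeries_weight₂ {n : ℕ} (H : Op (Fin n)) (τ p : ℝ) {K₁ K₂ : ℕ} (h : K₁ ≤ K₂) :
    weightedSeries H τ (weight₂ p K₁) K₂ = F₂ H τ p K₁ K₂ :=
  sum_weight₂ _ p h

/-- The padding terms cancel. The powers of H expand into ordered products, since the H_l need not
commute. -/
theorem sum_lcu {n L K : ℕ} (c : ℕ → ℝ) (τ : ℝ) (α : Fin L → ℝ)
    (Hl : Fin L → Matrix.unitaryGroup (Basis (Fin n)) ℂ) (s : ℝ) :
    ∑ j : LCUIndex L K, (lcuCoeff c τ α s j : ℂ) • lcuUnitary Hl j =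
      weightedSeries (hamiltonian α Hl) τ c K := by
  rw [Fintype.sum_sum_type, Fintype.sum_bool]
  simp only [lcuCoeff, lcuUnitary, if_true, Bool.false_eq_true, if_false, smul_neg,
    add_neg_cancel, add_zero]
  rw [Fintype.sum_sigma, weightedSeries, Finset.sum_range]
  refine Finset.sum_congr rfl fun k _ => ?_
  rw [taylorTerm, smul_pow, hamiltonian, sum_pow_eq_sum_ofFn, Finset.smul_sum, Finset.smul_sum,
    Finset.smul_sum]
  refine Finset.sum_congr rfl fun l _ => ?_
  rw [ofFn_smul_prod (fun m => (α (l m) : ℂ)) fun m => (Hl (l m) : Op (Fin n))]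
  simp only [taylorCoeff, taylorUnitary, smul_smul]
  congr 1
  push_cast
  rw [← neg_mul, mul_pow]
  field_simp

/-! ### Block and success probability of a segment circuit -/

namespace Segment

variable {n L K : ℕ} {c : ℕ → ℝ} {τ : ℝ} {α : Fin L → ℝ}
  {Hl : Fin L → Matrix.unitaryGroup (Basis (Fin n)) ℂ} {s : ℝ} {rounds : ℕ}

/-- SELECT is specified only on encoded indices. That is enough, because the column G|0⟩ is
supported there; the two amplitudes √(β_j/s) multiply to β_j/s. -/
theorem zeroBlock_lcuW (S : Segment K c τ α Hl s rounds) (hs : 0 < s)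
    (hβ : ∀ j : LCUIndex L K, 0 ≤ lcuCoeff c τ α s j) :
    zeroBlock (lcuW (S.G : Op (Fin S.a)) (S.sel : JointOp S.a n)) =
      ((1 / s : ℝ) : ℂ) • weightedSeries (hamiltonian α Hl) τ c K := by
  ext x y
  have hG : ∀ j, (S.G : Op (Fin S.a)) (S.enc j) (zero _) =
      ((√(lcuCoeff c τ α s j / s) : ℝ) : ℂ) := fun j => by
    rw [S.G_zero]
    simp [S.enc.injective.eq_iff]
  have h1 : zeroBlock (lcuW (S.G : Op (Fin S.a)) (S.sel : JointOp S.a n)) x y =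
      ∑ v, ∑ u, star ((S.G : Op (Fin S.a)) u (zero _)) * (S.sel : JointOp S.a n) (u, x) (v, y) *
        (S.G : Op (Fin S.a)) v (zero _) := by
    simp only [zeroBlock_apply, lcuW, Matrix.mul_apply, Fintype.sum_prod_type,
      Matrix.kroneckerMap_apply, Matrix.one_apply, mul_ite, mul_one, mul_zero, ite_mul, zero_mul,
      Finset.sum_ite_eq', Finset.sum_ite_eq, Finset.mem_univ, if_true,
      Matrix.conjTranspose_apply, Finset.sum_mul]
  have h2 : ∀ v, (S.G : Op (Fin S.a)) v (zero _) =
      ∑ j, if S.enc j = v then ((√(lcuCoeff c τ α s j / s) : ℝ) : ℂ) else 0 := S.G_zero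
  rw [h1]
  calc _ = ∑ v, ∑ j, if S.enc j = v then
        (∑ u, star ((S.G : Op (Fin S.a)) u (zero _)) * (S.sel : JointOp S.a n) (u, x) (v, y)) *
          ((√(lcuCoeff c τ α s j / s) : ℝ) : ℂ) else 0 := by
        refine Finset.sum_congr rfl fun v _ => ?_
        rw [← Finset.sum_mul, h2 v, Finset.mul_sum]
        simp only [mul_ite, mul_zero]
    _ = ∑ j, (∑ u, star ((S.G : Op (Fin S.a)) u (zero _)) *
          (S.sel : JointOp S.a n) (u, x) (S.enc j, y)) *
          ((√(lcuCoeff c τ α s j / s) : ℝ) : ℂ) := by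
        rw [Finset.sum_comm]
        simp
    _ = ∑ j, ((1 / s : ℝ) : ℂ) * ((lcuCoeff c τ α s j : ℂ) * lcuUnitary Hl j x y) := by
        refine Finset.sum_congr rfl fun j _ => ?_
        simp only [S.sel_apply, mul_ite, mul_zero, Finset.sum_ite_eq', Finset.mem_univ, if_true,
          hG]
        rw [Complex.star_def, Complex.conj_ofReal, mul_right_comm, ← Complex.ofReal_mul,
          Real.mul_self_sqrt (div_nonneg (hβ j) hs.le)]
        push_cast
        ring
    _ = _ := by
        rw [← sum_lcu c τ α Hl s, Matrix.smul_apply, Matrix.sum_apply, smul_eq_mul,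
          Finset.mul_sum]
        rfl

theorem lcuW_mul_conjTranspose (S : Segment K c τ α Hl s rounds) :
    lcuW (S.G : Op (Fin S.a)) (S.sel : JointOp S.a n) *
      (lcuW (S.G : Op (Fin S.a)) (S.sel : JointOp S.a n))ᴴ = 1 := by
  have hG : (S.G : Op (Fin S.a)) * (S.G : Op (Fin S.a))ᴴ = 1 :=
    Matrix.mem_unitaryGroup_iff.1 S.G.2
  have hG' : (S.G : Op (Fin S.a))ᴴ * (S.G : Op (Fin S.a)) = 1 :=
    Matrix.mem_unitaryGroup_iff'.1 S.G.2
  have hs : (S.sel : JointOp S.a n) * (S.sel : JointOp S.a n)ᴴ = 1 :=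
    Matrix.mem_unitaryGroup_iff.1 S.sel.2
  set g := (S.G : Op (Fin S.a)) ⊗ₖ (1 : Op (Fin n)) with hg
  have hgh : (S.G : Op (Fin S.a))ᴴ ⊗ₖ (1 : Op (Fin n)) = gᴴ := by
    rw [hg, Matrix.conjTranspose_kronecker, Matrix.conjTranspose_one]
  have h1 : g * gᴴ = 1 := by
    rw [← hgh, hg, ← Matrix.mul_kronecker_mul, hG, one_mul, Matrix.one_kronecker_one]
  have h2 : gᴴ * g = 1 := by
    rw [← hgh, hg, ← Matrix.mul_kronecker_mul, hG', one_mul, Matrix.one_kronecker_one]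
  rw [lcuW, ← hg, hgh, Matrix.conjTranspose_mul, Matrix.conjTranspose_mul,
    Matrix.conjTranspose_conjTranspose]
  calc gᴴ * (S.sel : JointOp S.a n) * g * (gᴴ * ((S.sel : JointOp S.a n)ᴴ * g))
      = gᴴ * (S.sel : JointOp S.a n) * (g * gᴴ) * (S.sel : JointOp S.a n)ᴴ * g := by
        simp only [mul_assoc]
    _ = gᴴ * ((S.sel : JointOp S.a n) * (S.sel : JointOp S.a n)ᴴ) * g := by
        rw [h1, mul_one, mul_assoc gᴴ]
    _ = 1 := by rw [hs, mul_one, h2]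

theorem block_eq_zeroBlock (S : Segment K c τ α Hl s rounds) :
    S.block = zeroBlock (ampStep (lcuW (S.G : Op (Fin S.a)) (S.sel : JointOp S.a n)) ^ rounds *
      lcuW (S.G : Op (Fin S.a)) (S.sel : JointOp S.a n)) := by
  ext x y
  rw [block, Matrix.of_apply, S.circuit_apply, if_pos rfl]
  rfl

theorem block_one (S : Segment K c τ α Hl s 1) (hs : 0 < s)
    (hβ : ∀ j : LCUIndex L K, 0 ≤ lcuCoeff c τ α s j) :
    S.block = amp₁ s (weightedSeries (hamiltonian α Hl) τ c K) := by
  have h := S.lcuW_mul_conjTranspose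
  rw [S.block_eq_zeroBlock, pow_one, zeroBlock_ampStep_mul h (mul_eq_one_comm.1 h),
    S.zeroBlock_lcuW hs hβ, amp₁]
  simp only [Matrix.conjTranspose_smul, Complex.star_def, Complex.conj_ofReal, Matrix.smul_mul,
    Matrix.mul_smul, smul_smul]
  congr 2 <;> push_cast <;> ring

theorem block_two (S : Segment K c τ α Hl s 2) (hs : 0 < s)
    (hβ : ∀ j : LCUIndex L K, 0 ≤ lcuCoeff c τ α s j) :
    S.block = amp₂ s (weightedSeries (hamiltonian α Hl) τ c K) := by
  have h := S.lcuW_mul_conjTranspose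
  rw [S.block_eq_zeroBlock, zeroBlock_ampStep_sq_mul h (mul_eq_one_comm.1 h),
    S.zeroBlock_lcuW hs hβ, amp₂]
  simp only [Matrix.conjTranspose_smul, Complex.star_def, Complex.conj_ofReal, Matrix.smul_mul,
    Matrix.mul_smul, smul_smul]
  congr 3 <;> push_cast <;> ring

theorem successProb_eq (S : Segment K c τ α Hl s rounds) (ρ : Op (Fin n)) :
    S.successProb ρ = (S.block * ρ * S.blockᴴ).trace.re := by
  set J : Matrix (Basis (SegWires n S.a S.w)) (Basis (Fin n)) ℂ :=
    Matrix.of fun y x => if y = joinBasis x (zero _) (zero _) then 1 else 0 with hJ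
  have hinit : S.initial ρ = J * ρ * Jᴴ := by
    have key : ∀ (y : Basis (SegWires n S.a S.w)) (x : Basis (Fin n)),
        y = joinBasis x (zero _) (zero _) ↔ y ∘ Sum.inr = zero _ ∧ x = y ∘ Sum.inl := by
      intro y x
      constructor
      · rintro rfl
        refine ⟨?_, rfl⟩
        ext k
        cases k <;> rfl
      · rintro ⟨h, rfl⟩
        rw [← Sum.elim_comp_inl_inr y, h, joinBasis]
        congr 1
        ext k
        cases k <;> rfl
    ext y y'
    simp only [Matrix.mul_apply, hJ, Matrix.of_apply, Matrix.conjTranspose_apply, key,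
      initial, ite_and, apply_ite star, star_one, star_zero, mul_ite, mul_one, mul_zero, ite_mul,
      one_mul, zero_mul]
    split_ifs <;> simp
  have hrow : ∀ x z y, (S.circuit.op * J) (joinBasis x (zero _) z) y =
      if z = zero _ then S.block x y else 0 := by
    intro x z y
    rw [Matrix.mul_apply]
    simp only [hJ, Matrix.of_apply, mul_ite, mul_one, mul_zero, Finset.sum_ite_eq',
      Finset.mem_univ, if_true]
    simp only [block, Matrix.of_apply, S.circuit_apply, if_true]
  have hprod : S.circuit.op * S.initial ρ * S.circuit.opᴴ =
      (S.circuit.op * J) * ρ * (S.circuit.op * J)ᴴ := by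
    rw [hinit, Matrix.conjTranspose_mul]
    simp only [Matrix.mul_assoc]
  rw [successProb, Matrix.trace, Complex.re_sum]
  refine Finset.sum_congr rfl fun x _ => ?_
  -- The circuit returns the work qubits clean, so outcomes with z ≠ 0 carry no weight.
  rw [Finset.sum_eq_single (zero _)]
  · rw [hprod]
    simp only [Matrix.mul_apply (N := (S.circuit.op * J)ᴴ), Matrix.mul_apply (N := ρ),
      Matrix.conjTranspose_apply, hrow, if_true, Matrix.diag_apply,
      Matrix.mul_apply (N := S.blockᴴ)]
  · intro z _ hz
    rw [hprod]
    simp only [Matrix.mul_apply (N := (S.circuit.op * J)ᴴ), Matrix.mul_apply (N := ρ),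
      hrow, if_neg hz]
    simp
  · simp

end Segment

section SpectralOp

variable {m : Type} [Fintype m] [DecidableEq m]

/-! ### Operators diagonal in a fixed orthonormal basis -/

/-- The operator with eigenvalues `g` and the columns of `Q` as eigenvectors. -/
def spectralOp (Q : Matrix m m ℂ) (g : m → ℂ) : Matrix m m ℂ := Q * Matrix.diagonal g * Qᴴ

variable {Q : Matrix m m ℂ}

theorem spectralOp_add (g h : m → ℂ) :
    spectralOp Q (fun i => g i + h i) = spectralOp Q g + spectralOp Q h := by
  rw [spectralOp, spectralOp, spectralOp, ← Matrix.diagonal_add, mul_add, add_mul]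

theorem spectralOp_smul (a : ℂ) (g : m → ℂ) :
    spectralOp Q (fun i => a * g i) = a • spectralOp Q g := by
  rw [spectralOp, spectralOp, show (fun i => a * g i) = a • g from rfl, Matrix.diagonal_smul,
    Matrix.mul_smul, Matrix.smul_mul]

theorem spectralOp_sub (g h : m → ℂ) :
    spectralOp Q (fun i => g i - h i) = spectralOp Q g - spectralOp Q h := by
  rw [spectralOp, spectralOp, spectralOp, ← Matrix.diagonal_sub, mul_sub, sub_mul]

theorem spectralOp_sum {ι : Type*} (s : Finset ι) (g : ι → m → ℂ) :
    spectralOp Q (fun i => ∑ k ∈ s, g k i) = ∑ k ∈ s, spectralOp Q (g k) := by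
  classical
  induction s using Finset.induction_on with
  | empty => simp [spectralOp]
  | insert a s ha ih =>
    simp only [Finset.sum_insert ha]
    rw [spectralOp_add, ih]

theorem spectralOp_conjTranspose (g : m → ℂ) :
    spectralOp Q (fun i => star (g i)) = (spectralOp Q g)ᴴ := by
  rw [spectralOp, spectralOp, Matrix.conjTranspose_mul, Matrix.conjTranspose_mul,
    Matrix.conjTranspose_conjTranspose, Matrix.diagonal_conjTranspose, mul_assoc]
  rfl

section Unitary

variable (hQ : Qᴴ * Q = 1)
include hQ

theorem spectralOp_mul (g h : m → ℂ) :
    spectralOp Q (fun i => g i * h i) = spectralOp Q g * spectralOp Q h := by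
  rw [spectralOp, spectralOp, spectralOp, ← Matrix.diagonal_mul_diagonal]
  calc Q * (Matrix.diagonal g * Matrix.diagonal h) * Qᴴ
      = Q * Matrix.diagonal g * 1 * Matrix.diagonal h * Qᴴ := by
        simp only [mul_assoc, one_mul]
    _ = _ := by
        rw [← hQ]
        simp only [mul_assoc]

theorem spectralOp_one : spectralOp Q (fun _ => 1) = 1 := by
  rw [spectralOp, Matrix.diagonal_one, mul_one, mul_eq_one_comm.1 hQ]

theorem spectralOp_pow (g : m → ℂ) (k : ℕ) :
    spectralOp Q (fun i => g i ^ k) = spectralOp Q g ^ k := by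
  induction k with
  | zero => simpa using spectralOp_one hQ
  | succ k ih => simp only [pow_succ, spectralOp_mul hQ, ih]

theorem spectralOp_exp (g : m → ℂ) :
    spectralOp Q (fun i => Complex.exp (g i)) = NormedSpace.exp (spectralOp Q g) := by
  have hinv : Q⁻¹ = Qᴴ := Matrix.inv_eq_left_inv hQ
  have hu : IsUnit Q := ⟨⟨Q, Qᴴ, mul_eq_one_comm.1 hQ, hQ⟩, rfl⟩
  rw [spectralOp, spectralOp, ← hinv, Matrix.exp_conj _ _ hu, Matrix.exp_diagonal]
  congr 3
  ext i
  rw [Pi.coe_exp, Complex.exp_eq_exp_ℂ]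

theorem trace_spectralOp (g : m → ℂ) : (spectralOp Q g).trace = ∑ i, g i := by
  rw [spectralOp, Matrix.trace_mul_comm, ← mul_assoc, hQ, one_mul, Matrix.trace_diagonal]

end Unitary

theorem exists_spectralOp {A : Matrix m m ℂ} (hA : A.IsHermitian) :
    ∃ Q : Matrix m m ℂ, Qᴴ * Q = 1 ∧ A = spectralOp Q fun i => (hA.eigenvalues i : ℂ) :=
  ⟨hA.eigenvectorUnitary, Matrix.mem_unitaryGroup_iff'.1 hA.eigenvectorUnitary.2,
    hA.spectral_theorem⟩

/-! ### Operator norm and trace norm -/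

open scoped Matrix.Norms.L2Operator

theorem norm_le_one_of_conjTranspose_mul_self (hQ : Qᴴ * Q = 1) : ‖Q‖ ≤ 1 := by
  have h : ‖Q‖ * ‖Q‖ ≤ 1 := by
    rw [← Matrix.l2_opNorm_conjTranspose_mul_self, hQ, ← Matrix.diagonal_one,
      Matrix.l2_opNorm_diagonal]
    exact (pi_norm_le_iff_of_nonneg zero_le_one).2 fun i => by simp
  nlinarith [norm_nonneg Q]

theorem norm_conj_le (hQ : Qᴴ * Q = 1) (A : Matrix m m ℂ) : ‖Q * A * Qᴴ‖ ≤ ‖A‖ := by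
  have h1 := norm_le_one_of_conjTranspose_mul_self hQ
  calc ‖Q * A * Qᴴ‖ ≤ ‖Q‖ * ‖A‖ * ‖Qᴴ‖ :=
        (norm_mul_le _ _).trans (mul_le_mul_of_nonneg_right (norm_mul_le _ _) (norm_nonneg _))
    _ ≤ 1 * ‖A‖ * 1 := by
        rw [Matrix.l2_opNorm_conjTranspose]
        gcongr
    _ = ‖A‖ := by ring

theorem norm_spectralOp_le (hQ : Qᴴ * Q = 1) {g : m → ℂ} {r : ℝ} (hr : 0 ≤ r)
    (hg : ∀ i, ‖g i‖ ≤ r) : ‖spectralOp Q g‖ ≤ r :=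
  (norm_conj_le hQ _).trans <| by
    rw [Matrix.l2_opNorm_diagonal]
    exact (pi_norm_le_iff_of_nonneg hr).2 hg

theorem norm_eigenvalues_le {A : Matrix m m ℂ} (hA : A.IsHermitian) (i : m) :
    |hA.eigenvalues i| ≤ ‖A‖ := by
  obtain ⟨Q, hQ, h⟩ := exists_spectralOp hA
  have h2 : Matrix.diagonal (fun i => (hA.eigenvalues i : ℂ)) = Qᴴ * A * Qᴴᴴ := by
    rw [Matrix.conjTranspose_conjTranspose]
    nth_rewrite 2 [h]
    rw [spectralOp]
    calc _ = (Qᴴ * Q) * Matrix.diagonal (fun i => (hA.eigenvalues i : ℂ)) * (Qᴴ * Q) := by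
          rw [hQ, one_mul, mul_one]
      _ = _ := by simp only [mul_assoc]
  have h3 : ‖Matrix.diagonal fun i => (hA.eigenvalues i : ℂ)‖ ≤ ‖A‖ := by
    rw [h2]
    exact norm_conj_le (by rw [Matrix.conjTranspose_conjTranspose, mul_eq_one_comm.1 hQ]) _
  rw [Matrix.l2_opNorm_diagonal] at h3
  simpa using (norm_le_pi_norm (fun i => (hA.eigenvalues i : ℂ)) i).trans h3

theorem norm_apply_le (A : Matrix m m ℂ) (i j : m) : ‖A i j‖ ≤ ‖A‖ := by
  have h := Matrix.l2_opNorm_mulVec A (EuclideanSpace.single j 1)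
  rw [PiLp.norm_single, norm_one, mul_one] at h
  refine le_trans ?_ h
  refine le_trans (le_of_eq ?_) (PiLp.norm_apply_le _ i)
  simp

/-- In an eigenbasis of ρ the trace is a convex combination of diagonal entries of a unitary
conjugate of A. -/
theorem norm_trace_mul_le {ρ : Matrix m m ℂ} (hρ : ρ.PosSemidef) (hρ1 : ρ.trace = 1)
    (A : Matrix m m ℂ) : ‖(A * ρ).trace‖ ≤ ‖A‖ := by
  obtain ⟨Q, hQ, h⟩ := exists_spectralOp hρ.1
  have hsum : ∑ i, hρ.1.eigenvalues i = 1 := by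
    have h1 := trace_spectralOp hQ fun i => (hρ.1.eigenvalues i : ℂ)
    rw [← h, hρ1] at h1
    exact_mod_cast h1.symm
  have htr : (A * ρ).trace = ∑ i, (Qᴴ * A * Q) i i * (hρ.1.eigenvalues i : ℂ) := by
    refine (congrArg (fun B => (A * B).trace) h).trans ?_
    simp only [spectralOp]
    rw [← mul_assoc, Matrix.trace_mul_comm, ← mul_assoc, ← mul_assoc]
    simp only [Matrix.trace, Matrix.diag_apply, Matrix.mul_diagonal]
  have hconj : ‖Qᴴ * A * Q‖ ≤ ‖A‖ := by
    have := norm_conj_le (Q := Qᴴ)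
      (by rw [Matrix.conjTranspose_conjTranspose, mul_eq_one_comm.1 hQ]) A
    rwa [Matrix.conjTranspose_conjTranspose] at this
  rw [htr]
  calc ‖∑ i, (Qᴴ * A * Q) i i * (hρ.1.eigenvalues i : ℂ)‖
      ≤ ∑ i, ‖A‖ * hρ.1.eigenvalues i := by
        refine norm_sum_le_of_le _ fun i _ => ?_
        have h0 := hρ.eigenvalues_nonneg i
        rw [norm_mul, Complex.norm_real, Real.norm_of_nonneg h0]
        exact mul_le_mul_of_nonneg_right ((norm_apply_le _ i i).trans hconj) h0
    _ = ‖A‖ := by rw [← Finset.mul_sum, hsum, mul_one]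

theorem norm_trace_mul_mul_le {ρ : Matrix m m ℂ} (hρ : ρ.PosSemidef) (hρ1 : ρ.trace = 1)
    {W : Matrix m m ℂ} (hW : ‖W‖ ≤ 1) (A B : Matrix m m ℂ) :
    ‖(W * (A * ρ * B)).trace‖ ≤ ‖A‖ * ‖B‖ := by
  have h : (W * (A * ρ * B)).trace = (B * W * A * ρ).trace := by
    rw [← mul_assoc, Matrix.trace_mul_comm]
    simp only [mul_assoc]
  rw [h]
  calc _ ≤ ‖B * W * A‖ := norm_trace_mul_le hρ hρ1 _
    _ ≤ ‖B‖ * ‖W‖ * ‖A‖ :=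
        (norm_mul_le _ _).trans (mul_le_mul_of_nonneg_right (norm_mul_le _ _) (norm_nonneg _))
    _ ≤ ‖B‖ * 1 * ‖A‖ := by gcongr
    _ = _ := by ring

/-- The trace norm is attained on a contraction. -/
theorem exists_traceNorm_eq (X : Matrix m m ℂ) :
    ∃ W : Matrix m m ℂ, ‖W‖ ≤ 1 ∧ traceNorm X = ((W * X).trace).re := by
  set hX := Matrix.isHermitian_conjTranspose_mul_self X
  obtain ⟨Q, hQ, h⟩ := exists_spectralOp hX
  have h0 : ∀ i, 0 ≤ hX.eigenvalues i := (Matrix.posSemidef_conjTranspose_mul_self X).eigenvalues_nonneg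
  set r : m → ℝ := fun i => √(hX.eigenvalues i) with hr
  -- A pseudo-inverse of |X|: since 0⁻¹ = 0, the kernel is sent to 0. Then S X† is a partial
  -- isometry with S X† X = |X|.
  set S := spectralOp Q fun i => ((r i)⁻¹ : ℂ) with hS
  have hSh : Sᴴ = S := by
    rw [hS, ← spectralOp_conjTranspose]
    simp
  have hWX : (S * Xᴴ * X) = spectralOp Q fun i => (r i : ℂ) := by
    rw [mul_assoc, h, hS, ← spectralOp_mul hQ]
    congr 1
    ext i
    rw [← Complex.ofReal_inv, ← Complex.ofReal_mul]
    congr 1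
    rw [← Real.mul_self_sqrt (h0 i), ← mul_assoc]
    by_cases hi : r i = 0
    · simp [hr] at hi
      simp [hr, hi]
    · rw [inv_mul_cancel₀ hi, one_mul]
  refine ⟨S * Xᴴ, ?_, ?_⟩
  · have h1 : ‖(S * Xᴴ)ᴴ‖ * ‖(S * Xᴴ)ᴴ‖ ≤ 1 := by
      rw [← Matrix.l2_opNorm_conjTranspose_mul_self, Matrix.conjTranspose_conjTranspose,
        Matrix.conjTranspose_mul, Matrix.conjTranspose_conjTranspose, hSh, ← mul_assoc, hWX, hS,
        ← spectralOp_mul hQ]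
      refine norm_spectralOp_le hQ zero_le_one fun i => ?_
      by_cases hi : r i = 0
      · simp [hi]
      · rw [mul_inv_cancel₀ (by exact_mod_cast hi), norm_one]
    rw [Matrix.l2_opNorm_conjTranspose] at h1
    nlinarith [norm_nonneg (S * Xᴴ)]
  · rw [hWX, trace_spectralOp hQ, Complex.re_sum]
    rfl

/-- The error of a mixture is quadratic in the errors of its members and linear in the error of
their average. -/
theorem traceNorm_mixChannel_sub_le {p : ℝ} (hp0 : 0 ≤ p) (hp1 : p ≤ 1) {U V₁ V₂ : Matrix m m ℂ}
    (hU : ‖U‖ ≤ 1) {a₁ a₂ b : ℝ} (h₁ : ‖V₁ - U‖ ^ 2 ≤ a₁) (h₂ : ‖V₂ - U‖ ^ 2 ≤ a₂)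
    (hb : ‖(p : ℂ) • V₁ + ((1 - p : ℝ) : ℂ) • V₂ - U‖ ≤ b) {ρ : Matrix m m ℂ} (hρ : ρ.PosSemidef)
    (hρ1 : ρ.trace = 1) :
    traceNorm (mixChannel p V₁ V₂ ρ - U * ρ * Uᴴ) ≤ p * a₁ + (1 - p) * a₂ + 2 * b := by
  set D := (p : ℂ) • V₁ + ((1 - p : ℝ) : ℂ) • V₂ - U with hD
  -- Substitute V_i = U + E_i. The terms linear in E_i see only the averaged deviation D; the rest
  -- is quadratic.
  have key : mixChannel p V₁ V₂ ρ - U * ρ * Uᴴ =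
      (p : ℂ) • ((V₁ - U) * ρ * (V₁ - U)ᴴ) +
        ((1 - p : ℝ) : ℂ) • ((V₂ - U) * ρ * (V₂ - U)ᴴ) + D * ρ * Uᴴ + U * ρ * Dᴴ := by
    simp only [mixChannel, hD, Matrix.conjTranspose_sub, Matrix.conjTranspose_add,
      Matrix.conjTranspose_smul, Complex.star_def, Complex.conj_ofReal, sub_mul, mul_sub, add_mul,
      mul_add, Matrix.smul_mul, Matrix.mul_smul]
    push_cast
    module
  obtain ⟨W, hW, hWX⟩ := exists_traceNorm_eq (mixChannel p V₁ V₂ ρ - U * ρ * Uᴴ)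
  rw [hWX, key]
  refine (Complex.re_le_norm _).trans ?_
  simp only [mul_add, Matrix.mul_smul, Matrix.trace_add, Matrix.trace_smul]
  have n1 := norm_trace_mul_mul_le hρ hρ1 hW (V₁ - U) (V₁ - U)ᴴ
  have n2 := norm_trace_mul_mul_le hρ hρ1 hW (V₂ - U) (V₂ - U)ᴴ
  have n3 := norm_trace_mul_mul_le hρ hρ1 hW D Uᴴ
  have n4 := norm_trace_mul_mul_le hρ hρ1 hW U Dᴴ
  rw [Matrix.l2_opNorm_conjTranspose] at n1 n2 n3 n4
  rw [← pow_two] at n1 n2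
  have hD0 := norm_nonneg D
  refine (norm_add_le _ _).trans ?_
  refine (add_le_add_left (norm_add_le _ _) _).trans ?_
  refine (add_le_add_left (add_le_add_left (norm_add_le _ _) _) _).trans ?_
  rw [norm_smul, norm_smul, Complex.norm_real, Complex.norm_real, Real.norm_of_nonneg hp0,
    Real.norm_of_nonneg (sub_nonneg.2 hp1)]
  have m1 := mul_le_mul_of_nonneg_left (n1.trans h₁) hp0
  have m2 := mul_le_mul_of_nonneg_left (n2.trans h₂) (sub_nonneg.2 hp1)
  have m3 : ‖D‖ * ‖U‖ ≤ b := by nlinarith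
  have m4 : ‖U‖ * ‖D‖ ≤ b := by nlinarith
  linarith

theorem one_sub_trace_re_le {V : Matrix m m ℂ} {a : ℝ} (hV : ‖1 - Vᴴ * V‖ ≤ a) {ρ : Matrix m m ℂ}
    (hρ : ρ.PosSemidef) (hρ1 : ρ.trace = 1) : 1 - (V * ρ * Vᴴ).trace.re ≤ a := by
  have h : ((1 - Vᴴ * V) * ρ).trace = 1 - (V * ρ * Vᴴ).trace := by
    rw [sub_mul, one_mul, Matrix.trace_sub, hρ1, Matrix.trace_mul_comm (V * ρ), mul_assoc]
  calc 1 - (V * ρ * Vᴴ).trace.re = ((1 - Vᴴ * V) * ρ).trace.re := by simp [h]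
    _ ≤ ‖((1 - Vᴴ * V) * ρ).trace‖ := Complex.re_le_norm _
    _ ≤ a := (norm_trace_mul_le hρ hρ1 _).trans hV

end SpectralOp

/-! ### Amplification of scalars close to a phase -/

/-- The case of target phase 1, with φ = a + ib the phase of f and t its modulus. The real part of
Pφ - 1 is second order, since both 1 - P and 1 - a are. Its imaginary part Pb differs from tb by (1
- P)b + (t - 1)b up to sign, which is second order too. -/
theorem norm_sq_le_of_phase {t P m A : ℝ} {φ : ℂ} (hφ : ‖φ‖ = 1) (ht : 0 ≤ t) (hP : |P| ≤ 1)
    (hm : ‖t * φ - 1‖ ≤ m) (_hA : 0 ≤ A) (hPA : 1 - P ≤ A * m ^ 2) :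
    ‖P * φ - 1‖ ^ 2 ≤ 2 * (A + 2) * m ^ 2 ∧
      ‖P * φ - 1 - ((t * φ).im : ℂ) * Complex.I‖ ^ 2 ≤
        ((A + 2) ^ 2 + (A + 1) ^ 2) * (m ^ 2) ^ 2 := by
  obtain ⟨a, b⟩ := φ
  obtain ⟨hP1, hP2⟩ := abs_le.1 hP
  have hm0 : 0 ≤ m := (norm_nonneg _).trans hm
  have hab : a ^ 2 + b ^ 2 = 1 := by
    have : ‖(⟨a, b⟩ : ℂ)‖ ^ 2 = 1 := by rw [hφ]; norm_num
    rw [Complex.sq_norm, Complex.normSq_mk] at this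
    linarith
  have hm2 : (t * a - 1) ^ 2 + (t * b) ^ 2 ≤ m ^ 2 := by
    have := pow_le_pow_left₀ (norm_nonneg _) hm 2
    rw [Complex.sq_norm, Complex.normSq_apply] at this
    simp at this
    nlinarith
  have hexp : (t - 1) ^ 2 + 2 * t * (1 - a) ≤ m ^ 2 := by nlinarith
  have ha1 : a ≤ 1 := by nlinarith
  have ha2 : -1 ≤ a := by nlinarith
  have ht1 : (t - 1) ^ 2 ≤ m ^ 2 := by nlinarith [mul_nonneg ht (sub_nonneg.2 ha1)]
  have hb : b ^ 2 ≤ m ^ 2 := by nlinarith [sq_nonneg (t - a)]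
  -- For a ≥ 0 use 1 - a ≤ 1 - a² = b². For a ≤ 0 the point tφ is at distance at least 1 from 1, and
  -- 1 - a ≤ 2.
  have hcos : 1 - a ≤ 2 * m ^ 2 := by
    rcases le_total 0 a with h | h
    · nlinarith
    · have : 1 ≤ m ^ 2 := by nlinarith [mul_nonneg ht (neg_nonneg.2 h)]
      linarith
  have hre : 1 - P * a ≤ (A + 2) * m ^ 2 := by
    rcases le_total 0 P with h | h
    · nlinarith [mul_nonneg h (sub_nonneg.2 ha1)]
    · nlinarith [mul_nonneg (neg_nonneg.2 h) (sub_nonneg.2 ha1), sq_nonneg m]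
  have hre0 : 0 ≤ 1 - P * a := by nlinarith
  have hb1 : |b| ≤ 1 := (sq_le_one_iff_abs_le_one b).1 (by nlinarith [sq_nonneg a])
  have hbm : |b| ≤ m := abs_le_of_sq_le_sq hb hm0
  have htm : |t - 1| ≤ m := abs_le_of_sq_le_sq ht1 hm0
  have him : |P * b - t * b| ≤ (A + 1) * m ^ 2 := by
    have e : P * b - t * b = -((1 - P) * b) - (t - 1) * b := by ring
    rw [e]
    refine (abs_sub _ _).trans ?_
    rw [abs_neg, abs_mul, abs_mul, abs_of_nonneg (sub_nonneg.2 hP2)]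
    have h1 : (1 - P) * |b| ≤ A * m ^ 2 := by
      nlinarith [mul_nonneg (sub_nonneg.2 hP2) (sub_nonneg.2 hb1)]
    have h2 : |t - 1| * |b| ≤ m * m := mul_le_mul htm hbm (abs_nonneg _) hm0
    nlinarith
  constructor
  · rw [Complex.sq_norm, Complex.normSq_apply]
    simp
    have e : (P * a - 1) * (P * a - 1) + P * b * (P * b) = 2 * (1 - P * a) - (1 - P ^ 2) := by
      linear_combination P ^ 2 * hab
    have hPsq : P ^ 2 ≤ 1 := (sq_le_one_iff_abs_le_one P).2 hP
    rw [e]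
    linarith
  · have h1 : (1 - P * a) ^ 2 ≤ ((A + 2) * m ^ 2) ^ 2 := pow_le_pow_left₀ hre0 hre 2
    have h2 : (P * b - t * b) ^ 2 ≤ ((A + 1) * m ^ 2) ^ 2 := by
      rw [← sq_abs]
      exact pow_le_pow_left₀ (abs_nonneg _) him 2
    rw [Complex.sq_norm, Complex.normSq_apply]
    simp
    nlinarith

/-- A scalar `f` close to the phase `u` whose modulus is amplified from `‖f‖` to `P` is moved
towards `u`, up to the first-order error in the direction `i u`. -/
theorem amplified_scalar {f u : ℂ} (hu : ‖u‖ = 1) {P m A : ℝ} {v : ℂ}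
    (hv : v * ‖f‖ = P * f) (hf0 : f = 0 → v = 0 ∧ P = 0)
    (hP : |P| ≤ 1) (hm : ‖f - u‖ ≤ m) (hA : 0 ≤ A) (hPA : 1 - P ≤ A * m ^ 2) :
    ‖v - u‖ ^ 2 ≤ 2 * (A + 2) * m ^ 2 ∧
      ‖v - u - ((f * star u).im : ℂ) * Complex.I * u‖ ^ 2 ≤
        ((A + 2) ^ 2 + (A + 1) ^ 2) * (m ^ 2) ^ 2 ∧ ‖v‖ = |P| := by
  have hu0 : u ≠ 0 := by
    rintro rfl
    simp at hu
  have hus : star u * u = 1 := by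
    rw [Complex.star_def, ← Complex.normSq_eq_conj_mul_self, Complex.normSq_eq_norm_sq, hu]
    norm_num
  obtain ⟨φ, hφ, hfφ⟩ : ∃ φ : ℂ, ‖φ‖ = 1 ∧ f = ‖f‖ * φ :=
    ⟨Complex.exp (f.arg * Complex.I), Complex.norm_exp_ofReal_mul_I _,
      (Complex.norm_mul_exp_arg_mul_I f).symm⟩
  have hvφ : v = P * φ := by
    by_cases h : f = 0
    · obtain ⟨h1, h2⟩ := hf0 h
      simp [h1, h2]
    · have hn : (‖f‖ : ℂ) ≠ 0 := by exact_mod_cast norm_ne_zero_iff.2 h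
      refine mul_right_cancel₀ hn ?_
      rw [hv]
      nth_rewrite 1 [hfφ]
      ring
  have hnorm : ∀ z : ℂ, ‖z * star u‖ = ‖z‖ := fun z => by rw [norm_mul, norm_star, hu, mul_one]
  have hφu : ‖φ * star u‖ = 1 := by rw [hnorm, hφ]
  have e1 : (‖f‖ : ℂ) * (φ * star u) = f * star u := by rw [← mul_assoc, ← hfφ]
  have hfu : ‖(‖f‖ : ℂ) * (φ * star u) - 1‖ ≤ m := by
    rw [e1, ← hus, mul_comm (star u), ← sub_mul, hnorm]
    exact hm
  obtain ⟨h1, h2⟩ := norm_sq_le_of_phase hφu (norm_nonneg f) hP hfu hA hPA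
  have e2 : (P : ℂ) * (φ * star u) - 1 = (v - u) * star u := by
    rw [hvφ]
    linear_combination hus
  refine ⟨?_, ?_, ?_⟩
  · rw [e2, hnorm] at h1
    exact h1
  · have e3 : (v - u) * star u - ((f * star u).im : ℂ) * Complex.I =
        (v - u - ((f * star u).im : ℂ) * Complex.I * u) * star u := by
      linear_combination ((f * star u).im : ℂ) * Complex.I * hus
    rw [e1, e2, e3, hnorm] at h2
    exact h2
  · rw [hvφ, norm_mul, hφ, mul_one, Complex.norm_real, Real.norm_eq_abs]

/-- The scalar amplification with one round. -/
def scalarAmp₁ (s : ℝ) (f : ℂ) : ℂ := (3 / s : ℝ) * f - (4 / s ^ 3 : ℝ) * (f * star f * f)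

/-- The scalar amplification with two rounds. -/
def scalarAmp₂ (s : ℝ) (f : ℂ) : ℂ :=
  (5 / s : ℝ) * f - (20 / s ^ 3 : ℝ) * (f * star f * f) +
    (16 / s ^ 5 : ℝ) * (f * star f * f * star f * f)

theorem mul_star_eq (f : ℂ) : f * star f = (‖f‖ : ℂ) ^ 2 := Complex.mul_conj' f

/-- The double root of 1 - P = (2y - 1)²(1 + y) makes the modulus error quadratic. Because (2y - 1)s
= 2(‖f‖ - 1) + (2 - s), the choice of s below 2 costs only another r. -/
theorem scalarAmp₁_bounds {f u : ℂ} (hu : ‖u‖ = 1) {s r : ℝ} (hs1 : 1 ≤ s) (hs : 2 - r ≤ s)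
    (hs2 : s ≤ 2) (hf : ‖f‖ ≤ s) (hr : ‖f - u‖ ≤ r) (hr' : 1 ≤ r ∨ r ≤ 0.307) :
    ‖scalarAmp₁ s f - u‖ ^ 2 ≤ 16.6 * r ^ 2 ∧
      ‖scalarAmp₁ s f - u - ((f * star u).im : ℂ) * Complex.I * u‖ ≤ 11.1 * r ^ 2 ∧
      ‖scalarAmp₁ s f‖ ≤ 1 ∧ 1 - ‖scalarAmp₁ s f‖ ^ 2 ≤ 12.6 * r ^ 2 := by
  have hs0 : 0 < s := by linarith
  set y := ‖f‖ / s with hy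
  have hy0 : 0 ≤ y := div_nonneg (norm_nonneg _) hs0.le
  have hy1 : y ≤ 1 := (div_le_one hs0).2 hf
  have hfy : ‖f‖ = y * s := by rw [hy, div_mul_cancel₀ _ hs0.ne']
  set P := 3 * y - 4 * y ^ 3 with hP
  have hPid : 1 - P = (2 * y - 1) ^ 2 * (1 + y) := by rw [hP]; ring
  have hPid' : 1 + P = (2 * y + 1) ^ 2 * (1 - y) := by rw [hP]; ring
  have hP1 : P ≤ 1 := by nlinarith [mul_nonneg (sq_nonneg (2 * y - 1)) (by linarith : 0 ≤ 1 + y)]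
  have hP2 : -1 ≤ P := by
    nlinarith [mul_nonneg (sq_nonneg (2 * y + 1)) (by linarith : 0 ≤ 1 - y)]
  have hr0 : 0 ≤ r := (norm_nonneg _).trans hr
  have hnf : |‖f‖ - 1| ≤ r := by
    rw [← hu]
    exact (abs_norm_sub_norm_le f u).trans hr
  have hPA : 1 - P ≤ 6.3 * r ^ 2 := by
    -- For r ≥ 1 the trivial bound 1 - P ≤ 2 is enough. Otherwise s ≥ 1.693, and 2·9/2.866 < 6.3.
    rcases hr' with h | h
    · nlinarith
    · have hs' : 1.693 ≤ s := by linarith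
      have h1 : |(2 * y - 1) * s| ≤ 3 * r := by
        have : (2 * y - 1) * s = 2 * (‖f‖ - 1) + (2 - s) := by rw [hfy]; ring
        rw [this]
        refine (abs_add_le _ _).trans ?_
        rw [abs_mul, abs_two, abs_of_nonneg (by linarith : 0 ≤ 2 - s)]
        linarith
      have h2 : (2 * y - 1) ^ 2 * s ^ 2 ≤ 9 * r ^ 2 := by
        have := pow_le_pow_left₀ (abs_nonneg _) h1 2
        rw [sq_abs] at this
        nlinarith
      have h3 : (2.866 : ℝ) ≤ s ^ 2 := by nlinarith
      have h4 : (2 * y - 1) ^ 2 * 2.866 ≤ 9 * r ^ 2 :=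
        (mul_le_mul_of_nonneg_left h3 (sq_nonneg _)).trans h2
      rw [hPid]
      nlinarith [sq_nonneg (2 * y - 1)]
  have hv : scalarAmp₁ s f * ‖f‖ = P * f := by
    have e : f * star f * f = (‖f‖ : ℂ) ^ 2 * f := by rw [mul_star_eq]
    have hsc : (s : ℂ) ≠ 0 := by exact_mod_cast hs0.ne'
    rw [scalarAmp₁, e, hP, hfy]
    push_cast
    field_simp
  obtain ⟨h1, h2, h3⟩ := amplified_scalar hu hv
    (fun h => ⟨by simp [scalarAmp₁, h], by simp [hP, hy, h]⟩) (abs_le.2 ⟨hP2, hP1⟩) hr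
    (by norm_num : (0 : ℝ) ≤ 6.3) hPA
  refine ⟨h1.trans (le_of_eq (by ring)), ?_, ?_, ?_⟩
  · refine abs_le_of_sq_le_sq' (h2.trans ?_) (by positivity) |>.2
    nlinarith [sq_nonneg (r ^ 2)]
  · rw [h3]
    exact abs_le.2 ⟨hP2, hP1⟩
  · rw [h3, sq_abs]
    nlinarith

/-- Here 1 - P = (4y² + 2y - 1)²(1 - y), and 1/`sTwo` is a root of the quadratic. Dividing out that
root exposes the factor (‖f‖ - 1)². -/
theorem scalarAmp₂_bounds {f u : ℂ} (hu : ‖u‖ = 1) {m : ℝ} (hf : ‖f‖ ≤ sTwo)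
    (hm : ‖f - u‖ ≤ m) :
    ‖scalarAmp₂ sTwo f - u‖ ^ 2 ≤ 6.8 * m ^ 2 ∧
      ‖scalarAmp₂ sTwo f - u - ((f * star u).im : ℂ) * Complex.I * u‖ ≤ 4.2 * m ^ 2 ∧
      ‖scalarAmp₂ sTwo f‖ ≤ 1 ∧ 1 - ‖scalarAmp₂ sTwo f‖ ^ 2 ≤ 2.8 * m ^ 2 := by
  have hs1 := sTwo_gt
  have hs2 := sTwo_lt
  have hs5 : sTwo ^ 2 = 2 * sTwo + 4 := by
    rw [sTwo_eq]
    nlinarith [Real.sq_sqrt (show (0 : ℝ) ≤ 5 by norm_num)]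
  set s := sTwo with hsdef
  have hs0 : 0 < s := by linarith
  set y := ‖f‖ / s with hy
  have hy0 : 0 ≤ y := div_nonneg (norm_nonneg _) hs0.le
  have hy1 : y ≤ 1 := (div_le_one hs0).2 hf
  have hfy : ‖f‖ = y * s := by rw [hy, div_mul_cancel₀ _ hs0.ne']
  set P := 5 * y - 20 * y ^ 3 + 16 * y ^ 5 with hP
  have hPid : 1 - P = (4 * y ^ 2 + 2 * y - 1) ^ 2 * (1 - y) := by rw [hP]; ring
  have hPid' : 1 + P = (4 * y ^ 2 - 2 * y - 1) ^ 2 * (1 + y) := by rw [hP]; ring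
  have hP1 : P ≤ 1 := by
    nlinarith [mul_nonneg (sq_nonneg (4 * y ^ 2 + 2 * y - 1)) (by linarith : 0 ≤ 1 - y)]
  have hP2 : -1 ≤ P := by
    nlinarith [mul_nonneg (sq_nonneg (4 * y ^ 2 - 2 * y - 1)) (by linarith : 0 ≤ 1 + y)]
  have hm0 : 0 ≤ m := (norm_nonneg _).trans hm
  have hnf : |‖f‖ - 1| ≤ m := by
    rw [← hu]
    exact (abs_norm_sub_norm_le f u).trans hm
  have hnf2 : (‖f‖ - 1) ^ 2 ≤ m ^ 2 := by
    rw [← sq_abs]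
    exact pow_le_pow_left₀ (abs_nonneg _) hnf 2
  have hfac : 4 * y ^ 2 + 2 * y - 1 = (‖f‖ - 1) * (1 + 4 / s * y) := by
    rw [hfy]
    field_simp
    linear_combination (-y) * hs5
  have hc : 4 / s ≤ 1.2364 := by
    rw [div_le_iff₀ hs0]
    linarith
  have hc0 : 0 ≤ 4 / s := by positivity
  have hPA : 1 - P ≤ 1.4 * m ^ 2 := by
    have h1 : (1 + 4 / s * y) ^ 2 * (1 - y) ≤ 1.4 := by
      have h2 : (1 + 4 / s * y) ^ 2 ≤ (1 + 1.2364 * y) ^ 2 :=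
        pow_le_pow_left₀ (by positivity) (by nlinarith) 2
      -- The cubic has its maximum, about 1.34, near y = 0.4, which explains the square supplied as
      -- a hint.
      have h3 : (1 + 1.2364 * y) ^ 2 * (1 - y) ≤ 1.4 := by
        nlinarith [mul_nonneg hy0 (sq_nonneg (y - 0.4)), sq_nonneg (y - 0.4)]
      exact (mul_le_mul_of_nonneg_right h2 (sub_nonneg.2 hy1)).trans h3
    rw [hPid, hfac]
    calc ((‖f‖ - 1) * (1 + 4 / s * y)) ^ 2 * (1 - y)
        = (‖f‖ - 1) ^ 2 * ((1 + 4 / s * y) ^ 2 * (1 - y)) := by ring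
      _ ≤ m ^ 2 * 1.4 := mul_le_mul hnf2 h1
          (mul_nonneg (sq_nonneg _) (sub_nonneg.2 hy1)) (sq_nonneg _)
      _ = 1.4 * m ^ 2 := mul_comm _ _
  have hv : scalarAmp₂ s f * ‖f‖ = P * f := by
    have e : f * star f * f = (‖f‖ : ℂ) ^ 2 * f := by rw [mul_star_eq]
    have e' : f * star f * f * star f * f = (‖f‖ : ℂ) ^ 4 * f := by
      rw [mul_assoc (f * star f), mul_star_eq]
      ring
    have hsc : (s : ℂ) ≠ 0 := by exact_mod_cast hs0.ne'
    rw [scalarAmp₂, e', e, hP, hfy]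
    push_cast
    field_simp
  obtain ⟨h1, h2, h3⟩ := amplified_scalar hu hv
    (fun h => ⟨by simp [scalarAmp₂, h], by simp [hP, hy, h]⟩) (abs_le.2 ⟨hP2, hP1⟩) hm
    (by norm_num : (0 : ℝ) ≤ 1.4) hPA
  refine ⟨h1.trans (le_of_eq (by ring)), ?_, ?_, ?_⟩
  · refine abs_le_of_sq_le_sq' (h2.trans ?_) (by positivity) |>.2
    nlinarith [sq_nonneg (m ^ 2)]
  · rw [h3]
    exact abs_le.2 ⟨hP2, hP1⟩
  · rw [h3, sq_abs]
    nlinarith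

/-! ### Truncated exponential series -/

/-- The partial sum of order `K` of the exponential series. -/
def expPartial (K : ℕ) (z : ℂ) : ℂ := ∑ k ∈ Finset.range (K + 1), z ^ k / k.factorial

/-- The remainder of the exponential series at `ln 2`. -/
def expTail (K : ℕ) : ℝ := 2 - ∑ k ∈ Finset.range (K + 1), Real.log 2 ^ k / k.factorial

theorem hasSum_exp_tail (x : ℝ) (n : ℕ) :
    HasSum (fun k => x ^ (k + n) / (k + n).factorial)
      (Real.exp x - ∑ k ∈ Finset.range n, x ^ k / k.factorial) := by
  have h : HasSum (fun k : ℕ => x ^ k / k.factorial) (Real.exp x) := by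
    rw [Real.exp_eq_exp_ℝ]
    exact NormedSpace.expSeries_div_hasSum_exp x
  exact (hasSum_nat_add_iff' n).2 h

theorem norm_exp_sub_expPartial_le {z : ℂ} (hz : ‖z‖ ≤ Real.log 2) (K : ℕ) :
    ‖expPartial K z - Complex.exp z‖ ≤ expTail K := by
  rw [norm_sub_rev]
  refine (Complex.norm_exp_sub_sum_le_exp_norm_sub_sum z (K + 1)).trans ?_
  have h := hasSum_le (fun k => ?_) (hasSum_exp_tail ‖z‖ (K + 1))
    (hasSum_exp_tail (Real.log 2) (K + 1))
  · rwa [Real.exp_log two_pos] at h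
  · gcongr

theorem expTail_nonneg (K : ℕ) : 0 ≤ expTail K :=
  (norm_nonneg _).trans
    (norm_exp_sub_expPartial_le (z := 0) (by simpa using Real.log_nonneg one_le_two) K)

/-- As (K+1)!·k! ≤ (K+1+k)!, the tail is at most its first term times the whole series, whose sum is
exp(ln 2) = 2. -/
theorem expTail_le_delta (K : ℕ) : expTail K ≤ delta K := by
  have h1 := hasSum_exp_tail (Real.log 2) (K + 1)
  have h2 : HasSum (fun k : ℕ => Real.log 2 ^ (K + 1) / (K + 1).factorial *
      (Real.log 2 ^ k / k.factorial)) (Real.log 2 ^ (K + 1) / (K + 1).factorial * 2) := by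
    refine HasSum.mul_left _ ?_
    have := hasSum_exp_tail (Real.log 2) 0
    simpa [Real.exp_log two_pos] using this
  have h := hasSum_le (fun k => ?_) h1 h2
  · rw [Real.exp_log two_pos] at h
    refine h.trans (le_of_eq ?_)
    rw [delta]
    ring
  · have hf : ((K + 1).factorial : ℝ) * k.factorial ≤ (k + (K + 1)).factorial := by
      rw [mul_comm]
      exact_mod_cast Nat.le_of_dvd (Nat.factorial_pos _) (Nat.factorial_mul_factorial_dvd_factorial_add k (K + 1))
    have hl := Real.log_nonneg one_le_two
    rw [div_mul_div_comm, ← pow_add, add_comm (K + 1) k]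
    exact div_le_div_of_nonneg_left (by positivity) (by positivity) hf

theorem expTail_sub {K₁ K₂ : ℕ} (h : K₁ ≤ K₂) :
    expTail K₁ - expTail K₂ = ∑ k ∈ Finset.Ioc K₁ K₂, Real.log 2 ^ k / k.factorial := by
  have hu : Finset.Ioc K₁ K₂ = Finset.Ico (K₁ + 1) (K₂ + 1) := by
    ext k
    simp only [Finset.mem_Ioc, Finset.mem_Ico]
    omega
  rw [hu, Finset.sum_Ico_eq_sub _ (Nat.succ_le_succ h), expTail, expTail]
  ring

/-- The tail is 1 at order 0 and at most 1 - ln 2 from order 1 on. This gap is the case split used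
in `scalarAmp₁_bounds`. -/
theorem one_le_or_expTail_le (K : ℕ) : 1 ≤ expTail K ∨ expTail K ≤ 0.307 := by
  rcases Nat.eq_zero_or_pos K with rfl | hK
  · left
    simp [expTail]
    norm_num
  · right
    have h := expTail_sub hK
    have h0 : 0 ≤ ∑ k ∈ Finset.Ioc 1 K, Real.log 2 ^ k / k.factorial :=
      Finset.sum_nonneg fun k _ => div_nonneg (pow_nonneg (Real.log_nonneg one_le_two) _)
        (Nat.cast_nonneg _)
    have h1 : expTail 1 = 1 - Real.log 2 := by
      simp [expTail, Finset.sum_range_succ]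
      ring
    linarith [log_two_gt]

/-! ### The segment operators in the eigenbasis of the Hamiltonian -/

section

variable {m : Type} [Fintype m] [DecidableEq m] {Q : Matrix m m ℂ} (hQ : Qᴴ * Q = 1)
include hQ

theorem amp₁_spectralOp (s : ℝ) (f : m → ℂ) :
    amp₁ s (spectralOp Q f) = spectralOp Q fun i => scalarAmp₁ s (f i) := by
  simp only [scalarAmp₁]
  rw [spectralOp_sub, spectralOp_smul, spectralOp_smul, spectralOp_mul hQ, spectralOp_mul hQ,
    spectralOp_conjTranspose, amp₁]

theorem amp₂_spectralOp (s : ℝ) (f : m → ℂ) :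
    amp₂ s (spectralOp Q f) = spectralOp Q fun i => scalarAmp₂ s (f i) := by
  simp only [scalarAmp₂]
  rw [spectralOp_add, spectralOp_sub, spectralOp_smul, spectralOp_smul, spectralOp_smul,
    spectralOp_mul hQ (fun i => f i * star (f i) * f i * star (f i)),
    spectralOp_mul hQ (fun i => f i * star (f i) * f i), spectralOp_mul hQ, spectralOp_mul hQ,
    spectralOp_conjTranspose, amp₂]

end

theorem weightedSeries_spectralOp {n : ℕ} {Q : Op (Fin n)} (hQ : Qᴴ * Q = 1)
    (d : Basis (Fin n) → ℂ) (τ : ℝ) (c : ℕ → ℝ) (K : ℕ) :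
    weightedSeries (spectralOp Q d) τ c K = spectralOp Q fun i =>
      ∑ k ∈ Finset.range (K + 1), (c k : ℂ) • ((-(Complex.I * τ) * d i) ^ k / k.factorial) := by
  rw [spectralOp_sum, weightedSeries]
  refine Finset.sum_congr rfl fun k _ => ?_
  simp only [smul_eq_mul, div_eq_inv_mul]
  rw [spectralOp_smul, spectralOp_smul, spectralOp_pow hQ, spectralOp_smul, taylorTerm]

theorem norm_weighted_sum_le {c : ℕ → ℝ} (hc : ∀ k, 0 ≤ c k) {z : ℂ} {t : ℝ} (hz : ‖z‖ ≤ t)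
    (S : Finset ℕ) :
    ‖∑ k ∈ S, (c k : ℂ) • (z ^ k / k.factorial)‖ ≤ ∑ k ∈ S, c k * (t ^ k / k.factorial) := by
  refine norm_sum_le_of_le _ fun k _ => ?_
  rw [norm_smul, Complex.norm_real, Real.norm_of_nonneg (hc k), norm_div, norm_pow,
    Complex.norm_natCast]
  have := hc k
  gcongr

/-- The deviations of the mixed circuits on one eigenvector. -/
theorem mixed_scalar_bounds {p s₁ : ℝ} (hp0 : 0 ≤ p) (hp : p < 1) {K₁ K₂ : ℕ} (h12 : K₁ ≤ K₂)
    {z : ℂ} (hz : ‖z‖ ≤ Real.log 2) (hzu : ‖Complex.exp z‖ = 1) (hs₁2 : s₁ ≤ 2)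
    (hs₁ : ∑ k ∈ Finset.range (K₁ + 1), weight₁ k * (Real.log 2 ^ k / k.factorial) ≤ s₁)
    (hs₂ : ∑ k ∈ Finset.range (K₂ + 1), weight₂ p K₁ k * (Real.log 2 ^ k / k.factorial) ≤ sTwo)
    {v₁ v₂ : ℂ}
    (hv₁ : v₁ = scalarAmp₁ s₁
      (∑ k ∈ Finset.range (K₁ + 1), (weight₁ k : ℂ) • (z ^ k / k.factorial)))
    (hv₂ : v₂ = scalarAmp₂ sTwo
      (∑ k ∈ Finset.range (K₂ + 1), (weight₂ p K₁ k : ℂ) • (z ^ k / k.factorial))) :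
    (‖v₁ - Complex.exp z‖ ^ 2 ≤ 16.6 * expTail K₁ ^ 2 ∧
      ‖v₂ - Complex.exp z‖ ^ 2 ≤ 6.8 * (expTail K₁ / (1 - p)) ^ 2 ∧
      ‖p * v₁ + ((1 - p : ℝ) : ℂ) * v₂ - Complex.exp z‖ ≤ p * (11.1 * expTail K₁ ^ 2) +
        (1 - p) * (4.2 * (expTail K₁ / (1 - p)) ^ 2) + expTail K₂) ∧
    (‖1 - star v₁ * v₁‖ ≤ 12.6 * expTail K₁ ^ 2 ∧
      ‖1 - star v₂ * v₂‖ ≤ 2.8 * (expTail K₁ / (1 - p)) ^ 2) := by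
  have hq : 0 < 1 - p := sub_pos.2 hp
  set u := Complex.exp z with hu
  set f₁ := ∑ k ∈ Finset.range (K₁ + 1), (weight₁ k : ℂ) • (z ^ k / k.factorial) with hf₁
  set f₂ := ∑ k ∈ Finset.range (K₂ + 1), (weight₂ p K₁ k : ℂ) • (z ^ k / k.factorial) with hf₂
  have hl := Real.log_nonneg one_le_two
  have hf₁' : f₁ = expPartial K₁ z := by simp [hf₁, expPartial, weight₁]
  set D := ∑ k ∈ Finset.Ioc K₁ K₂, z ^ k / (k.factorial : ℂ) with hD
  have hf₂' : f₂ = expPartial K₁ z + ((1 / (1 - p) : ℝ) : ℂ) * D := sum_weight₂ _ p h12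
  have hfm : expPartial K₂ z = expPartial K₁ z + D := by
    have hsum := sum_weight₂ (fun k => z ^ k / (k.factorial : ℂ)) 0 h12
    simpa [weight₂, expPartial] using hsum
  have hDn : ‖D‖ ≤ expTail K₁ - expTail K₂ := by
    have := norm_weighted_sum_le (c := fun _ => 1) (fun _ => zero_le_one) hz (Finset.Ioc K₁ K₂)
    rw [expTail_sub h12]
    simpa using this
  have h1 : ‖f₁ - u‖ ≤ expTail K₁ := by
    rw [hf₁']
    exact norm_exp_sub_expPartial_le hz K₁
  have hm : ‖expPartial K₂ z - u‖ ≤ expTail K₂ := norm_exp_sub_expPartial_le hz K₂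
  have hK0 := expTail_nonneg K₂
  -- The boosted series exceeds the one truncated at `K₂` by p/(1-p) times the middle terms D.
  have h2 : ‖f₂ - u‖ ≤ expTail K₁ / (1 - p) := by
    have e : f₂ - u = ((p / (1 - p) : ℝ) : ℂ) * D + (expPartial K₂ z - u) := by
      have hqc : (1 - p : ℂ) ≠ 0 := by exact_mod_cast hq.ne'
      rw [hf₂', hfm]
      push_cast
      field_simp
      ring
    rw [e]
    refine (norm_add_le _ _).trans ?_
    rw [norm_mul, Complex.norm_real, Real.norm_of_nonneg (div_nonneg hp0 hq.le)]
    have h3 := mul_le_mul_of_nonneg_left hDn (div_nonneg hp0 hq.le)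
    have h4 : p / (1 - p) * (expTail K₁ - expTail K₂) + expTail K₂ ≤ expTail K₁ / (1 - p) := by
      have hd : 0 ≤ expTail K₁ - expTail K₂ := (norm_nonneg _).trans hDn
      rw [le_div_iff₀ hq, add_mul, mul_right_comm, div_mul_cancel₀ _ hq.ne']
      nlinarith [mul_nonneg hp0 hK0, mul_nonneg hq.le hd]
    linarith
  have hn₁ : ‖f₁‖ ≤ s₁ := (norm_weighted_sum_le weight₁_nonneg hz _).trans hs₁
  have hn₂ : ‖f₂‖ ≤ sTwo := (norm_weighted_sum_le (weight₂_nonneg hp K₁) hz _).trans hs₂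
  have hs₁t : 2 - expTail K₁ ≤ s₁ := by
    refine le_trans (le_of_eq ?_) hs₁
    simp [expTail, weight₁]
  have hs₁1 : 1 ≤ s₁ := by
    refine le_trans ?_ hs₁
    rw [Finset.sum_range_succ']
    simp only [weight₁, one_mul, pow_zero, Nat.factorial_zero, Nat.cast_one, div_one]
    exact le_add_of_nonneg_left (Finset.sum_nonneg fun k _ => div_nonneg (pow_nonneg hl _)
      (Nat.cast_nonneg _))
  obtain ⟨a1, b1, c1, d1⟩ := scalarAmp₁_bounds hzu hs₁1 hs₁t hs₁2 hn₁ h1 (one_le_or_expTail_le K₁)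
  obtain ⟨a2, b2, c2, d2⟩ := scalarAmp₂_bounds hzu hn₂ h2
  rw [← hv₁] at a1 b1 c1 d1
  rw [← hv₂] at a2 b2 c2 d2
  have hfail : ∀ {v : ℂ} {B : ℝ}, ‖v‖ ≤ 1 → 1 - ‖v‖ ^ 2 ≤ B → ‖1 - star v * v‖ ≤ B := by
    intro v B hv hB
    have e : 1 - star v * v = ((1 - ‖v‖ ^ 2 : ℝ) : ℂ) := by
      rw [mul_comm, mul_star_eq]
      push_cast
      rfl
    rw [e, Complex.norm_real, Real.norm_of_nonneg]
    · exact hB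
    · nlinarith [norm_nonneg v]
  refine ⟨⟨a1, a2, ?_⟩, hfail c1 d1, hfail c2 d2⟩
  have hqc : ((1 - p : ℝ) : ℂ) = 1 - (p : ℂ) := by push_cast; rfl
  -- The cancellation behind the theorem: the weight 1/(1-p) undoes the probability with which the
  -- middle terms are used.
  have hcomb : (p : ℂ) * f₁ + ((1 - p : ℝ) : ℂ) * f₂ = expPartial K₂ z := by
    have hqc' : (1 - p : ℂ) ≠ 0 := by exact_mod_cast hq.ne'
    rw [hf₁', hf₂', hfm]
    push_cast
    field_simp
    ring
  have him : p * (f₁ * star u).im + (1 - p) * (f₂ * star u).im =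
      ((expPartial K₂ z - u) * star u).im := by
    have huu : (u * star u).im = 0 := by rw [mul_star_eq, hzu]; simp
    have e : (expPartial K₂ z - u) * star u =
        (p : ℂ) * (f₁ * star u) + ((1 - p : ℝ) : ℂ) * (f₂ * star u) - u * star u := by
      rw [← hcomb]
      ring
    rw [e, Complex.sub_im, Complex.add_im, Complex.im_ofReal_mul, Complex.im_ofReal_mul, huu,
      sub_zero]
  have himn : |p * (f₁ * star u).im + (1 - p) * (f₂ * star u).im| ≤ expTail K₂ := by
    rw [him]
    refine (Complex.abs_im_le_norm _).trans ?_
    rw [norm_mul, norm_star, hzu, mul_one]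
    exact hm
  -- The second-order remainders are bounded separately; the first-order phase errors are averaged
  -- before taking norms.
  have e : p * v₁ + ((1 - p : ℝ) : ℂ) * v₂ - u =
      (p : ℂ) * (v₁ - u - ((f₁ * star u).im : ℂ) * Complex.I * u) +
        ((1 - p : ℝ) : ℂ) * (v₂ - u - ((f₂ * star u).im : ℂ) * Complex.I * u) +
        ((p * (f₁ * star u).im + (1 - p) * (f₂ * star u).im : ℝ) : ℂ) * (Complex.I * u) := by
    push_cast
    ring
  rw [e]
  refine (norm_add_le _ _).trans (add_le_add ((norm_add_le _ _).trans (add_le_add ?_ ?_)) ?_)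
  · rw [norm_mul, Complex.norm_real, Real.norm_of_nonneg hp0]
    exact mul_le_mul_of_nonneg_left b1 hp0
  · rw [norm_mul, Complex.norm_real, Real.norm_of_nonneg hq.le]
    exact mul_le_mul_of_nonneg_left b2 hq.le
  · rw [norm_mul, norm_mul, Complex.norm_I, hzu, Complex.norm_real, one_mul, mul_one]
    exact himn

open scoped Matrix.Norms.L2Operator in
theorem norm_hamiltonian_le {n L : ℕ} {α : Fin L → ℝ} (hα : ∀ l, 0 ≤ α l)
    (Hl : Fin L → Matrix.unitaryGroup (Basis (Fin n)) ℂ) : ‖hamiltonian α Hl‖ ≤ ∑ l, α l := by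
  refine norm_sum_le_of_le _ fun l _ => ?_
  rw [norm_smul, Complex.norm_real, Real.norm_of_nonneg (hα l)]
  exact mul_le_of_le_one_right (hα l)
    (norm_le_one_of_conjTranspose_mul_self (Matrix.mem_unitaryGroup_iff'.1 (Hl l).2))

section Segment

variable {n L : ℕ} {α : Fin L → ℝ} {Hl : Fin L → Matrix.unitaryGroup (Basis (Fin n)) ℂ}
  {τ p s₁ : ℝ} {K₁ K₂ : ℕ}

open scoped Matrix.Norms.L2Operator in
-- All operators are diagonal in an eigenbasis of H, and ‖H‖ ≤ ∑ α_l puts each exponent -iτλ in the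
-- disc of radius ln 2. Operator norms are then controlled by the eigenvalues.
theorem mixed_operator_bounds (hα : ∀ l, 0 ≤ α l) (hH : (hamiltonian α Hl).IsHermitian)
    (hτ : τ * ∑ l, α l = Real.log 2) (hτ0 : 0 ≤ τ) (h12 : K₁ ≤ K₂) (hp0 : 0 ≤ p) (hp : p < 1)
    (hs₁ : coeffSum K₁ weight₁ τ α ≤ s₁) (hs₁2 : s₁ ≤ 2)
    (hs₂ : coeffSum K₂ (weight₂ p K₁) τ α ≤ sTwo) {U V₁ V₂ : Op (Fin n)}
    (hU : U = idealU (hamiltonian α Hl) τ) (hV₁ : V₁ = amp₁ s₁ (F₁ (hamiltonian α Hl) τ K₁))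
    (hV₂ : V₂ = amp₂ sTwo (F₂ (hamiltonian α Hl) τ p K₁ K₂)) :
    ‖U‖ ≤ 1 ∧ (‖V₁ - U‖ ^ 2 ≤ 16.6 * expTail K₁ ^ 2 ∧
      ‖V₂ - U‖ ^ 2 ≤ 6.8 * (expTail K₁ / (1 - p)) ^ 2 ∧
      ‖(p : ℂ) • V₁ + ((1 - p : ℝ) : ℂ) • V₂ - U‖ ≤ p * (11.1 * expTail K₁ ^ 2) +
        (1 - p) * (4.2 * (expTail K₁ / (1 - p)) ^ 2) + expTail K₂) ∧
    (‖1 - V₁ᴴ * V₁‖ ≤ 12.6 * expTail K₁ ^ 2 ∧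
      ‖1 - V₂ᴴ * V₂‖ ≤ 2.8 * (expTail K₁ / (1 - p)) ^ 2) := by
  obtain ⟨Q, hQ, hspec⟩ := exists_spectralOp hH
  have hd : ∀ i, |hH.eigenvalues i| ≤ ∑ l, α l := fun i =>
    (norm_eigenvalues_le hH i).trans (norm_hamiltonian_le hα Hl)
  generalize hH.eigenvalues = d at hspec hd
  set z : Basis (Fin n) → ℂ := fun i => -(Complex.I * τ) * d i with hz
  have hzn : ∀ i, ‖z i‖ ≤ Real.log 2 := fun i => by
    rw [hz, ← hτ]
    simp only [norm_mul, norm_neg, Complex.norm_I, Complex.norm_real, Real.norm_of_nonneg hτ0,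
      one_mul, Real.norm_eq_abs]
    exact mul_le_mul_of_nonneg_left (hd i) hτ0
  have hzu : ∀ i, ‖Complex.exp (z i)‖ = 1 := fun i => by
    rw [show z i = ((-(τ * d i) : ℝ) : ℂ) * Complex.I by simp only [hz]; push_cast; ring]
    exact Complex.norm_exp_ofReal_mul_I _
  have hU' : U = spectralOp Q fun i => Complex.exp (z i) := by
    rw [hU, spectralOp_exp hQ, idealU, hspec, ← spectralOp_smul]
  set v₁ : Basis (Fin n) → ℂ := fun i => scalarAmp₁ s₁
    (∑ k ∈ Finset.range (K₁ + 1), (weight₁ k : ℂ) • (z i ^ k / k.factorial)) with hv₁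
  set v₂ : Basis (Fin n) → ℂ := fun i => scalarAmp₂ sTwo
    (∑ k ∈ Finset.range (K₂ + 1), (weight₂ p K₁ k : ℂ) • (z i ^ k / k.factorial)) with hv₂
  have hV₁' : V₁ = spectralOp Q v₁ := by
    rw [hV₁, ← weightedSeries_weight₁, hspec, weightedSeries_spectralOp hQ, amp₁_spectralOp hQ]
  have hV₂' : V₂ = spectralOp Q v₂ := by
    rw [hV₂, ← weightedSeries_weight₂ _ _ _ h12, hspec, weightedSeries_spectralOp hQ,
      amp₂_spectralOp hQ]
  rw [coeffSum_eq, hτ] at hs₁ hs₂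
  have key := fun i => mixed_scalar_bounds hp0 hp h12 (hzn i) (hzu i) hs₁2 hs₁ hs₂
    (v₁ := v₁ i) (v₂ := v₂ i) rfl rfl
  have hq : 0 < 1 - p := sub_pos.2 hp
  have hK0 := expTail_nonneg K₂
  have hsq : ∀ {A : Op (Fin n)} {g : Basis (Fin n) → ℂ} {b : ℝ}, A = spectralOp Q g → 0 ≤ b →
      (∀ i, ‖g i‖ ^ 2 ≤ b) → ‖A‖ ^ 2 ≤ b := by
    rintro A g b rfl hb hg
    have := norm_spectralOp_le hQ (Real.sqrt_nonneg b) fun i => Real.le_sqrt_of_sq_le (hg i)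
    calc _ ≤ √b ^ 2 := pow_le_pow_left₀ (norm_nonneg _) this 2
      _ = b := Real.sq_sqrt hb
  refine ⟨?_, ⟨?_, ?_, ?_⟩, ?_, ?_⟩
  · rw [hU']
    exact norm_spectralOp_le hQ zero_le_one fun i => (hzu i).le
  · exact hsq (g := fun i => v₁ i - Complex.exp (z i)) (by rw [spectralOp_sub, hV₁', hU'])
      (by positivity) fun i => (key i).1.1
  · exact hsq (g := fun i => v₂ i - Complex.exp (z i)) (by rw [spectralOp_sub, hV₂', hU'])
      (by positivity) fun i => (key i).1.2.1
  · rw [hV₁', hV₂', hU', ← spectralOp_smul, ← spectralOp_smul, ← spectralOp_add,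
      ← spectralOp_sub]
    exact norm_spectralOp_le hQ (by positivity) fun i => (key i).1.2.2
  · rw [hV₁', ← spectralOp_conjTranspose, ← spectralOp_mul hQ, ← spectralOp_one hQ,
      ← spectralOp_sub]
    exact norm_spectralOp_le hQ (by positivity) fun i => (key i).2.1
  · rw [hV₂', ← spectralOp_conjTranspose, ← spectralOp_mul hQ, ← spectralOp_one hQ,
      ← spectralOp_sub]
    exact norm_spectralOp_le hQ (by positivity) fun i => (key i).2.2

/-! ### Collecting the constants -/

theorem mul_le_inv_four {p q : ℝ} (hpq : p + q = 1) (hq : 0 < q) : p ≤ 1 / 4 * (1 / q) := by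
  rw [mul_one_div, le_div_iff₀ hq]
  nlinarith [sq_nonneg (p - q)]

/-- With X = r²/(1-p) and p r² ≤ X/4, the left side is at most 24.9 X + 2ε. Since 24.9/40 + 2/8 < 1,
the maximum dominates it. -/
theorem mixed_error_arith {p r t δ ε : ℝ} (hp : p < 1) (hr : 0 ≤ r) (hrδ : r ≤ δ) (ht : t ≤ ε) :
    p * (16.6 * r ^ 2) + (1 - p) * (6.8 * (r / (1 - p)) ^ 2) +
        2 * (p * (11.1 * r ^ 2) + (1 - p) * (4.2 * (r / (1 - p)) ^ 2) + t) ≤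
      max (40 / (1 - p) * δ ^ 2) (8 * ε) := by
  have hq : 0 < 1 - p := sub_pos.2 hp
  set X := 1 / (1 - p) * r ^ 2 with hX
  have e1 : (1 - p) * (r / (1 - p)) ^ 2 = X := by rw [hX]; field_simp
  have h1 : p * r ^ 2 ≤ 1 / 4 * X := by
    have := mul_le_mul_of_nonneg_right (mul_le_inv_four (add_sub_cancel p 1) hq) (sq_nonneg r)
    rw [hX]
    linarith
  have h2 : X ≤ 1 / (1 - p) * δ ^ 2 := by
    rw [hX]
    gcongr
  have h3 := le_max_left (40 / (1 - p) * δ ^ 2) (8 * ε)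
  have h4 := le_max_right (40 / (1 - p) * δ ^ 2) (8 * ε)
  have h5 : 40 / (1 - p) * δ ^ 2 = 40 * (1 / (1 - p) * δ ^ 2) := by ring
  have h6 : 0 ≤ X := by positivity
  rw [h5] at h3 h4 ⊢
  linarith

/-- The same estimate gives 12.6/4 + 2.8 < 8, so the quadratic term alone suffices and 4δ ≥ 0 is
slack. -/
theorem mixed_failure_arith {p r δ : ℝ} (hp : p < 1) (hr : 0 ≤ r) (hrδ : r ≤ δ) :
    p * (12.6 * r ^ 2) + (1 - p) * (2.8 * (r / (1 - p)) ^ 2) ≤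
      8 / (1 - p) * δ ^ 2 + 4 * δ := by
  have hq : 0 < 1 - p := sub_pos.2 hp
  set X := 1 / (1 - p) * r ^ 2 with hX
  have e1 : (1 - p) * (r / (1 - p)) ^ 2 = X := by rw [hX]; field_simp
  have h1 : p * r ^ 2 ≤ 1 / 4 * X := by
    have := mul_le_mul_of_nonneg_right (mul_le_inv_four (add_sub_cancel p 1) hq) (sq_nonneg r)
    rw [hX]
    linarith
  have h2 : X ≤ 1 / (1 - p) * δ ^ 2 := by
    rw [hX]
    gcongr
  have h5 : 8 / (1 - p) * δ ^ 2 = 8 * (1 / (1 - p) * δ ^ 2) := by ring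
  have h6 : 0 ≤ X := by positivity
  rw [h5]
  linarith

end Segment

end RTS

end

/-! ### The main theorem -/

theorem corollary1 (κ : ℕ) :
    ∃ (C : ℝ) (e : ℕ), ∀ (n L : ℕ), 1 ≤ n →
      ∀ (α : Fin L → ℝ) (Hl : Fin L → Matrix.unitaryGroup (RTS.Basis (Fin n)) ℂ)
        (τ p s₁ : ℝ) (K₁ K₂ : ℕ),
      -- the Hamiltonian, given as a linear combination of efficiently simulatable unitaries
      (∀ l, 0 ≤ α l) →
      (RTS.hamiltonian α Hl).IsHermitian →
      (∀ l, ∃ c : RTS.Circuit (Unit ⊕ Fin n),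
        c.length ≤ κ * n ∧ c.op = RTS.controlled (Hl l : RTS.Op (Fin n))) →
      -- one segment
      τ * ∑ l, α l = Real.log 2 →
      -- truncation orders and mixing probability
      K₁ ≤ K₂ → 1 ≤ K₂ → 0 ≤ p → p < 1 →
      -- `s₁ ≈ 2`, between the sum of the coefficients of `F₁` and its limit `2`
      RTS.coeffSum K₁ RTS.weight₁ τ α ≤ s₁ → s₁ ≤ 2 →
      -- the coefficients of `F₂` can be brought up to the sum `s₂ = 1 / sin (π / 10)`
      RTS.coeffSum K₂ (RTS.weight₂ p K₁) τ α ≤ RTS.sTwo →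
      -- error of the mixed channel
      (∀ ρ : RTS.Op (Fin n), RTS.IsDensity ρ →
        RTS.traceNorm
          (RTS.mixChannel p
              (RTS.amp₁ s₁ (RTS.F₁ (RTS.hamiltonian α Hl) τ K₁))
              (RTS.amp₂ RTS.sTwo (RTS.F₂ (RTS.hamiltonian α Hl) τ p K₁ K₂)) ρ -
            RTS.idealU (RTS.hamiltonian α Hl) τ * ρ * (RTS.idealU (RTS.hamiltonian α Hl) τ)ᴴ)
          ≤ max (40 / (1 - p) * RTS.delta K₁ ^ 2) (8 * RTS.delta K₂)) ∧
      -- the segment circuits perform `V₁` and `V₂`, and fail with small probability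
      (∀ (S₁ : RTS.Segment K₁ RTS.weight₁ τ α Hl s₁ 1)
          (S₂ : RTS.Segment K₂ (RTS.weight₂ p K₁) τ α Hl RTS.sTwo 2),
        S₁.block = RTS.amp₁ s₁ (RTS.F₁ (RTS.hamiltonian α Hl) τ K₁) ∧
        S₂.block = RTS.amp₂ RTS.sTwo (RTS.F₂ (RTS.hamiltonian α Hl) τ p K₁ K₂) ∧
        ∀ ρ : RTS.Op (Fin n), RTS.IsDensity ρ →
          1 - (p * S₁.successProb ρ + (1 - p) * S₂.successProb ρ)
            ≤ 8 / (1 - p) * RTS.delta K₁ ^ 2 + 4 * RTS.delta K₁) ∧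
      -- and they exist with expected gate count `Õ(n L (p K₁ + (1 - p) K₂))`
      (∃ (S₁ : RTS.Segment K₁ RTS.weight₁ τ α Hl s₁ 1)
          (S₂ : RTS.Segment K₂ (RTS.weight₂ p K₁) τ α Hl RTS.sTwo 2),
        p * (S₁.cost : ℝ) + (1 - p) * (S₂.cost : ℝ) ≤
          C * (n * L * (p * K₁ + (1 - p) * K₂)) *
            Real.log (2 + n * L * (p * K₁ + (1 - p) * K₂)) ^ e) := by
  -- The exponent 0 means that no logarithmic factor is needed. The outer 5 comes from M + 1 ≤ 5M
  -- for the mean order M, by `one_le_mean_order`.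
  refine ⟨5 * (5 * κ + 250), 0, ?_⟩
  intro n L hn α Hl τ p s₁ K₁ K₂ hα hH hHl hτ h12 hK₂ hp0 hp hs₁ hs₁2 hs₂
  have hlog : 0 < Real.log 2 := Real.log_pos one_lt_two
  have hq : 0 < 1 - p := sub_pos.2 hp
  have hA0 : 0 ≤ ∑ l, α l := Finset.sum_nonneg fun l _ => hα l
  have hApos : 0 < ∑ l, α l := hA0.lt_of_ne fun h => by
    rw [← h, mul_zero] at hτ
    exact hlog.ne hτ
  have hτ0 : 0 ≤ τ := (pos_of_mul_pos_left (hτ ▸ hlog) hA0).le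
  have hs₁0 : 0 < s₁ := by
    refine lt_of_lt_of_le ?_ hs₁
    rw [RTS.coeffSum_eq, hτ]
    exact Finset.sum_pos (fun k _ => mul_pos one_pos
      (div_pos (pow_pos hlog _) (Nat.cast_pos.2 (Nat.factorial_pos _)))) ⟨0, by simp⟩
  have hs₂0 : 0 < RTS.sTwo := by linarith [RTS.sTwo_gt]
  have hβ₁ := RTS.lcuCoeff_nonneg (K := K₁) RTS.weight₁_nonneg hτ0 hα hs₁
  have hβ₂ := RTS.lcuCoeff_nonneg (K := K₂) (RTS.weight₂_nonneg hp K₁) hτ0 hα hs₂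
  obtain ⟨hU, ⟨e1, e2, e3⟩, g1, g2⟩ :=
    RTS.mixed_operator_bounds hα hH hτ hτ0 h12 hp0 hp hs₁ hs₁2 hs₂ rfl rfl rfl
  have hr := RTS.expTail_nonneg K₁
  have hrδ := RTS.expTail_le_delta K₁
  refine ⟨fun ρ hρ => ?_, fun S₁ S₂ => ?_, ?_⟩
  · exact (RTS.traceNorm_mixChannel_sub_le hp0 hp.le hU e1 e2 e3 hρ.1 hρ.2).trans
      (RTS.mixed_error_arith hp hr hrδ (RTS.expTail_le_delta K₂))
  · have hb₁ : S₁.block = RTS.amp₁ s₁ (RTS.F₁ (RTS.hamiltonian α Hl) τ K₁) := by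
      rw [S₁.block_one hs₁0 hβ₁, RTS.weightedSeries_weight₁]
    have hb₂ : S₂.block = RTS.amp₂ RTS.sTwo (RTS.F₂ (RTS.hamiltonian α Hl) τ p K₁ K₂) := by
      rw [S₂.block_two hs₂0 hβ₂, RTS.weightedSeries_weight₂ _ _ _ h12]
    refine ⟨hb₁, hb₂, fun ρ hρ => ?_⟩
    have f1 := RTS.one_sub_trace_re_le g1 hρ.1 hρ.2
    have f2 := RTS.one_sub_trace_re_le g2 hρ.1 hρ.2
    rw [S₁.successProb_eq, S₂.successProb_eq, hb₁, hb₂]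
    have k1 := mul_le_mul_of_nonneg_left f1 hp0
    have k2 := mul_le_mul_of_nonneg_left f2 hq.le
    have k3 := RTS.mixed_failure_arith hp hr hrδ
    linarith
  · have hHl' : ∀ l, RTS.Implementable (RTS.controlled (Hl l : RTS.Op (Fin n))) (κ * n) :=
      fun l => let ⟨c, h1, h2⟩ := hHl l; ⟨c, h2, h1⟩
    obtain ⟨S₁, hS₁⟩ := RTS.exists_taylor_segment (K := K₁) (rounds := 1) hn RTS.weight₁_nonneg
      hτ0 hα hApos hHl' hs₁0 hs₁ (by norm_num)
    obtain ⟨S₂, hS₂⟩ := RTS.exists_taylor_segment (K := K₂) (rounds := 2) hn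
      (RTS.weight₂_nonneg hp K₁) hτ0 hα hApos hHl' hs₂0 hs₂ le_rfl
    refine ⟨S₁, S₂, ?_⟩
    have c1 : (S₁.cost : ℝ) ≤ (5 * κ + 250) * (n * L * (K₁ + 1)) := by exact_mod_cast hS₁
    have c2 : (S₂.cost : ℝ) ≤ (5 * κ + 250) * (n * L * (K₂ + 1)) := by exact_mod_cast hS₂
    have hX : (0 : ℝ) ≤ (5 * κ + 250) * (n * L) := by positivity
    have h1 := RTS.one_le_mean_order hτ h12 hK₂ hp0 hp hs₂
    rw [pow_zero, mul_one]
    calc p * (S₁.cost : ℝ) + (1 - p) * (S₂.cost : ℝ)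
        ≤ p * ((5 * κ + 250) * (n * L * (K₁ + 1))) +
          (1 - p) * ((5 * κ + 250) * (n * L * (K₂ + 1))) :=
          add_le_add (mul_le_mul_of_nonneg_left c1 hp0) (mul_le_mul_of_nonneg_left c2 hq.le)
      _ = (5 * κ + 250) * (n * L) * (p * K₁ + (1 - p) * K₂ + 1) := by ring
      _ ≤ (5 * κ + 250) * (n * L) * (5 * (p * K₁ + (1 - p) * K₂)) :=
          mul_le_mul_of_nonneg_left (by linarith) hX
      _ = _ := by ring
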